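/- **Conventions.** Manifolds are smooth and finite dimensional, without boundary. Let $(\mathbf G,\mathbf H,\rho,\jmath)$ be a crossed module of finite dimensional Lie groups: $\rho:\mathbf G\to\mathbf H$ and $\jmath:\mathbf H\to\mathrm{Aut}(\mathbf G)$ are Lie group homomorphisms (for $\jmath$: the action $\mathbf H\times\mathbf G\to\mathbf G$, $(h,g)\mapsto h(g):=\jmath(h)(g)$ is smooth) with $\rho(h(g))=h\rho(g)h^{-1}$ and $\rho(g)(g')=gg'g^{-1}$. Let $N$ be a (Hausdorff, second countable) manifold and $\mathcal U=(U_i)_{i\in I}$ an open cover of $N$; write $U_{ij}=U_i\cap U_j$, $U_{ijk}=U_i\cap U_j\cap U_k$, and $x_i,x_{ij},x_{ijk}$ for a point $x$ seen in $U_i,U_{ij},U_{ijk}$. The Čech groupoid $N[\mathcal U]$ is $\coprod U_{ij}\rightrightarrows\coprod U_i$ with source $x_{ij}\mapsto x_i$, target $x_{ij}\mapsto x_j$ and product $x_{ij}\bullet x_{jk}=x_{ik}$ (in every groupoid $a\bullet b$ is defined when $t(a)=s(b)$). **Cohomology.** A $1$-cocycle is a pair of smooth maps $\lambda:\coprod U_{ij}\to\mathbf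 H$, $\mathbf g:\coprod U_{ijk}\to\mathbf G$ with $\rho(\mathbf g_{ijk})\lambda_{ik}=\lambda_{ij}\lambda_{jk}$, $\mathbf g_{ijk}\mathbf g_{ikl}=\lambda_{ij}(\mathbf g_{jkl})\mathbf g_{ijl}$, $\mathbf g_{iij}=e$. Two cocycles $(\lambda,\mathbf g)$, $(\lambda',\mathbf g')$ are cohomologous if there are smooth maps $r:\coprod U_i\to\mathbf H$, $\mathbf v:\coprod U_{ij}\to\mathbf G$ with $\lambda'_{ij}=\rho(\mathbf v_{ij})r_i\lambda_{ij}r_j^{-1}$ and $\mathbf g'_{ijk}\mathbf v_{ik}=\lambda'_{ij}(\mathbf v_{jk})\mathbf v_{ij}r_i(\mathbf g_{ijk})$. This is an equivalence relation; $H^1_{\mathcal U}(\mathbf G\to\mathbf H)$ is the quotient set. **Extensions.** A $\mathbf G\to\mathbf H$-extension of a Lie groupoid $\mathcal G\rightrightarrows M$ is a triple $(\mathcal R\xrightarrow{\varphi}\mathcal G,\ P\xrightarrow{\pi}M,\ \chi)$ where: $\mathcal R\rightrightarrows M$ is a Lie groupoid, and $\varphi$ is a Lie groupoid morphism over $\mathrm{id}_M$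 and a surjective submersion whose kernel $K=\varphi^{-1}(\epsilon(M))$ is, as a bundle of Lie groups over $M$, locally isomorphic to $\mathbf G\times V$, $V\subseteq M$ open; $P\to M$ is a (right) principal $\mathbf H$-bundle with a smooth left action of $\mathcal R$ (an action of $\gamma$ on $p$ being defined when $t(\gamma)=\pi(p)$, with $\pi(\gamma\cdot p)=s(\gamma)$) commuting with the $\mathbf H$-action; and $\chi$ assigns to each $p\in P$ a Lie group isomorphism $\chi(p):\mathbf G\to K_{\pi(p)}$, such that $(p,g)\mapsto\chi(p)(g)$ is smooth, $\chi(p\cdot h)=\chi(p)\circ\jmath(h)$, $\chi(\gamma\cdot p)(g)=\gamma\bullet\chi(p)(g)\bullet\gamma^{-1}$, and $p\cdot\rho(g)=\chi(p)(g)\cdot p$. An isomorphism between two such extensions of $\mathcal G$ is a pair of diffeomorphisms $\Phi:\mathcal R\to\mathcal R'$, $\Psi:P\to P'$ such that $\Phi$ is a groupoid morphism with $\varphi'\circ\Phi=\varphi$, $\Psi$ is over $\mathrm{id}_M$ with $\Psi(\gamma\cdot p\cdot h)=\Phi(\gamma)\cdot\Psi(p)\cdot h$, and $\Phi(\chi(p)(g))=\chi'(\Psi(p))(g)$.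 An extension of $N[\mathcal U]$ is *adapted* if $\mathcal R=\mathbf G\times\coprod U_{ij}$ with $\varphi$ the projection; $P=\coprod U_i\times\mathbf H$ with $\pi$ the projection and $(x_i,h)\cdot h'=(x_i,hh')$; $\chi(x_i,h)(g)=(h(g),x_{ii})$; and $(g,x_{ii})\bullet(g',x_{ij})=(gg',x_{ij})$. **Theorem.** Assume that every nonempty $U_{ij}$, $i,j\in I$, is contractible. Then the following three sets are in one-to-one correspondence: 1. $H^1_{\mathcal U}(\mathbf G\to\mathbf H)$; 2. adapted $\mathbf G\to\mathbf H$-extensions of $N[\mathcal U]$ up to isomorphism of $\mathbf G\to\mathbf H$-extensions of $N[\mathcal U]$; 3. $\mathbf G\to\mathbf H$-extensions of $N[\mathcal U]$ up to isomorphism of $\mathbf G\to\mathbf H$-extensions of $N[\mathcal U]$. More precisely, every adapted extension $A$, with groupoid product $\bullet$ and action $\star$ of $\mathcal R$ on $P$, has an associated $1$-cocycle $(\lambda,\mathbf g)$ determined by $(e,x_{ij})\star(x_j,e)=(x_i,\lambda_{ij}(x))$ and $(e,x_{ij})\bullet(e,x_{jk})=(\mathbf g_{ijk}(x),x_{ik})$;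 there is a bijection from set 1 to set 2 which maps the class of the cocycle associated with $A$ to the class of $A$, for every adapted $A$; and the map from set 2 to set 3 that sends the class of $A$ to the class of $A$ is well defined and bijective. -/

import Mathlib

open Set Function TopologicalSpace Topology Manifold
open scoped Manifold ContDiff

universe u

noncomputable section

/-! ### Disjoint unions of manifolds -/

section DisjointUnion

variable {ι : Type*} {X : ι → Type*} [∀ i, TopologicalSpace (X i)]
  {HM : Type*} [TopologicalSpace HM] [Nonempty HM] [∀ i, ChartedSpace HM (X i)]

/-- The disjoint union of a family of charted spaces: the charts are those of the summands. -/
instance sigmaChartedSpace : ChartedSpace HM (Σ i, X i) where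
  atlas := {e | ∃ i, ∃ f ∈ atlas HM (X i),
    e = f.lift_openEmbedding (X' := Σ i, X i) IsOpenEmbedding.sigmaMk}
  chartAt p := (chartAt HM p.2).lift_openEmbedding (X' := Σ i, X i) IsOpenEmbedding.sigmaMk
  mem_chart_source p := ⟨p.2, mem_chart_source HM p.2, rfl⟩
  chart_mem_atlas p := ⟨p.1, _, chart_mem_atlas HM p.2, rfl⟩

theorem sigma_chartAt (p : Σ i, X i) :
    chartAt HM p =
      (chartAt HM p.2).lift_openEmbedding (X' := Σ i, X i) IsOpenEmbedding.sigmaMk := rfl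

instance sigmaIsManifold {EM : Type*} [NormedAddCommGroup EM] [NormedSpace ℝ EM]
    {IM : ModelWithCorners ℝ EM HM} [∀ i, IsManifold IM ∞ (X i)] :
    IsManifold IM ∞ (Σ i, X i) where
  compatible := by
    rintro e e' ⟨i, f, hf, rfl⟩ ⟨j, f', hf', rfl⟩
    by_cases hij : i = j
    · subst hij
      rw [OpenPartialHomeomorph.lift_openEmbedding_trans]
      exact HasGroupoid.compatible hf hf'
    · apply ContDiffGroupoid.mem_of_source_eq_empty
      ext x
      constructor
      · rintro ⟨_, h2⟩
        obtain ⟨y, _, hy⟩ := h2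
        have := congrArg Sigma.fst hy
        exact absurd this.symm hij
      · exact fun h => h.elim

end DisjointUnion

section Coproduct

variable {EN : Type*} [NormedAddCommGroup EN] [NormedSpace ℝ EN]
  {N : Type*} [TopologicalSpace N] [ChartedSpace EN N]

/-- The disjoint union `∐ Vᵢ` of a family of open subsets of `N`. -/
abbrev Coprod {ι : Type*} (V : ι → Opens N) := Σ i, (V i : Type _)

/-- The point of `N` underlying a point of `∐ Vᵢ`. -/
def Coprod.val {ι : Type*} {V : ι → Opens N} (p : Coprod V) : N := p.2.1

/-- The map `∐ Wⱼ → ∐ Vᵢ` made of the inclusions `Wⱼ ⊆ V_{k j}`. -/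
def Coprod.incl {ι κ : Type*} {W : κ → Opens N} {V : ι → Opens N} (k : κ → ι)
    (h : ∀ j, W j ≤ V (k j)) (p : Coprod W) : Coprod V := ⟨k p.1, p.2.1, h p.1 p.2.2⟩

theorem Coprod.chartAt_mk {ι : Type*} {V : ι → Opens N} (p : Coprod V) (i : ι) (hi : p.1 = i)
    (y : N) (hy : y ∈ V i) :
    chartAt EN p (⟨i, y, hy⟩ : Coprod V) = chartAt EN p.val y := by
  subst hi
  rw [sigma_chartAt, OpenPartialHomeomorph.lift_openEmbedding_apply]
  rfl

theorem Coprod.continuous_incl {ι κ : Type*} {W : κ → Opens N} {V : ι → Opens N} (k : κ → ι)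
    (h : ∀ j, W j ≤ V (k j)) : Continuous (Coprod.incl k h : Coprod W → Coprod V) := by
  refine continuous_sigma fun j => ?_
  have h1 : Continuous (fun a : W j => (⟨a.1, h j a.2⟩ : V (k j))) :=
    Continuous.subtype_mk continuous_subtype_val _
  exact (continuous_sigmaMk (σ := fun i => (V i : Type _))).comp h1

variable [IsManifold 𝓘(ℝ, EN) ∞ N]

theorem Coprod.incl_isSubmersion {ι κ : Type*} {W : κ → Opens N} {V : ι → Opens N} (k : κ → ι)
    (h : ∀ j, W j ≤ V (k j)) :
    IsSubmersion 𝓘(ℝ, EN) 𝓘(ℝ, EN) ∞ (Coprod.incl k h : Coprod W → Coprod V) := by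
  refine IsSubmersionOfComplement.isSubmersion (F := PUnit) fun x => ?_
  refine IsSubmersionAtOfComplement.mk_of_continuousAt
    (Coprod.continuous_incl k h).continuousAt
    (ContinuousLinearEquiv.prodUnique ℝ EN PUnit).symm
    (chartAt EN x) (chartAt EN (Coprod.incl k h x)) (mem_chart_source _ _) (mem_chart_source _ _)
    (IsManifold.chart_mem_maximalAtlas _) (IsManifold.chart_mem_maximalAtlas _) ?_
  intro z hz
  have hz' : z ∈ (chartAt EN x).target := by simpa using hz
  obtain ⟨y, hy, hyz⟩ : ∃ y : W x.1, (chartAt EN x).symm z = ⟨x.1, y⟩ ∧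
      chartAt EN x.val y.1 = z := by
    have h1 := (chartAt EN x).map_target hz'
    obtain ⟨y, hy1, hy2⟩ := h1
    refine ⟨y, hy2.symm, ?_⟩
    have := (chartAt EN x).right_inv hz'
    rw [← hy2] at this
    rw [← this]
    exact (Coprod.chartAt_mk x x.1 rfl y.1 y.2).symm
  simp only [comp_apply, OpenPartialHomeomorph.extend_coe_symm, OpenPartialHomeomorph.extend_coe,
    modelWithCornersSelf_coe, modelWithCornersSelf_coe_symm, id]
  rw [hy]
  have : (Coprod.incl k h ⟨x.1, y⟩ : Coprod V) = ⟨k x.1, y.1, h _ y.2⟩ := rfl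
  rw [this, Coprod.chartAt_mk (Coprod.incl k h x) (k x.1) rfl]
  exact hyz

theorem Coprod.contMDiff_val {ι : Type*} {V : ι → Opens N} :
    ContMDiff 𝓘(ℝ, EN) 𝓘(ℝ, EN) ∞ (Coprod.val : Coprod V → N) := by
  intro x
  have hc : Continuous (Coprod.val : Coprod V → N) :=
    continuous_sigma fun i => continuous_subtype_val
  rw [contMDiffAt_iff_target]
  refine ⟨hc.continuousAt, ?_⟩
  refine (contMDiffAt_extChartAt (I := 𝓘(ℝ, EN)) (x := x)).congr_of_eventuallyEq ?_
  filter_upwards [chart_source_mem_nhds EN x] with p hp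
  obtain ⟨y, hy, rfl⟩ := hp
  simp only [comp_apply, extChartAt_coe, modelWithCornersSelf_coe, id]
  exact (Coprod.chartAt_mk x x.1 rfl y.1 y.2).symm

theorem Coprod.contMDiffWithinAt_of_val {ι : Type*} {V : ι → Opens N}
    {EZ HZ Z : Type*} [NormedAddCommGroup EZ] [NormedSpace ℝ EZ] [TopologicalSpace HZ]
    {IZ : ModelWithCorners ℝ EZ HZ} [TopologicalSpace Z] [ChartedSpace HZ Z]
    {f : Z → Coprod V} {s : Set Z} {z : Z} (hi : ∀ᶠ w in 𝓝[s] z, (f w).1 = (f z).1)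
    (hv : ContMDiffWithinAt IZ 𝓘(ℝ, EN) ∞ (fun w => (f w).val) s z) :
    ContMDiffWithinAt IZ 𝓘(ℝ, EN) ∞ f s z := by
  rw [contMDiffWithinAt_iff_target] at hv ⊢
  obtain ⟨hc, hs⟩ := hv
  constructor
  · intro t ht
    obtain ⟨i, hfi⟩ : ∃ i, (f z).1 = i := ⟨_, rfl⟩
    have h1 : Sigma.mk (f z).1 ⁻¹' t ∈ 𝓝 (f z).2 := by
      rw [show f z = ⟨(f z).1, (f z).2⟩ from rfl, Sigma.nhds_mk] at ht
      exact ht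
    rw [nhds_subtype_eq_comap, Filter.mem_comap] at h1
    obtain ⟨t', ht', hsub⟩ := h1
    have h2 : ∀ᶠ w in 𝓝[s] z, (f w).val ∈ t' := hc ht'
    rw [Filter.mem_map]
    filter_upwards [hi, h2] with w hw1 hw2
    have key : ∀ p : Coprod V, p.1 = (f z).1 → p.val ∈ t' → p ∈ t := by
      rintro ⟨j, y⟩ hj hy
      dsimp at hj
      subst hj
      exact hsub hy
    exact key _ hw1 hw2
  · refine hs.congr_of_eventuallyEq ?_ ?_
    · filter_upwards [hi] with w hw
      have key : ∀ p : Coprod V, p.1 = (f z).1 →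
          extChartAt 𝓘(ℝ, EN) (f z) p = extChartAt 𝓘(ℝ, EN) (f z).val p.val := by
        rintro ⟨j, y⟩ hj
        simp only [extChartAt_coe, comp_apply, modelWithCornersSelf_coe, id]
        exact Coprod.chartAt_mk (f z) j hj.symm y.1 y.2
      exact key _ hw
    · simp only [extChartAt_coe, comp_apply, modelWithCornersSelf_coe, id]
      exact Coprod.chartAt_mk (f z) (f z).1 rfl (f z).2.1 (f z).2.2

end Coproduct

/-! ### Lie groupoids, extensions and principal bundles -/

section General

variable {EG HG EH HH EM HM EΓ HΓ ER HR ES HS EP HP EQ HQ ET HT ED HD : Type*}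
  [NormedAddCommGroup EG] [NormedSpace ℝ EG] [TopologicalSpace HG]
  [NormedAddCommGroup EH] [NormedSpace ℝ EH] [TopologicalSpace HH]
  [NormedAddCommGroup EM] [NormedSpace ℝ EM] [TopologicalSpace HM]
  [NormedAddCommGroup EΓ] [NormedSpace ℝ EΓ] [TopologicalSpace HΓ]
  [NormedAddCommGroup ER] [NormedSpace ℝ ER] [TopologicalSpace HR]
  [NormedAddCommGroup ES] [NormedSpace ℝ ES] [TopologicalSpace HS]
  [NormedAddCommGroup EP] [NormedSpace ℝ EP] [TopologicalSpace HP]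
  [NormedAddCommGroup EQ] [NormedSpace ℝ EQ] [TopologicalSpace HQ]
  [NormedAddCommGroup ET] [NormedSpace ℝ ET] [TopologicalSpace HT]
  [NormedAddCommGroup ED] [NormedSpace ℝ ED] [TopologicalSpace HD]

/-- A crossed module of Lie groups `ρ : G → H`, where `act h g` is the (left) action `h(g)` of `H`
on `G` by automorphisms. That `H → Aut(G)` is a homomorphism of Lie groups is expressed by the
smoothness of the action map `H × G → G`. -/
structure LieCrossedModule (IG : ModelWithCorners ℝ EG HG) (G : Type*) [Group G]
    [TopologicalSpace G] [ChartedSpace HG G]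
    (IH : ModelWithCorners ℝ EH HH) (H : Type*) [Group H]
    [TopologicalSpace H] [ChartedSpace HH H] where
  ρ : G →* H
  act : H →* MulAut G
  smooth_ρ : ContMDiff IG IH ∞ ρ
  smooth_act : ContMDiff (IH.prod IG) IG ∞ (fun q : H × G => act q.1 q.2)
  ρ_act : ∀ h g, ρ (act h g) = h * ρ g * h⁻¹
  act_ρ : ∀ g g', act (ρ g) g' = g * g' * g⁻¹

/-- A Lie groupoid `Γ ⇉ M`. The product `mul a b` is meaningful only when `tgt a = src b`; its
values on other pairs are irrelevant, and smoothness is required on the submanifold of composable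
pairs. -/
structure LieGroupoid (IΓ : ModelWithCorners ℝ EΓ HΓ) (Γ : Type*) [TopologicalSpace Γ]
    [ChartedSpace HΓ Γ] (IM : ModelWithCorners ℝ EM HM) (M : Type*) [TopologicalSpace M]
    [ChartedSpace HM M] where
  src : Γ → M
  tgt : Γ → M
  unit : M → Γ
  inv : Γ → Γ
  mul : Γ → Γ → Γ
  src_unit : ∀ m, src (unit m) = m
  tgt_unit : ∀ m, tgt (unit m) = m
  src_inv : ∀ a, src (inv a) = tgt a
  tgt_inv : ∀ a, tgt (inv a) = src a
  src_mul : ∀ a b, tgt a = src b → src (mul a b) = src a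
  tgt_mul : ∀ a b, tgt a = src b → tgt (mul a b) = tgt b
  mul_assoc : ∀ a b c, tgt a = src b → tgt b = src c → mul (mul a b) c = mul a (mul b c)
  unit_mul : ∀ a, mul (unit (src a)) a = a
  mul_unit : ∀ a, mul a (unit (tgt a)) = a
  mul_inv : ∀ a, mul a (inv a) = unit (src a)
  inv_mul : ∀ a, mul (inv a) a = unit (tgt a)
  src_submersion : IsSubmersion IΓ IM ∞ src
  tgt_submersion : IsSubmersion IΓ IM ∞ tgt
  smooth_unit : ContMDiff IM IΓ ∞ unit
  smooth_inv : ContMDiff IΓ IΓ ∞ inv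
  smooth_mul : ContMDiffOn (IΓ.prod IΓ) IΓ ∞ (fun p : Γ × Γ => mul p.1 p.2)
    {p | tgt p.1 = src p.2}

/-- A morphism of Lie groupoids over the identity of the common base `M`. -/
structure LieGroupoid.IsHom {IR : ModelWithCorners ℝ ER HR} {R : Type*} [TopologicalSpace R]
    [ChartedSpace HR R] {IΓ : ModelWithCorners ℝ EΓ HΓ} {Γ : Type*} [TopologicalSpace Γ]
    [ChartedSpace HΓ Γ] {IM : ModelWithCorners ℝ EM HM} {M : Type*} [TopologicalSpace M]
    [ChartedSpace HM M] (ℛ : LieGroupoid IR R IM M) (𝒢 : LieGroupoid IΓ Γ IM M)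
    (φ : R → Γ) : Prop where
  smooth : ContMDiff IR IΓ ∞ φ
  map_src : ∀ r, 𝒢.src (φ r) = ℛ.src r
  map_tgt : ∀ r, 𝒢.tgt (φ r) = ℛ.tgt r
  map_unit : ∀ m, φ (ℛ.unit m) = 𝒢.unit m
  map_mul : ∀ r s, ℛ.tgt r = ℛ.src s → φ (ℛ.mul r s) = 𝒢.mul (φ r) (φ s)

/-- A Lie groupoid `G`-extension `φ : R → Γ` of `𝒢 = (Γ ⇉ M)`: a morphism of Lie groupoids over
the identity of `M` that is a surjective submersion and whose kernel
`K = {r | φ r is a unit}` is, as a bundle of Lie groups over `M`, locally isomorphic to `V × G`.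
In `kernel_locTriv` the mutually inverse diffeomorphisms `V × G ≅ K_V` are
`τ` and `k ↦ (src k, κ k)`. -/
structure LieGroupoidGExtension (IG : ModelWithCorners ℝ EG HG) (G : Type*) [Group G]
    [TopologicalSpace G] [ChartedSpace HG G]
    {IΓ : ModelWithCorners ℝ EΓ HΓ} {Γ : Type*} [TopologicalSpace Γ] [ChartedSpace HΓ Γ]
    {IM : ModelWithCorners ℝ EM HM} {M : Type*} [TopologicalSpace M] [ChartedSpace HM M]
    (𝒢 : LieGroupoid IΓ Γ IM M)
    (IR : ModelWithCorners ℝ ER HR) (R : Type*) [TopologicalSpace R] [ChartedSpace HR R] where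
  gpd : LieGroupoid IR R IM M
  φ : R → Γ
  φ_hom : gpd.IsHom 𝒢 φ
  φ_surjective : Surjective φ
  φ_submersion : IsSubmersion IR IΓ ∞ φ
  kernel_locTriv : ∀ m₀ : M, ∃ V : Set M, IsOpen V ∧ m₀ ∈ V ∧ ∃ (τ : M × G → R) (κ : R → G),
    ContMDiffOn (IM.prod IG) IR ∞ τ (V ×ˢ univ) ∧
    ContMDiffOn IR IG ∞ κ {r | ∃ m ∈ V, φ r = 𝒢.unit m} ∧
    (∀ m ∈ V, ∀ g, φ (τ (m, g)) = 𝒢.unit m ∧ κ (τ (m, g)) = g) ∧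
    (∀ m ∈ V, ∀ r, φ r = 𝒢.unit m → τ (m, κ r) = r) ∧
    ∀ m ∈ V, ∀ g g', τ (m, g * g') = gpd.mul (τ (m, g)) (τ (m, g'))

/-- The fibre over `m` of the band of a `G`-extension: Lie group isomorphisms from `G` to the
kernel fibre `K_m = {r | φ r = unit m}`. -/
structure LieGroupoidGExtension.BandFibre {IG : ModelWithCorners ℝ EG HG} {G : Type*} [Group G]
    [TopologicalSpace G] [ChartedSpace HG G]
    {IΓ : ModelWithCorners ℝ EΓ HΓ} {Γ : Type*} [TopologicalSpace Γ] [ChartedSpace HΓ Γ]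
    {IM : ModelWithCorners ℝ EM HM} {M : Type*} [TopologicalSpace M] [ChartedSpace HM M]
    {𝒢 : LieGroupoid IΓ Γ IM M}
    {IR : ModelWithCorners ℝ ER HR} {R : Type*} [TopologicalSpace R] [ChartedSpace HR R]
    (A : LieGroupoidGExtension IG G 𝒢 IR R) (m : M) where
  toFun : G → R
  mem_kernel : ∀ g, A.φ (toFun g) = 𝒢.unit m
  map_mul : ∀ g g', toFun (g * g') = A.gpd.mul (toFun g) (toFun g')
  smooth : ContMDiff IG IR ∞ toFun
  exists_inverse : ∃ κ : R → G, ContMDiffOn IR IG ∞ κ {r | A.φ r = 𝒢.unit m} ∧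
    (∀ g, κ (toFun g) = g) ∧ ∀ r, A.φ r = 𝒢.unit m → toFun (κ r) = r

/-- A smooth (right) principal `H`-bundle `P → M`, with its smooth equivariant local
trivializations. -/
structure SmoothPrincipalBundle (IH : ModelWithCorners ℝ EH HH) (H : Type*) [Group H]
    [TopologicalSpace H] [ChartedSpace HH H]
    (IM : ModelWithCorners ℝ EM HM) (M : Type*) [TopologicalSpace M] [ChartedSpace HM M]
    (IP : ModelWithCorners ℝ EP HP) (P : Type*) [TopologicalSpace P] [ChartedSpace HP P] where
  proj : P → M
  ract : P → H → P
  smooth_proj : ContMDiff IP IM ∞ proj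
  smooth_ract : ContMDiff (IP.prod IH) IP ∞ (fun q : P × H => ract q.1 q.2)
  ract_one : ∀ p, ract p 1 = p
  ract_mul : ∀ p h h', ract p (h * h') = ract (ract p h) h'
  proj_ract : ∀ p h, proj (ract p h) = proj p
  locTriv : ∀ m : M, ∃ e : Bundle.Trivialization H proj, m ∈ e.baseSet ∧
    ContMDiffOn IP (IM.prod IH) ∞ e e.source ∧
    ContMDiffOn (IM.prod IH) IP ∞ e.toOpenPartialHomeomorph.symm e.target ∧
    ∀ p ∈ e.source, ∀ h, (e (ract p h)).2 = (e p).2 * h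

/-- A principal `H`-bundle over the Lie groupoid `ℛ = (R ⇉ M)`: a principal `H`-bundle `P → M`
with a left action of `ℛ` commuting with the action of `H`. The value `act r p` is meaningful
only when `tgt r = proj p`. -/
structure GroupoidPrincipalBundle (IH : ModelWithCorners ℝ EH HH) (H : Type*) [Group H]
    [TopologicalSpace H] [ChartedSpace HH H]
    {IR : ModelWithCorners ℝ ER HR} {R : Type*} [TopologicalSpace R] [ChartedSpace HR R]
    {IM : ModelWithCorners ℝ EM HM} {M : Type*} [TopologicalSpace M] [ChartedSpace HM M]
    (ℛ : LieGroupoid IR R IM M)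
    (IP : ModelWithCorners ℝ EP HP) (P : Type*) [TopologicalSpace P] [ChartedSpace HP P]
    extends SmoothPrincipalBundle IH H IM M IP P where
  act : R → P → P
  smooth_act : ContMDiffOn (IR.prod IP) IP ∞ (fun q : R × P => act q.1 q.2)
    {q | ℛ.tgt q.1 = proj q.2}
  proj_act : ∀ r p, ℛ.tgt r = proj p → proj (act r p) = ℛ.src r
  unit_act : ∀ p, act (ℛ.unit (proj p)) p = p
  mul_act : ∀ r s p, ℛ.tgt r = ℛ.src s → ℛ.tgt s = proj p →
    act (ℛ.mul r s) p = act r (act s p)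
  act_ract : ∀ r p h, ℛ.tgt r = proj p → ract (act r p) h = act r (ract p h)

/-- The structure of a Lie groupoid `G → H`-extension of `𝒢 = (Γ ⇉ M)` on given manifolds `R`
(arrows of the extension) and `P` (total space of the principal bundle). The pair `(χ, H → Aut G)`
is a morphism, over the identity of `R ⇉ M`, to the band, which is a principal `Aut(G)`-bundle by
`b · α = b ∘ α` and on which `R` acts by `(r · b)(g) = r b(g) r⁻¹`; smoothness of `χ` is that of
`(p, g) ↦ χ(p)(g)`. -/
structure GHExtensionOn {IG : ModelWithCorners ℝ EG HG} {G : Type*} [Group G]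
    [TopologicalSpace G] [ChartedSpace HG G]
    {IH : ModelWithCorners ℝ EH HH} {H : Type*} [Group H]
    [TopologicalSpace H] [ChartedSpace HH H] (X : LieCrossedModule IG G IH H)
    {IΓ : ModelWithCorners ℝ EΓ HΓ} {Γ : Type*} [TopologicalSpace Γ] [ChartedSpace HΓ Γ]
    {IM : ModelWithCorners ℝ EM HM} {M : Type*} [TopologicalSpace M] [ChartedSpace HM M]
    (𝒢 : LieGroupoid IΓ Γ IM M)
    (IR : ModelWithCorners ℝ ER HR) (R : Type*) [TopologicalSpace R] [ChartedSpace HR R]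
    (IP : ModelWithCorners ℝ EP HP) (P : Type*) [TopologicalSpace P] [ChartedSpace HP P]
    extends LieGroupoidGExtension IG G 𝒢 IR R where
  bundle : GroupoidPrincipalBundle IH H gpd IP P
  χ : ∀ p : P, toLieGroupoidGExtension.BandFibre (bundle.proj p)
  smooth_χ : ContMDiff (IP.prod IG) IR ∞ (fun q : P × G => (χ q.1).toFun q.2)
  χ_ract : ∀ p h g, (χ (bundle.ract p h)).toFun g = (χ p).toFun (X.act h g)
  χ_act : ∀ r p g, gpd.tgt r = bundle.proj p →
    (χ (bundle.act r p)).toFun g = gpd.mul (gpd.mul r ((χ p).toFun g)) (gpd.inv r)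
  ract_ρ : ∀ p g, bundle.ract p (X.ρ g) = bundle.act ((χ p).toFun g) p

section Isomorphisms

variable {IG : ModelWithCorners ℝ EG HG} {G : Type*} [Group G]
  [TopologicalSpace G] [ChartedSpace HG G]
  {IH : ModelWithCorners ℝ EH HH} {H : Type*} [Group H]
  [TopologicalSpace H] [ChartedSpace HH H] {X : LieCrossedModule IG G IH H}
  {IΓ : ModelWithCorners ℝ EΓ HΓ} {Γ : Type*} [TopologicalSpace Γ] [ChartedSpace HΓ Γ]
  {IM : ModelWithCorners ℝ EM HM} {M : Type*} [TopologicalSpace M] [ChartedSpace HM M]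
  {𝒢 : LieGroupoid IΓ Γ IM M}
  {IR : ModelWithCorners ℝ ER HR} {R : Type*} [TopologicalSpace R] [ChartedSpace HR R]
  {IP : ModelWithCorners ℝ EP HP} {P : Type*} [TopologicalSpace P] [ChartedSpace HP P]
  {IS : ModelWithCorners ℝ ES HS} {S : Type*} [TopologicalSpace S] [ChartedSpace HS S]
  {IQ : ModelWithCorners ℝ EQ HQ} {Q : Type*} [TopologicalSpace Q] [ChartedSpace HQ Q]
  {IT : ModelWithCorners ℝ ET HT} {T : Type*} [TopologicalSpace T] [ChartedSpace HT T]
  {ID : ModelWithCorners ℝ ED HD} {D : Type*} [TopologicalSpace D] [ChartedSpace HD D]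

/-- An isomorphism of `G → H`-extensions of `𝒢` (over the identity of `𝒢`). -/
structure GHExtensionOn.Iso (A : GHExtensionOn X 𝒢 IR R IP P)
    (B : GHExtensionOn X 𝒢 IS S IQ Q) where
  Φ : R ≃ₘ^∞⟮IR, IS⟯ S
  Ψ : P ≃ₘ^∞⟮IP, IQ⟯ Q
  map_φ : ∀ r, B.φ (Φ r) = A.φ r
  map_mul : ∀ r s, A.gpd.tgt r = A.gpd.src s → Φ (A.gpd.mul r s) = B.gpd.mul (Φ r) (Φ s)
  map_proj : ∀ p, B.bundle.proj (Ψ p) = A.bundle.proj p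
  map_ract : ∀ p h, Ψ (A.bundle.ract p h) = B.bundle.ract (Ψ p) h
  map_act : ∀ r p, A.gpd.tgt r = A.bundle.proj p →
    Ψ (A.bundle.act r p) = B.bundle.act (Φ r) (Ψ p)
  map_χ : ∀ p g, Φ ((A.χ p).toFun g) = (B.χ (Ψ p)).toFun g

/-- Two `G → H`-extensions of `𝒢` are isomorphic. -/
def GHExtensionOn.Isomorphic (A : GHExtensionOn X 𝒢 IR R IP P)
    (B : GHExtensionOn X 𝒢 IS S IQ Q) : Prop := Nonempty (A.Iso B)

theorem GHExtensionOn.Isomorphic.refl (A : GHExtensionOn X 𝒢 IR R IP P) : A.Isomorphic A :=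
  ⟨{ Φ := Diffeomorph.refl IR R ∞
     Ψ := Diffeomorph.refl IP P ∞
     map_φ := fun _ => rfl
     map_mul := fun _ _ _ => rfl
     map_proj := fun _ => rfl
     map_ract := fun _ _ => rfl
     map_act := fun _ _ _ => rfl
     map_χ := fun _ _ => rfl }⟩

theorem GHExtensionOn.Iso.map_src {A : GHExtensionOn X 𝒢 IR R IP P}
    {B : GHExtensionOn X 𝒢 IS S IQ Q} (f : A.Iso B) (r : R) :
    B.gpd.src (f.Φ r) = A.gpd.src r := by
  rw [← B.φ_hom.map_src, f.map_φ, A.φ_hom.map_src]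

theorem GHExtensionOn.Iso.map_tgt {A : GHExtensionOn X 𝒢 IR R IP P}
    {B : GHExtensionOn X 𝒢 IS S IQ Q} (f : A.Iso B) (r : R) :
    B.gpd.tgt (f.Φ r) = A.gpd.tgt r := by
  rw [← B.φ_hom.map_tgt, f.map_φ, A.φ_hom.map_tgt]

theorem GHExtensionOn.Isomorphic.symm {A : GHExtensionOn X 𝒢 IR R IP P}
    {B : GHExtensionOn X 𝒢 IS S IQ Q} (h : A.Isomorphic B) : B.Isomorphic A := by
  obtain ⟨f⟩ := h
  refine ⟨⟨f.Φ.symm, f.Ψ.symm, ?_, ?_, ?_, ?_, ?_, ?_⟩⟩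
  · intro s
    obtain ⟨r, rfl⟩ : ∃ a, f.Φ a = s := ⟨_, f.Φ.apply_symm_apply s⟩
    simp [f.map_φ]
  · intro s s' hs
    obtain ⟨r, rfl⟩ : ∃ a, f.Φ a = s := ⟨_, f.Φ.apply_symm_apply s⟩
    obtain ⟨r', rfl⟩ : ∃ a, f.Φ a = s' := ⟨_, f.Φ.apply_symm_apply s'⟩
    rw [f.map_tgt, f.map_src] at hs
    rw [← f.map_mul _ _ hs]
    simp
  · intro q
    obtain ⟨p, rfl⟩ : ∃ a, f.Ψ a = q := ⟨_, f.Ψ.apply_symm_apply q⟩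
    simp [f.map_proj]
  · intro q h
    obtain ⟨p, rfl⟩ : ∃ a, f.Ψ a = q := ⟨_, f.Ψ.apply_symm_apply q⟩
    rw [← f.map_ract]
    simp
  · intro s q hs
    obtain ⟨r, rfl⟩ : ∃ a, f.Φ a = s := ⟨_, f.Φ.apply_symm_apply s⟩
    obtain ⟨p, rfl⟩ : ∃ a, f.Ψ a = q := ⟨_, f.Ψ.apply_symm_apply q⟩
    rw [f.map_tgt, f.map_proj] at hs
    rw [← f.map_act _ _ hs]
    simp
  · intro q g
    obtain ⟨p, rfl⟩ : ∃ a, f.Ψ a = q := ⟨_, f.Ψ.apply_symm_apply q⟩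
    have key : ∀ p' : P, p' = p → (A.χ p).toFun g = (A.χ p').toFun g := by
      rintro _ rfl
      rfl
    rw [← f.map_χ, f.Φ.symm_apply_apply]
    exact key _ (f.Ψ.symm_apply_apply p)

theorem GHExtensionOn.Isomorphic.trans {A : GHExtensionOn X 𝒢 IR R IP P}
    {B : GHExtensionOn X 𝒢 IS S IQ Q} {C : GHExtensionOn X 𝒢 IT T ID D}
    (h : A.Isomorphic B) (h' : B.Isomorphic C) : A.Isomorphic C := by
  obtain ⟨f⟩ := h
  obtain ⟨f'⟩ := h'
  refine ⟨⟨f.Φ.trans f'.Φ, f.Ψ.trans f'.Ψ, ?_, ?_, ?_, ?_, ?_, ?_⟩⟩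
  · intro r
    simp [f.map_φ, f'.map_φ]
  · intro r s hrs
    have h2 : B.gpd.tgt (f.Φ r) = B.gpd.src (f.Φ s) := by rw [f.map_tgt, f.map_src, hrs]
    simp [f.map_mul _ _ hrs, f'.map_mul _ _ h2]
  · intro p
    simp [f.map_proj, f'.map_proj]
  · intro p h
    simp [f.map_ract, f'.map_ract]
  · intro r p hrp
    have h2 : B.gpd.tgt (f.Φ r) = B.bundle.proj (f.Ψ p) := by rw [f.map_tgt, f.map_proj, hrp]
    simp [f.map_act _ _ hrp, f'.map_act _ _ h2]
  · intro p g
    simp [f.map_χ, f'.map_χ]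

end Isomorphisms

/-- A Lie groupoid `G → H`-extension of `𝒢 = (Γ ⇉ M)`, with its manifolds `R` and `P`. As `R → Γ`
is a submersion whose fibres are diffeomorphic to `G`, and `P → M` is locally `M × H`, the manifold
`R` has dimension `dim G + dim Γ` and `P` has dimension `dim M + dim H`; accordingly they are
modelled on the product models. -/
structure GHExtension {IG : ModelWithCorners ℝ EG HG} {G : Type u} [Group G]
    [TopologicalSpace G] [ChartedSpace HG G]
    {IH : ModelWithCorners ℝ EH HH} {H : Type u} [Group H]
    [TopologicalSpace H] [ChartedSpace HH H] (X : LieCrossedModule IG G IH H)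
    {IΓ : ModelWithCorners ℝ EΓ HΓ} {Γ : Type u} [TopologicalSpace Γ] [ChartedSpace HΓ Γ]
    {IM : ModelWithCorners ℝ EM HM} {M : Type u} [TopologicalSpace M] [ChartedSpace HM M]
    (𝒢 : LieGroupoid IΓ Γ IM M) where
  R : Type u
  P : Type u
  [topR : TopologicalSpace R]
  [chartedR : ChartedSpace (ModelProd HG HΓ) R]
  [manifoldR : IsManifold (IG.prod IΓ) ∞ R]
  [topP : TopologicalSpace P]
  [chartedP : ChartedSpace (ModelProd HM HH) P]
  [manifoldP : IsManifold (IM.prod IH) ∞ P]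
  ext : GHExtensionOn X 𝒢 (IG.prod IΓ) R (IM.prod IH) P

attribute [instance] GHExtension.topR GHExtension.chartedR GHExtension.manifoldR
  GHExtension.topP GHExtension.chartedP GHExtension.manifoldP

/-- Isomorphism of `G → H`-extensions of `𝒢`, as an equivalence relation. -/
instance GHExtension.setoid {IG : ModelWithCorners ℝ EG HG} {G : Type u} [Group G]
    [TopologicalSpace G] [ChartedSpace HG G]
    {IH : ModelWithCorners ℝ EH HH} {H : Type u} [Group H]
    [TopologicalSpace H] [ChartedSpace HH H] (X : LieCrossedModule IG G IH H)
    {IΓ : ModelWithCorners ℝ EΓ HΓ} {Γ : Type u} [TopologicalSpace Γ] [ChartedSpace HΓ Γ]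
    {IM : ModelWithCorners ℝ EM HM} {M : Type u} [TopologicalSpace M] [ChartedSpace HM M]
    (𝒢 : LieGroupoid IΓ Γ IM M) : Setoid (GHExtension X 𝒢) where
  r A B := A.ext.Isomorphic B.ext
  iseqv := ⟨fun A => .refl A.ext, fun h => h.symm, fun h h' => h.trans h'⟩

end General

/-! ### The Čech groupoid of an open cover -/

section Cech

variable {EN : Type*} [NormedAddCommGroup EN] [NormedSpace ℝ EN]
  {N : Type u} [TopologicalSpace N] [ChartedSpace EN N]
  {I : Type u} (U : I → Opens N)

/-- `∐ U_i`. -/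
abbrev Cech0 := Coprod U

/-- `∐ U_ij`. -/
abbrev Cech1 := Coprod (fun p : I × I => U p.1 ⊓ U p.2)

/-- `∐ U_ijk`. -/
abbrev Cech2 := Coprod (fun p : I × I × I => U p.1 ⊓ U p.2.1 ⊓ U p.2.2)

/-- The point `x_i`. -/
def cech0 {U : I → Opens N} (i : I) (x : N) (hi : x ∈ U i) : Cech0 U := ⟨i, x, hi⟩

/-- The point `x_ij`. -/
def cech1 {U : I → Opens N} (i j : I) (x : N) (hi : x ∈ U i) (hj : x ∈ U j) : Cech1 U :=
  ⟨(i, j), x, hi, hj⟩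

/-- The point `x_ijk`. -/
def cech2 {U : I → Opens N} (i j k : I) (x : N) (hi : x ∈ U i) (hj : x ∈ U j) (hk : x ∈ U k) :
    Cech2 U :=
  ⟨(i, j, k), x, ⟨hi, hj⟩, hk⟩

open Classical in
/-- The product `x_ij • x_jk = x_ik` (with an irrelevant value on non-composable pairs). -/
def cechMul {U : I → Opens N} (a b : Cech1 U) : Cech1 U :=
  if h : a.val ∈ U b.1.2 then cech1 a.1.1 b.1.2 a.val a.2.2.1 h else a

theorem Cech1.composable {U : I → Opens N} {a b : Cech1 U}
    (h : (Coprod.incl Prod.snd (fun _ => inf_le_right) a : Cech0 U) =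
      Coprod.incl Prod.fst (fun _ => inf_le_left) b) :
    ∃ i j k x hi hj hk, a = cech1 i j x hi hj ∧ b = cech1 j k x hj hk := by
  obtain ⟨⟨i, j⟩, x, hi, hj⟩ := a
  obtain ⟨⟨j', k⟩, y, hj', hk⟩ := b
  have h1 : j = j' := congrArg Sigma.fst h
  have h2 : x = y := congrArg Coprod.val h
  subst h1 h2
  exact ⟨i, j, k, x, hi, hj, hk, rfl, rfl⟩

theorem cechMul_mk {U : I → Opens N} (i j j' k : I) (x : N) (hi : x ∈ U i) (hj : x ∈ U j)
    (hj' : x ∈ U j') (hk : x ∈ U k) :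
    cechMul (cech1 i j x hi hj) (cech1 j' k x hj' hk) = cech1 i k x hi hk :=
  dif_pos hk

variable [IsManifold 𝓘(ℝ, EN) ∞ N]

theorem contMDiffOn_cechMul :
    ContMDiffOn (𝓘(ℝ, EN).prod 𝓘(ℝ, EN)) 𝓘(ℝ, EN) ∞ (fun p : Cech1 U × Cech1 U => cechMul p.1 p.2)
      {p | (Coprod.incl Prod.snd (fun _ => inf_le_right) p.1 : Cech0 U) =
        Coprod.incl Prod.fst (fun _ => inf_le_left) p.2} := by
  have hval : ∀ p : Cech1 U × Cech1 U, (cechMul p.1 p.2).val = p.1.val := by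
    intro p
    unfold cechMul
    split_ifs <;> rfl
  intro p hp
  apply Coprod.contMDiffWithinAt_of_val
  · have h1 : ∀ q : Cech1 U, ∀ᶠ q' in 𝓝 q, q'.1 = q.1 := by
      intro q
      have : IsOpen (Sigma.fst ⁻¹' {q.1} : Set (Cech1 U)) := by
        rw [isOpen_sigma_iff]
        intro i
        by_cases h : i = q.1
        · have : (Sigma.mk i ⁻¹' (Sigma.fst ⁻¹' {q.1} : Set (Cech1 U))) = univ := by
            ext y
            simp [h]
          rw [this]
          exact isOpen_univ
        · have : (Sigma.mk i ⁻¹' (Sigma.fst ⁻¹' {q.1} : Set (Cech1 U))) = ∅ := by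
            ext y
            simp [h]
          rw [this]
          exact isOpen_empty
      exact this.mem_nhds rfl
    have h2 : ∀ᶠ q in 𝓝[{p | (Coprod.incl Prod.snd (fun _ => inf_le_right) p.1 : Cech0 U) =
        Coprod.incl Prod.fst (fun _ => inf_le_left) p.2}] p, q.1.1 = p.1.1 ∧ q.2.1 = p.2.1 :=
      nhdsWithin_le_nhds (((continuous_fst.tendsto p).eventually (h1 p.1)).and
        ((continuous_snd.tendsto p).eventually (h1 p.2)))
    have h3 : ∀ q : Cech1 U × Cech1 U,
        (Coprod.incl Prod.snd (fun _ => inf_le_right) q.1 : Cech0 U) =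
          Coprod.incl Prod.fst (fun _ => inf_le_left) q.2 →
        (cechMul q.1 q.2).1 = (q.1.1.1, q.2.1.2) := by
      rintro ⟨a, b⟩ hq
      obtain ⟨i, j, k, x, hi, hj, hk, rfl, rfl⟩ := Cech1.composable hq
      rw [cechMul_mk]
      rfl
    filter_upwards [h2, self_mem_nhdsWithin] with q hq hq'
    rw [h3 q hq', h3 p hp, hq.1, hq.2]
  · simp only [hval]
    exact (Coprod.contMDiff_val.comp contMDiff_fst).contMDiffAt.contMDiffWithinAt

/-- The Čech groupoid `N[𝒰] = (∐ U_ij ⇉ ∐ U_i)`. -/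
def cechGroupoid : LieGroupoid 𝓘(ℝ, EN) (Cech1 U) 𝓘(ℝ, EN) (Cech0 U) where
  src := Coprod.incl Prod.fst (fun _ => inf_le_left)
  tgt := Coprod.incl Prod.snd (fun _ => inf_le_right)
  unit := Coprod.incl (fun i => (i, i)) (fun _ => le_inf le_rfl le_rfl)
  inv := Coprod.incl Prod.swap (fun _ => le_inf inf_le_right inf_le_left)
  mul := cechMul
  src_unit _ := rfl
  tgt_unit _ := rfl
  src_inv _ := rfl
  tgt_inv _ := rfl
  src_mul a b h := by
    obtain ⟨i, j, k, x, hi, hj, hk, rfl, rfl⟩ := Cech1.composable h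
    rw [cechMul_mk]
    rfl
  tgt_mul a b h := by
    obtain ⟨i, j, k, x, hi, hj, hk, rfl, rfl⟩ := Cech1.composable h
    rw [cechMul_mk]
    rfl
  mul_assoc a b c h h' := by
    obtain ⟨i, j, k, x, hi, hj, hk, rfl, rfl⟩ := Cech1.composable h
    obtain ⟨j', k', l, y, hj', hk', hl, hb, rfl⟩ := Cech1.composable h'
    have hxy : x = y := congrArg Coprod.val hb
    subst hxy
    rw [cechMul_mk, cechMul_mk, cechMul_mk, cechMul_mk]
  unit_mul := fun ⟨_, _, _, hj⟩ => dif_pos hj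
  mul_unit := fun ⟨_, _, _, hj⟩ => dif_pos hj
  mul_inv := fun ⟨_, _, hi, _⟩ => dif_pos hi
  inv_mul := fun ⟨_, _, _, hj⟩ => dif_pos hj
  src_submersion := Coprod.incl_isSubmersion _ _
  tgt_submersion := Coprod.incl_isSubmersion _ _
  smooth_unit := (Coprod.incl_isSubmersion _ _).contMDiff
  smooth_inv := (Coprod.incl_isSubmersion _ _).contMDiff
  smooth_mul := contMDiffOn_cechMul U

variable {EG EH : Type*} [NormedAddCommGroup EG] [NormedSpace ℝ EG]
  [NormedAddCommGroup EH] [NormedSpace ℝ EH]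
  {G H : Type u} [Group G] [TopologicalSpace G] [ChartedSpace EG G] [LieGroup 𝓘(ℝ, EG) ∞ G]
  [Group H] [TopologicalSpace H] [ChartedSpace EH H] [LieGroup 𝓘(ℝ, EH) ∞ H]
  (X : LieCrossedModule 𝓘(ℝ, EG) G 𝓘(ℝ, EH) H)

/-! ### Adapted extensions -/

/-- The conditions for a `G → H`-extension of the Čech groupoid with `R = G × ∐ U_ij` and
`P = ∐ U_i × H` to be adapted. -/
structure IsAdapted (A : GHExtensionOn X (cechGroupoid (EN := EN) U)
    (𝓘(ℝ, EG).prod 𝓘(ℝ, EN)) (G × Cech1 U) (𝓘(ℝ, EN).prod 𝓘(ℝ, EH)) (Cech0 U × H)) : Prop where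
  φ_eq : ∀ r, A.φ r = r.2
  proj_eq : ∀ p, A.bundle.proj p = p.1
  ract_eq : ∀ x h h', A.bundle.ract (x, h) h' = (x, h * h')
  χ_eq : ∀ i x (hi : x ∈ U i) h g,
    (A.χ (cech0 i x hi, h)).toFun g = (X.act h g, cech1 i i x hi hi)
  mul_eq : ∀ i j x (hi : x ∈ U i) (hj : x ∈ U j) g g',
    A.gpd.mul (g, cech1 i i x hi hi) (g', cech1 i j x hi hj) = (g * g', cech1 i j x hi hj)

/-- Adapted `G → H`-extensions of the Čech groupoid `N[𝒰]`. -/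
def AdaptedExtension := {A : GHExtensionOn X (cechGroupoid (EN := EN) U)
    (𝓘(ℝ, EG).prod 𝓘(ℝ, EN)) (G × Cech1 U) (𝓘(ℝ, EN).prod 𝓘(ℝ, EH)) (Cech0 U × H) //
  IsAdapted U X A}

/-- An adapted extension, seen as a `G → H`-extension of the Čech groupoid. -/
def AdaptedExtension.toGHExtension {U : I → Opens N}
    {X : LieCrossedModule 𝓘(ℝ, EG) G 𝓘(ℝ, EH) H} (A : AdaptedExtension (EN := EN) U X) :
    GHExtension X (cechGroupoid (EN := EN) U) where
  R := G × Cech1 U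
  P := Cech0 U × H
  ext := A.1

/-- Isomorphism of adapted extensions, as `G → H`-extensions of `N[𝒰]`. -/
instance AdaptedExtension.setoid : Setoid (AdaptedExtension (EN := EN) U X) where
  r A B := A.1.Isomorphic B.1
  iseqv := ⟨fun A => .refl A.1, fun h => h.symm, fun h h' => h.trans h'⟩

/-! ### Non-abelian cohomology -/

/-- A non-abelian `1`-cocycle `(λ, 𝐠)` with values in `G → H`, with respect to the cover `U`. -/
structure NonabelianCocycle where
  lam : C^∞⟮𝓘(ℝ, EN), Cech1 U; 𝓘(ℝ, EH), H⟯
  g : C^∞⟮𝓘(ℝ, EN), Cech2 U; 𝓘(ℝ, EG), G⟯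
  ρ_g : ∀ i j k x (hi : x ∈ U i) (hj : x ∈ U j) (hk : x ∈ U k),
    X.ρ (g (cech2 i j k x hi hj hk)) * lam (cech1 i k x hi hk) =
      lam (cech1 i j x hi hj) * lam (cech1 j k x hj hk)
  g_mul_g : ∀ i j k l x (hi : x ∈ U i) (hj : x ∈ U j) (hk : x ∈ U k) (hl : x ∈ U l),
    g (cech2 i j k x hi hj hk) * g (cech2 i k l x hi hk hl) =
      X.act (lam (cech1 i j x hi hj)) (g (cech2 j k l x hj hk hl)) * g (cech2 i j l x hi hj hl)
  g_iij : ∀ i j x (hi : x ∈ U i) (hj : x ∈ U j), g (cech2 i i j x hi hi hj) = 1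

variable {U X}

/-- The coboundary `(r, 𝐯)` relates the cocycles `c = (λ, 𝐠)` and `c' = (λ', 𝐠')`. -/
structure NonabelianCocycle.Relates (c c' : NonabelianCocycle (EN := EN) U X)
    (r : C^∞⟮𝓘(ℝ, EN), Cech0 U; 𝓘(ℝ, EH), H⟯) (v : C^∞⟮𝓘(ℝ, EN), Cech1 U; 𝓘(ℝ, EG), G⟯) :
    Prop where
  lam_eq : ∀ i j x (hi : x ∈ U i) (hj : x ∈ U j),
    c'.lam (cech1 i j x hi hj) = X.ρ (v (cech1 i j x hi hj)) * r (cech0 i x hi) *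
      c.lam (cech1 i j x hi hj) * (r (cech0 j x hj))⁻¹
  g_eq : ∀ i j k x (hi : x ∈ U i) (hj : x ∈ U j) (hk : x ∈ U k),
    c'.g (cech2 i j k x hi hj hk) * v (cech1 i k x hi hk) =
      X.act (c'.lam (cech1 i j x hi hj)) (v (cech1 j k x hj hk)) * v (cech1 i j x hi hj) *
        X.act (r (cech0 i x hi)) (c.g (cech2 i j k x hi hj hk))

/-- Two cocycles are cohomologous if they are related by a coboundary. -/
def NonabelianCocycle.Cohomologous (c c' : NonabelianCocycle (EN := EN) U X) : Prop :=
  ∃ r v, c.Relates c' r v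

theorem NonabelianCocycle.Cohomologous.refl (c : NonabelianCocycle (EN := EN) U X) :
    c.Cohomologous c := by
  refine ⟨1, 1, ?_, ?_⟩
  · intros
    simp
  · intros
    simp

theorem contMDiffMap_inv_apply {EY HY Y : Type*} [NormedAddCommGroup EY] [NormedSpace ℝ EY]
    [TopologicalSpace HY] {IY : ModelWithCorners ℝ EY HY} [TopologicalSpace Y] [ChartedSpace HY Y]
    (f : C^∞⟮IY, Y; 𝓘(ℝ, EG), G⟯) (y : Y) : f⁻¹ y = (f y)⁻¹ := rfl

/-- The map `x_ij ↦ r_i(v_ij)`. -/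
def smoothAct (r : C^∞⟮𝓘(ℝ, EN), Cech0 U; 𝓘(ℝ, EH), H⟯)
    (v : C^∞⟮𝓘(ℝ, EN), Cech1 U; 𝓘(ℝ, EG), G⟯) (X : LieCrossedModule 𝓘(ℝ, EG) G 𝓘(ℝ, EH) H) :
    C^∞⟮𝓘(ℝ, EN), Cech1 U; 𝓘(ℝ, EG), G⟯ :=
  ⟨fun a => X.act (r ((cechGroupoid (EN := EN) U).src a)) (v a),
    X.smooth_act.comp ((r.contMDiff.comp
      (cechGroupoid (EN := EN) U).src_submersion.contMDiff).prodMk v.contMDiff)⟩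

theorem smoothAct_apply (r : C^∞⟮𝓘(ℝ, EN), Cech0 U; 𝓘(ℝ, EH), H⟯)
    (v : C^∞⟮𝓘(ℝ, EN), Cech1 U; 𝓘(ℝ, EG), G⟯) (X : LieCrossedModule 𝓘(ℝ, EG) G 𝓘(ℝ, EH) H)
    (i j : I) (x : N) (hi : x ∈ U i) (hj : x ∈ U j) :
    smoothAct r v X (cech1 i j x hi hj) = X.act (r (cech0 i x hi)) (v (cech1 i j x hi hj)) := rfl

theorem NonabelianCocycle.Cohomologous.symm {c c' : NonabelianCocycle (EN := EN) U X}
    (h : c.Cohomologous c') : c'.Cohomologous c := by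
  obtain ⟨r, v, h1, h2⟩ := h
  refine ⟨r⁻¹, smoothAct r⁻¹ v⁻¹ X, ?_, ?_⟩
  · intro i j x hi hj
    rw [smoothAct_apply]
    simp only [contMDiffMap_inv_apply]
    rw [X.ρ_act, h1 i j x hi hj, map_inv]
    group
  · intro i j k x hi hj hk
    simp only [smoothAct_apply, contMDiffMap_inv_apply]
    have e1 := h1 i j x hi hj
    have e2 := h2 i j k x hi hj hk
    apply (X.act (r (cech0 i x hi))).injective
    have key : X.act (r (cech0 i x hi)) (X.act (c.lam (cech1 i j x hi hj))
        (X.act (r (cech0 j x hj))⁻¹ (v (cech1 j k x hj hk))⁻¹)) =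
        (v (cech1 i j x hi hj))⁻¹ * X.act (c'.lam (cech1 i j x hi hj))
          (v (cech1 j k x hj hk))⁻¹ * v (cech1 i j x hi hj) := by
      have : r (cech0 i x hi) * c.lam (cech1 i j x hi hj) * (r (cech0 j x hj))⁻¹ =
          X.ρ (v (cech1 i j x hi hj))⁻¹ * c'.lam (cech1 i j x hi hj) := by
        rw [e1, map_inv]
        group
      rw [← MulAut.mul_apply, ← MulAut.mul_apply, ← map_mul, ← map_mul, this, map_mul,
        MulAut.mul_apply, X.act_ρ, inv_inv]
    have cancel : ∀ (h : H) (y : G), X.act h (X.act h⁻¹ y) = y := by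
      intro h y
      rw [← MulAut.mul_apply, ← map_mul]
      simp
    simp only [map_mul]
    rw [key]
    simp only [cancel]
    have e3 : X.act (r (cech0 i x hi)) (c.g (cech2 i j k x hi hj hk)) =
        (v (cech1 i j x hi hj))⁻¹ *
          (X.act (c'.lam (cech1 i j x hi hj)) (v (cech1 j k x hj hk)))⁻¹ *
          (c'.g (cech2 i j k x hi hj hk) * v (cech1 i k x hi hk)) := by
      rw [e2]
      group
    rw [e3, map_inv]
    group

theorem NonabelianCocycle.Cohomologous.trans {c c' c'' : NonabelianCocycle (EN := EN) U X}
    (h : c.Cohomologous c') (h' : c'.Cohomologous c'') : c.Cohomologous c'' := by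
  obtain ⟨r, v, h1, h2⟩ := h
  obtain ⟨r', v', h1', h2'⟩ := h'
  refine ⟨r' * r, v' * smoothAct r' v X, ?_, ?_⟩
  · intro i j x hi hj
    simp only [ContMDiffMap.coe_mul, Pi.mul_apply, smoothAct_apply]
    rw [h1' i j x hi hj, h1 i j x hi hj, map_mul, X.ρ_act]
    group
  · intro i j k x hi hj hk
    simp only [ContMDiffMap.coe_mul, Pi.mul_apply, smoothAct_apply]
    have e1' := h1' i j x hi hj
    have e2 := congrArg (X.act (r' (cech0 i x hi))) (h2 i j k x hi hj hk)
    have e2' := h2' i j k x hi hj hk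
    have key : X.act (c''.lam (cech1 i j x hi hj))
          (X.act (r' (cech0 j x hj)) (v (cech1 j k x hj hk))) =
        v' (cech1 i j x hi hj) * X.act (r' (cech0 i x hi)) (X.act (c'.lam (cech1 i j x hi hj))
          (v (cech1 j k x hj hk))) * (v' (cech1 i j x hi hj))⁻¹ := by
      rw [← X.act_ρ, ← MulAut.mul_apply, ← MulAut.mul_apply, ← MulAut.mul_apply, ← map_mul,
        ← map_mul, ← map_mul, e1']
      congr 2
      group
    simp only [map_mul] at e2 ⊢
    rw [key, ← mul_assoc, e2', MulAut.mul_apply]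
    simp only [mul_assoc] at e2 ⊢
    rw [e2]
    simp

instance NonabelianCocycle.setoid : Setoid (NonabelianCocycle (EN := EN) U X) where
  r := NonabelianCocycle.Cohomologous
  iseqv := ⟨.refl, fun h => h.symm, fun h h' => h.trans h'⟩

/-- `c = (λ, 𝐠)` is the cocycle of the adapted extension `A`:
`(e, x_ij) ⋆ (x_j, e) = (x_i, λ_ij)` and `(e, x_ij) • (e, x_jk) = (𝐠_ijk, x_ik)`. -/
structure AdaptedExtension.HasCocycle (A : AdaptedExtension (EN := EN) U X)
    (c : NonabelianCocycle (EN := EN) U X) : Prop where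
  act_eq : ∀ i j x (hi : x ∈ U i) (hj : x ∈ U j),
    A.1.bundle.act (1, cech1 i j x hi hj) (cech0 j x hj, 1) =
      (cech0 i x hi, c.lam (cech1 i j x hi hj))
  mul_eq : ∀ i j k x (hi : x ∈ U i) (hj : x ∈ U j) (hk : x ∈ U k),
    A.1.gpd.mul (1, cech1 i j x hi hj) (1, cech1 j k x hj hk) =
      (c.g (cech2 i j k x hi hj hk), cech1 i k x hi hk)

variable (U X)

/-- The non-abelian cohomology `H¹_𝒰(G → H)`. -/
def NonabelianH1 := Quotient (NonabelianCocycle.setoid (EN := EN) (U := U) (X := X))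

/-- Adapted `G → H`-extensions of `N[𝒰]` up to isomorphism. -/
def AdaptedExtensionClasses := Quotient (AdaptedExtension.setoid (EN := EN) U X)

/-- `G → H`-extensions of `N[𝒰]` up to isomorphism. -/
def CechExtensionClasses := Quotient (GHExtension.setoid X (cechGroupoid (EN := EN) U))

end Cech

end

set_option linter.unusedSectionVars false

/-! ### Lifting maps along locally trivial maps -/

section Lifting

theorem exists_seq_closed_shrinking {B : Type*} [TopologicalSpace B] [ParacompactSpace B]
    [T4Space B] [SecondCountableTopology B] [Nonempty B] {S : B → Set B}
    (hS : ∀ x, S x ∈ 𝓝 x) :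
    ∃ (c : ℕ → B) (K L : ℕ → Set B), (∀ n, IsClosed (K n)) ∧ (∀ n, IsClosed (L n)) ∧
      (∀ n, K n ⊆ interior (L n)) ∧ (∀ n, L n ⊆ S (c n)) ∧ LocallyFinite L ∧
      ⋃ n, K n = univ := by
  obtain ⟨s, hs, hsU⟩ := TopologicalSpace.countable_cover_nhds fun x => interior_mem_nhds.2 (hS x)
  have hne : s.Nonempty := by
    by_contra h
    rw [not_nonempty_iff_eq_empty] at h
    subst h
    simp only [mem_empty_iff_false, iUnion_of_empty, iUnion_empty] at hsU
    exact empty_ne_univ hsU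
  obtain ⟨c, rfl⟩ := hs.exists_eq_range hne
  rw [biUnion_range] at hsU
  obtain ⟨v, hvo, hvU, hvf, hvs⟩ :=
    precise_refinement (fun n => interior (S (c n))) (fun _ => isOpen_interior) hsU
  obtain ⟨w, hwU, hwo, hwv⟩ := exists_iUnion_eq_closure_subset hvo (fun x => hvf.point_finite x) hvU
  have hwf : LocallyFinite fun n => closure (w n) := hvf.subset hwv
  obtain ⟨k, hkU, -, hkw⟩ := exists_iUnion_eq_closure_subset hwo
    (fun x => (hwf.subset fun n => subset_closure).point_finite x) hwU
  refine ⟨c, fun n => closure (k n), fun n => closure (w n), fun n => isClosed_closure,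
    fun n => isClosed_closure, fun n => (hkw n).trans ?_, fun n => ?_, hwf, ?_⟩
  · exact interior_maximal subset_closure (hwo n)
  · exact (hwv n).trans ((hvs n).trans interior_subset)
  · exact eq_univ_of_univ_subset (hkU ▸ iUnion_mono fun n => subset_closure)

/-- The map `π : P → M` has continuous local transports: over a neighbourhood `D` of any point
there are maps moving the fibres of `π` to each other continuously. -/
def HasLocalTransports {P M : Type*} [TopologicalSpace P] [TopologicalSpace M] (π : P → M) :
    Prop :=
  ∀ m : M, ∃ (D : Set M) (T : P × M → P), IsOpen D ∧ m ∈ D ∧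
    ContinuousOn T ((π ⁻¹' D) ×ˢ D) ∧ (∀ p y, π p ∈ D → y ∈ D → π (T (p, y)) = y) ∧
    ∀ p, π p ∈ D → T (p, π p) = p

variable {B P M : Type*} [TopologicalSpace B] [TopologicalSpace P] [TopologicalSpace M]

theorem exists_lift_advance {π : P → M} {F : B × ℝ → M} (hF : Continuous F)
    {D : Set M} {T : P × M → P} (hT : ContinuousOn T ((π ⁻¹' D) ×ˢ D))
    (hTπ : ∀ p y, π p ∈ D → y ∈ D → π (T (p, y)) = y) (hTid : ∀ p, π p ∈ D → T (p, π p) = p)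
    {L : Set B} {u : B → ℝ} (hu : Continuous u) (huL : tsupport u ⊆ L)
    {a b : ℝ} (hD : ∀ x ∈ L, ∀ t ∈ Icc a b, F (x, t) ∈ D)
    {τ : B → ℝ} (hτ : Continuous τ) (hτ0 : ∀ x, 0 ≤ τ x) (hτa : ∀ x, min (u x) a ≤ τ x)
    {s : B → P} (hs : Continuous s) (hsF : ∀ x, π (s x) = F (x, τ x)) :
    ∃ s' : B → P, Continuous s' ∧ (∀ x, π (s' x) = F (x, max (τ x) (min (u x) b))) ∧
      ∀ x ∉ L, s' x = s x := by
  classical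
  set τ' : B → ℝ := fun x => max (τ x) (min (u x) b) with hτ'
  have hτ'c : Continuous τ' := hτ.max (hu.min continuous_const)
  set Z : Set B := tsupport u ∩ {x | a ≤ u x} ∩ {x | τ x ≤ b}
  have hZc : IsClosed Z := ((isClosed_tsupport u).inter (isClosed_le continuous_const hu)).inter
    (isClosed_le hτ continuous_const)
  have hZτ : ∀ x ∈ Z, F (x, τ x) ∈ D ∧ F (x, τ' x) ∈ D := by
    rintro x ⟨⟨hx1, hx2⟩, hx3⟩
    have h1 : a ≤ τ x := by simpa [min_eq_right hx2.out] using hτa x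
    exact ⟨hD x (huL hx1) _ ⟨h1, hx3⟩, hD x (huL hx1) _
      ⟨h1.trans (le_max_left _ _), max_le hx3 (min_le_right _ _)⟩⟩
  have hoff : ∀ x ∉ Z, τ' x = τ x := by
    intro x hx
    apply max_eq_left
    by_cases h1 : x ∈ tsupport u
    · by_cases h2 : a ≤ u x
      · have h3 : b < τ x := by
          by_contra h3
          exact hx ⟨⟨h1, h2⟩, not_lt.1 h3⟩
        exact (min_le_right _ _).trans h3.le
      · have h2' := not_le.1 h2
        have := hτa x
        rw [min_eq_left h2'.le] at this
        exact (min_le_left _ _).trans this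
    · rw [image_eq_zero_of_notMem_tsupport h1]
      exact (min_le_left _ _).trans (hτ0 x)
  have hon : ∀ x ∈ Z, τ' x = τ x → T (s x, F (x, τ' x)) = s x := by
    intro x hx h
    rw [h, ← hsF]
    exact hTid _ (by rw [hsF]; exact (hZτ x hx).1)
  set s' : B → P := fun x => if x ∈ Z then T (s x, F (x, τ' x)) else s x with hs'
  refine ⟨s', ?_, ?_, ?_⟩
  · have hE : IsClosed {x | τ' x = τ x} := isClosed_eq hτ'c hτ
    have h1 : ContinuousOn s' Z := by
      have : ContinuousOn (fun x => T (s x, F (x, τ' x))) Z := by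
        refine hT.comp (hs.prodMk (hF.comp (continuous_id.prodMk hτ'c))).continuousOn ?_
        intro x hx
        exact ⟨by simpa [hsF] using (hZτ x hx).1, (hZτ x hx).2⟩
      exact this.congr fun x hx => if_pos hx
    have h2 : ContinuousOn s' {x | τ' x = τ x} := by
      refine hs.continuousOn.congr fun x hx => ?_
      by_cases hxZ : x ∈ Z
      · simpa [hs', hxZ] using hon x hxZ hx
      · simp [hs', hxZ]
    rw [← continuousOn_univ]
    refine (h1.union_of_isClosed h2 hZc hE).mono fun x _ => ?_
    by_cases hxZ : x ∈ Z
    · exact Or.inl hxZ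
    · exact Or.inr (hoff x hxZ)
  · intro x
    by_cases hxZ : x ∈ Z
    · simp only [hs', if_pos hxZ]
      exact hTπ _ _ (by rw [hsF]; exact (hZτ x hxZ).1) (hZτ x hxZ).2
    · simp only [hs', if_neg hxZ]
      rw [hsF]
      exact congrArg (fun t => F (x, t)) (hoff x hxZ).symm
  · intro x hx
    have : x ∉ Z := fun h => hx (huL h.1.1)
    simp [hs', this]

theorem HasLocalTransports.exists_partition {π : P → M} (hπ : HasLocalTransports π)
    {F : B × ℝ → M} (hF : Continuous F) (x₀ : B) :
    ∃ S ∈ 𝓝 x₀, ∃ (t : ℕ → ℝ) (m : ℕ), t 0 = 0 ∧ t m = 1 ∧ Monotone t ∧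
      ∀ n < m, ∃ (D : Set M) (T : P × M → P), ContinuousOn T ((π ⁻¹' D) ×ˢ D) ∧
        (∀ p y, π p ∈ D → y ∈ D → π (T (p, y)) = y) ∧ (∀ p, π p ∈ D → T (p, π p) = p) ∧
        ∀ x ∈ S, ∀ r ∈ Icc (t n) (t (n + 1)), F (x, r) ∈ D := by
  choose D T hDo hDm hT hTπ hTid using hπ
  have h1 : ∀ r : ℝ, ∃ (A : Set B) (J : Set ℝ), A ∈ 𝓝 x₀ ∧ IsOpen J ∧ r ∈ J ∧
      ∀ x ∈ A, ∀ r' ∈ J, F (x, r') ∈ D (F (x₀, r)) := by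
    intro r
    have : F ⁻¹' D (F (x₀, r)) ∈ 𝓝 (x₀, r) :=
      ((hDo _).preimage hF).mem_nhds (hDm _)
    rw [nhds_prod_eq, Filter.mem_prod_iff] at this
    obtain ⟨A, hA, J, hJ, hsub⟩ := this
    obtain ⟨J', hJ'J, hJ'o, hrJ'⟩ := mem_nhds_iff.1 hJ
    exact ⟨A, J', hA, hJ'o, hrJ', fun x hx r' hr' => hsub (mk_mem_prod hx (hJ'J hr'))⟩
  choose A J hA hJo hJm hAJ using h1
  obtain ⟨t, ht0, htm, ⟨m, hm⟩, htc⟩ := exists_monotone_Icc_subset_open_cover_unitInterval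
    (c := fun r : ℝ => ((↑) : unitInterval → ℝ) ⁻¹' J r)
    (fun r => (hJo r).preimage continuous_subtype_val) (fun x _ => mem_iUnion.2 ⟨x, hJm _⟩)
  choose i hi using htc
  refine ⟨⋂ n ∈ Finset.range m, A (i n), (Filter.biInter_finset_mem _).2 fun n _ => hA _,
    fun n => t n, m, by simp [ht0], by simp [hm m le_rfl], fun a b hab => htm hab, ?_⟩
  intro n hn
  refine ⟨D (F (x₀, i n)), T _, hT _, hTπ _, hTid _, fun x hx r hr => ?_⟩
  refine hAJ _ x (mem_iInter₂.1 hx n (Finset.mem_range.2 hn)) r ?_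
  have h0 : 0 ≤ r := (t n).2.1.trans hr.1
  have h1 : r ≤ 1 := hr.2.trans (t (n + 1)).2.2
  exact @hi n ⟨r, h0, h1⟩ hr

/-- The homotopy lifting property of maps with local transports. -/
theorem HasLocalTransports.exists_lift [ParacompactSpace B] [T4Space B]
    [SecondCountableTopology B] {π : P → M} (hπ : HasLocalTransports π) {F : B × ℝ → M}
    (hF : Continuous F) {s₀ : B → P} (hs₀ : Continuous s₀) (hsF : ∀ x, π (s₀ x) = F (x, 0)) :
    ∃ s : B → P, Continuous s ∧ ∀ x, π (s x) = F (x, 1) := by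
  cases isEmpty_or_nonempty B with
  | inl h => exact ⟨s₀, hs₀, fun x => h.elim x⟩
  | inr h =>
  have hpart := fun x₀ => hπ.exists_partition hF x₀
  choose S hS t m ht0 htm htmono hstep using hpart
  obtain ⟨c, K, L, hK, hL, hKL, hLS, hLf, hKU⟩ := exists_seq_closed_shrinking hS
  let State := {q : B → ℝ × P // Continuous q ∧
    ∀ x, 0 ≤ (q x).1 ∧ (q x).1 ≤ 1 ∧ π (q x).2 = F (x, (q x).1)}
  have key : ∀ (n : ℕ) (q : State), ∃ q' : State, (∀ x ∉ L n, q'.1 x = q.1 x) ∧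
      (∀ x ∈ K n, (q'.1 x).1 = 1) ∧ ∀ x, (q.1 x).1 ≤ (q'.1 x).1 := by
    rintro n ⟨q, hqc, hq⟩
    obtain ⟨O, hOo, hKO, hOL⟩ := normal_exists_closure_subset (hK n) isOpen_interior (hKL n)
    obtain ⟨u, hu0, hu1, huI⟩ := exists_continuous_zero_one_of_isClosed
      hOo.isClosed_compl (hK n) (disjoint_compl_left_iff_subset.2 hKO)
    have husupp : tsupport u ⊆ L n := by
      refine (closure_mono ?_).trans (hOL.trans interior_subset)
      intro x hx
      by_contra hxO
      exact hx (hu0 hxO)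
    have sub : ∀ k ≤ m (c n), ∃ s : B → P, Continuous s ∧
        (∀ x, π (s x) = F (x, max (q x).1 (min (u x) (t (c n) k)))) ∧
        ∀ x ∉ L n, s x = (q x).2 := by
      intro k
      induction k with
      | zero =>
        intro _
        refine ⟨fun x => (q x).2, continuous_snd.comp hqc, fun x => ?_, fun _ _ => rfl⟩
        rw [ht0, min_eq_right (huI x).1, max_eq_left (hq x).1]
        exact (hq x).2.2
      | succ k ih =>
        intro hk
        obtain ⟨s, hs, hsπ, hsL⟩ := ih (by omega)
        obtain ⟨D, T, hT, hTπ, hTid, hTD⟩ := hstep (c n) k (by omega)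
        obtain ⟨s', hs', hs'π, hs'L⟩ := exists_lift_advance hF hT hTπ hTid u.continuous husupp
          (fun x hx => hTD x (hLS n hx))
          (τ := fun x => max (q x).1 (min (u x) (t (c n) k)))
          ((continuous_fst.comp hqc).max (u.continuous.min continuous_const))
          (fun x => le_max_of_le_left (hq x).1) (fun x => le_max_right _ _) hs hsπ
        refine ⟨s', hs', fun x => ?_, fun x hx => (hs'L x hx).trans (hsL x hx)⟩
        rw [hs'π, max_assoc, max_eq_right (min_le_min_left _ (htmono _ (Nat.le_succ k)))]
    obtain ⟨s, hs, hsπ, hsL⟩ := sub _ le_rfl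
    have hmin : ∀ x, min (u x) (t (c n) (m (c n))) = u x := by
      intro x
      rw [htm]
      exact min_eq_left (huI x).2
    simp only [hmin] at hsπ
    refine ⟨⟨fun x => (max (q x).1 (u x), s x),
      ((continuous_fst.comp hqc).max u.continuous).prodMk hs, fun x =>
        ⟨le_max_of_le_left (hq x).1, max_le (hq x).2.1 (huI x).2, hsπ x⟩⟩, ?_, ?_, ?_⟩
    · intro x hx
      have hux : u x = 0 := by
        by_contra h
        exact hx (husupp (subset_tsupport u h))
      simp only [hux, hsL x hx, max_eq_left (hq x).1]
    · intro x hx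
      have : u x = 1 := hu1 hx
      simp only [this]
      exact max_eq_right (hq x).2.1
    · intro x
      exact le_max_left _ _
  choose next hnext1 hnext2 hnext3 using key
  let q₀ : State := ⟨fun x => (0, s₀ x), continuous_const.prodMk hs₀,
    fun x => ⟨le_rfl, zero_le_one, hsF x⟩⟩
  let q : ℕ → State := fun n => Nat.rec q₀ (fun n q => next n q) n
  have hlf : LocallyFinite fun n => {x | (q (n + 1)).1 x ≠ (q n).1 x} := by
    refine hLf.subset fun n x hx => ?_
    by_contra hxL
    exact hx (hnext1 n (q n) x hxL)
  obtain ⟨Q, hQ⟩ := hlf.exists_forall_eventually_atTop_eventuallyEq (f := fun n => (q n).1)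
  have hmono : ∀ x, Monotone fun n => ((q n).1 x).1 := fun x =>
    monotone_nat_of_le_succ fun n => hnext3 n (q n) x
  have hev : ∀ x, ∃ n, (∀ᶠ y in 𝓝 x, (q n).1 y = Q y) ∧ ((q n).1 x).1 = 1 := by
    intro x
    obtain ⟨N, hN⟩ := Filter.eventually_atTop.1 (hQ x)
    obtain ⟨j, hj⟩ := mem_iUnion.1 (hKU.symm ▸ mem_univ x : x ∈ ⋃ n, K n)
    refine ⟨max N (j + 1), hN _ (le_max_left _ _), ?_⟩
    refine le_antisymm ((q _).2.2 x).2.1 ?_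
    have h1 : ((q (j + 1)).1 x).1 = 1 := hnext2 j (q j) x hj
    exact h1.symm.le.trans (hmono x (le_max_right N (j + 1)))
  refine ⟨fun x => (Q x).2, ?_, ?_⟩
  · rw [continuous_iff_continuousAt]
    intro x
    obtain ⟨n, hn, -⟩ := hev x
    refine (continuous_snd.comp (q n).2.1).continuousAt.congr ?_
    filter_upwards [hn] with y hy
    simp [hy]
  · intro x
    obtain ⟨n, hn, hn1⟩ := hev x
    have h1 := ((q n).2.2 x).2.2
    rw [hn1, hn.self_of_nhds] at h1
    exact h1

theorem HasLocalTransports.exists_lift_of_contractible [ParacompactSpace B] [T4Space B]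
    [SecondCountableTopology B] [ContractibleSpace B] {π : P → M} (hπ : HasLocalTransports π)
    (hπs : Surjective π) {f : B → M} (hf : Continuous f) :
    ∃ s : B → P, Continuous s ∧ ∀ x, π (s x) = f x := by
  obtain ⟨y, ⟨h⟩⟩ := id_nullhomotopic B
  obtain ⟨p, hp⟩ := hπs (f y)
  have hF : Continuous fun q : B × ℝ =>
      f (h.symm (projIcc (0 : ℝ) 1 zero_le_one q.2, q.1)) := by
    fun_prop
  obtain ⟨s, hs, hsf⟩ := hπ.exists_lift hF (s₀ := fun _ => p) continuous_const
    (fun x => by simp [hp])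
  exact ⟨s, hs, fun x => by simpa using hsf x⟩

end Lifting

/-! ### Smoothing lifts along submersions -/

section Smoothing

/-- The smooth map `π : P → M` looks locally, near every point of `P`, like the projection of an
open subset of `M × F`. -/
def HasVerticalCharts (F : Type*) [NormedAddCommGroup F] [NormedSpace ℝ F]
    {EP HP EM HM : Type*} [NormedAddCommGroup EP] [NormedSpace ℝ EP] [TopologicalSpace HP]
    [NormedAddCommGroup EM] [NormedSpace ℝ EM] [TopologicalSpace HM]
    (IP : ModelWithCorners ℝ EP HP) (IM : ModelWithCorners ℝ EM HM)
    {P M : Type*} [TopologicalSpace P] [ChartedSpace HP P] [TopologicalSpace M]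
    [ChartedSpace HM M] (π : P → M) : Prop :=
  ∀ p : P, ∃ (O : Set P) (v : P → F) (E : Set (M × F)) (w : M × F → P),
    IsOpen O ∧ p ∈ O ∧ IsOpen E ∧ ContMDiffOn IP 𝓘(ℝ, F) ∞ v O ∧
    ContMDiffOn (IM.prod 𝓘(ℝ, F)) IP ∞ w E ∧ (∀ q ∈ O, (π q, v q) ∈ E ∧ w (π q, v q) = q) ∧
    ∀ y ∈ E, π (w y) = y.1

variable {F EP HP EM HM EB HB : Type*} [NormedAddCommGroup F] [NormedSpace ℝ F]
  [NormedAddCommGroup EP] [NormedSpace ℝ EP] [TopologicalSpace HP]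
  [NormedAddCommGroup EM] [NormedSpace ℝ EM] [TopologicalSpace HM]
  [NormedAddCommGroup EB] [NormedSpace ℝ EB] [FiniteDimensional ℝ EB] [TopologicalSpace HB]
  {IP : ModelWithCorners ℝ EP HP} {IM : ModelWithCorners ℝ EM HM} {IB : ModelWithCorners ℝ EB HB}
  {P M B : Type*} [TopologicalSpace P] [ChartedSpace HP P] [TopologicalSpace M]
  [ChartedSpace HM M] [TopologicalSpace B] [ChartedSpace HB B] [IsManifold IB ∞ B]
  [SigmaCompactSpace B] [T2Space B]

/-- A continuous map on a closed set can be approximated by a smooth map, within any open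
neighbourhood of its graph, together with the segments. -/
theorem exists_contMDiff_approx_within {L W : Set B} (hL : IsClosed L) (hW : IsOpen W)
    (hLW : L ⊆ W) {u : B → F} (hu : ContinuousOn u W) {E : Set (B × F)} (hE : IsOpen E)
    (huE : ∀ x ∈ L, (x, u x) ∈ E) :
    ∃ a : B → F, ContMDiff IB 𝓘(ℝ, F) ∞ a ∧
      ∀ x ∈ L, ∀ r ∈ Icc (0 : ℝ) 1, (x, (1 - r) • u x + r • a x) ∈ E := by
  have huat : ∀ x ∈ L, ContinuousAt u x := fun x hx =>
    hu.continuousAt (hW.mem_nhds (hLW hx))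
  obtain ⟨ε, hε⟩ := exists_contMDiffMap_forall_mem_convex_of_local_const (n := ⊤) IB
    (t := fun x => {e : ℝ | x ∈ L → 0 < e ∧ ∀ c ∈ Metric.ball (u x) e, (x, c) ∈ E})
    (by
      intro x
      refine convex_iff_ordConnected.2 ⟨fun e he e' he' d hd hx => ⟨(he hx).1.trans_le hd.1, ?_⟩⟩
      exact fun c hc => (he' hx).2 c (Metric.ball_subset_ball hd.2 hc))
    (by
      intro x
      by_cases hx : x ∈ L
      · have h1 := hE.mem_nhds (huE x hx)
        rw [nhds_prod_eq, Filter.mem_prod_iff] at h1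
        obtain ⟨A, hA, C, hC, hAC⟩ := h1
        obtain ⟨e, he, heC⟩ := Metric.mem_nhds_iff.1 hC
        refine ⟨e / 2, ?_⟩
        filter_upwards [hA, (huat x hx).eventually (Metric.ball_mem_nhds _ (half_pos he))] with
          y hy hyu _
        refine ⟨half_pos he, fun c hc => hAC (mk_mem_prod hy (heC ?_))⟩
        have := dist_triangle c (u y) (u x)
        rw [Metric.mem_ball] at hc ⊢
        linarith [show dist (u y) (u x) < e / 2 from hyu]
      · refine ⟨0, ?_⟩
        filter_upwards [hL.isOpen_compl.mem_nhds hx] with y hy hy'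
        exact absurd hy' hy)
  obtain ⟨a, ha⟩ := exists_contMDiffMap_forall_mem_convex_of_local_const (n := ⊤) IB
    (t := fun x => {c : F | x ∈ L → c ∈ Metric.ball (u x) (ε x)})
    (by
      intro x
      by_cases hx : x ∈ L
      · simp only [hx, forall_true_left]
        exact convex_ball (u x) (ε x)
      · simpa [hx] using convex_univ)
    (by
      intro x
      by_cases hx : x ∈ L
      · refine ⟨u x, ?_⟩
        have h1 : ∀ᶠ y in 𝓝 x, dist (u x) (u y) < ε y := by
          have : ContinuousAt (fun y => ε y - dist (u x) (u y)) x :=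
            ε.contMDiff.continuous.continuousAt.sub (continuousAt_const.dist (huat x hx))
          have h2 := this.eventually (lt_mem_nhds (a := 0) (by simpa using (hε x hx).1))
          filter_upwards [h2] with y hy
          linarith
        filter_upwards [h1] with y hy _
        exact hy
      · refine ⟨0, ?_⟩
        filter_upwards [hL.isOpen_compl.mem_nhds hx] with y hy hy'
        exact absurd hy' hy)
  refine ⟨a, a.contMDiff, fun x hx r hr => (hε x hx).2 _ ?_⟩
  exact (convex_ball (u x) (ε x)) (Metric.mem_ball_self (hε x hx).1) (ha x hx)
    (sub_nonneg.2 hr.2) hr.1 (by ring)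

theorem exists_lift_smooth_on {π : P → M} {f : B → M} (hf : ContMDiff IB IM ∞ f)
    {s : B → P} (hs : Continuous s) (hsf : ∀ x, π (s x) = f x) {Ω : Set (B × P)} (hΩ : IsOpen Ω)
    (hsΩ : ∀ x, (x, s x) ∈ Ω) {K L : Set B} (hK : IsClosed K) (hL : IsClosed L)
    (hKL : K ⊆ interior L) {O : Set P} {v : P → F} {E : Set (M × F)} {w : M × F → P}
    (hO : IsOpen O) (hE : IsOpen E) (hv : ContMDiffOn IP 𝓘(ℝ, F) ∞ v O)
    (hw : ContMDiffOn (IM.prod 𝓘(ℝ, F)) IP ∞ w E)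
    (hOE : ∀ q ∈ O, (π q, v q) ∈ E ∧ w (π q, v q) = q) (hEπ : ∀ y ∈ E, π (w y) = y.1)
    (hLO : ∀ x ∈ L, s x ∈ O) :
    ∃ s' : B → P, Continuous s' ∧ (∀ x, π (s' x) = f x) ∧ (∀ x, (x, s' x) ∈ Ω) ∧
      (∀ x ∉ L, s' x = s x) ∧ (∀ x, ContMDiffAt IB IP ∞ s x → ContMDiffAt IB IP ∞ s' x) ∧
      ∀ x ∈ K, ContMDiffAt IB IP ∞ s' x := by
  classical
  have : LocallyCompactSpace HB := IB.locallyCompactSpace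
  have : LocallyCompactSpace B := ChartedSpace.locallyCompactSpace HB B
  have hLW : L ⊆ s ⁻¹' O := hLO
  have hW : IsOpen (s ⁻¹' O) := hO.preimage hs
  have hu : ContinuousOn (fun x => v (s x)) (s ⁻¹' O) :=
    hv.continuousOn.comp hs.continuousOn fun x hx => hx
  set E' : Set (B × F) := (fun q : B × F => (f q.1, q.2)) ⁻¹' E ∩
    (fun q : B × F => (q.1, w (f q.1, q.2))) ⁻¹' Ω with hE'
  have hfc : Continuous fun q : B × F => (f q.1, q.2) :=
    (hf.continuous.comp continuous_fst).prodMk continuous_snd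
  have hE'o : IsOpen E' := by
    refine ContinuousOn.isOpen_inter_preimage (ContinuousOn.prodMk continuous_fst.continuousOn
      (hw.continuousOn.comp hfc.continuousOn fun q hq => hq)) (hE.preimage hfc) hΩ
  obtain ⟨a, ha, haE⟩ := exists_contMDiff_approx_within (IB := IB) hL hW hLW hu hE'o (by
    intro x hx
    have h1 := hOE _ (hLO x hx)
    rw [hsf] at h1
    refine ⟨h1.1, ?_⟩
    simpa [h1.2] using hsΩ x)
  obtain ⟨χ, hχ0, hχ1, hχI⟩ := exists_contMDiffMap_zero_one_nhds_of_isClosed (n := ⊤) IB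
    (isOpen_interior (s := L)).isClosed_compl hK (disjoint_compl_left_iff_subset.2 hKL)
  set z : B → F := fun x => (1 - χ x) • v (s x) + χ x • a x with hz
  have hzE : ∀ x ∈ L, (x, z x) ∈ E' := fun x hx => haE x hx _ (hχI x)
  set s' : B → P := fun x => if x ∈ L then w (f x, z x) else s x with hs'
  have hin : ∀ x ∈ interior L, s' =ᶠ[𝓝 x] fun x => w (f x, z x) := by
    intro x hx
    filter_upwards [isOpen_interior.mem_nhds hx] with y hy
    exact if_pos (interior_subset hy)
  have hout : ∀ x ∉ interior L, s' =ᶠ[𝓝 x] s := by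
    intro x hx
    filter_upwards [Filter.eventually_iff.1 (hχ0.filter_mono (nhds_le_nhdsSet hx))] with y hy
    by_cases hyL : y ∈ L
    · have h1 := (hOE _ (hLO y hyL)).2
      rw [hsf] at h1
      have hy0 : χ y = 0 := hy
      simp [hs', hyL, hz, hy0, h1]
    · simp [hs', hyL]
  have hsv : ∀ x ∈ interior L, ContMDiffAt IB 𝓘(ℝ, F) ∞ z x → ContMDiffAt IB IP ∞ s' x := by
    intro x hx hzx
    refine ContMDiffAt.congr_of_eventuallyEq ?_ (hin x hx)
    have h1 : ContMDiffAt (IM.prod 𝓘(ℝ, F)) IP ∞ w (f x, z x) :=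
      hw.contMDiffAt (hE.mem_nhds (hzE x (interior_subset hx)).1)
    exact h1.comp x (hf.contMDiffAt.prodMk hzx)
  refine ⟨s', ?_, ?_, ?_, fun x hx => if_neg hx, ?_, ?_⟩
  · rw [continuous_iff_continuousAt]
    intro x
    by_cases hx : x ∈ interior L
    · refine ContinuousAt.congr ?_ (hin x hx).symm
      have h1 : ContinuousAt w (f x, z x) :=
        hw.continuousOn.continuousAt (hE.mem_nhds (hzE x (interior_subset hx)).1)
      have h2 : ContinuousAt z x := by
        have := hu.continuousAt (hW.mem_nhds (hLW (interior_subset hx)))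
        have h3 := χ.contMDiff.continuous.continuousAt (x := x)
        have h4 := ha.continuous.continuousAt (x := x)
        exact ((continuousAt_const.sub h3).smul this).add (h3.smul h4)
      exact ContinuousAt.comp (f := fun x => (f x, z x)) h1
        (hf.continuous.continuousAt.prodMk h2)
    · exact hs.continuousAt.congr (hout x hx).symm
  · intro x
    by_cases hx : x ∈ L
    · simp only [hs', if_pos hx]
      exact hEπ _ (hzE x hx).1
    · simp only [hs', if_neg hx, hsf]
  · intro x
    by_cases hx : x ∈ L
    · simp only [hs', if_pos hx]
      exact (hzE x hx).2
    · simp only [hs', if_neg hx, hsΩ]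
  · intro x hsx
    by_cases hx : x ∈ interior L
    · refine hsv x hx ?_
      have h1 : ContMDiffAt IB 𝓘(ℝ, F) ∞ (fun x => v (s x)) x :=
        (hv.contMDiffAt (hO.mem_nhds (hLO x (interior_subset hx)))).comp x hsx
      have h3 := χ.contMDiff.contMDiffAt (x := x)
      exact ((contMDiffAt_const.sub h3).smul h1).add (h3.smul ha.contMDiffAt)
    · exact hsx.congr_of_eventuallyEq (hout x hx)
  · intro x hx
    refine hsv x (hKL hx) (ha.contMDiffAt.congr_of_eventuallyEq ?_)
    filter_upwards [Filter.eventually_iff.1 (hχ1.filter_mono (nhds_le_nhdsSet hx))] with y hy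
    have hy1 : χ y = 1 := hy
    simp [hz, hy1]

theorem HasVerticalCharts.exists_smooth_lift [SecondCountableTopology B] {π : P → M}
    (hπ : HasVerticalCharts F IP IM π) {f : B → M} (hf : ContMDiff IB IM ∞ f)
    {s₀ : B → P} (hs₀ : Continuous s₀) (hsf : ∀ x, π (s₀ x) = f x) :
    ∃ s : B → P, ContMDiff IB IP ∞ s ∧ ∀ x, π (s x) = f x := by
  cases isEmpty_or_nonempty B with
  | inl h => exact ⟨s₀, fun x => h.elim x, hsf⟩
  | inr h =>
  have : LocallyCompactSpace HB := IB.locallyCompactSpace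
  have : LocallyCompactSpace B := ChartedSpace.locallyCompactSpace HB B
  choose O v E w hO hpO hE hv hw hOE hEπ using hπ
  obtain ⟨c, K, L, hK, hL, hKL, hLS, hLf, hKU⟩ := exists_seq_closed_shrinking
    (S := fun x => s₀ ⁻¹' O (s₀ x)) fun x => ((hO _).preimage hs₀).mem_nhds (hpO _)
  set Ω : Set (B × P) := (⋃ n, L n ×ˢ (O (s₀ (c n)))ᶜ)ᶜ
  have hΩo : IsOpen Ω := by
    refine (LocallyFinite.isClosed_iUnion ?_ fun n =>
      (hL n).prod (hO _).isClosed_compl).isOpen_compl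
    exact (hLf.preimage_continuous continuous_fst).subset fun n q hq => hq.1
  let State := {s : B → P // Continuous s ∧ (∀ x, π (s x) = f x) ∧ ∀ x, (x, s x) ∈ Ω}
  have key : ∀ (n : ℕ) (s : State), ∃ s' : State, (∀ x ∉ L n, s'.1 x = s.1 x) ∧
      (∀ x, ContMDiffAt IB IP ∞ s.1 x → ContMDiffAt IB IP ∞ s'.1 x) ∧
      ∀ x ∈ K n, ContMDiffAt IB IP ∞ s'.1 x := by
    rintro n ⟨s, hs, hsf, hsΩ⟩
    obtain ⟨s', h1, h2, h3, h4, h5, h6⟩ := exists_lift_smooth_on (IP := IP) hf hs hsf hΩo hsΩ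
      (hK n) (hL n) (hKL n) (hO (s₀ (c n))) (hE _) (hv _) (hw _) (hOE _) (hEπ _) (by
        intro x hx
        by_contra hxO
        exact hsΩ x (mem_iUnion.2 ⟨n, hx, hxO⟩))
    exact ⟨⟨s', h1, h2, h3⟩, h4, h5, h6⟩
  choose next hnext1 hnext2 hnext3 using key
  let q₀ : State := ⟨s₀, hs₀, hsf, fun x hx => by
    obtain ⟨n, hn⟩ := mem_iUnion.1 hx
    exact hn.2 (hLS n hn.1)⟩
  let q : ℕ → State := fun n => Nat.rec q₀ (fun n q => next n q) n
  have hlf : LocallyFinite fun n => {x | (q (n + 1)).1 x ≠ (q n).1 x} := by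
    refine hLf.subset fun n x hx => ?_
    by_contra hxL
    exact hx (hnext1 n (q n) x hxL)
  obtain ⟨Q, hQ⟩ := hlf.exists_forall_eventually_atTop_eventuallyEq (f := fun n => (q n).1)
  have hev : ∀ x, ∃ n, (q n).1 =ᶠ[𝓝 x] Q ∧ ContMDiffAt IB IP ∞ (q n).1 x := by
    intro x
    obtain ⟨N, hN⟩ := Filter.eventually_atTop.1 (hQ x)
    obtain ⟨j, hj⟩ := mem_iUnion.1 (hKU.symm ▸ mem_univ x : x ∈ ⋃ n, K n)
    refine ⟨max N (j + 1), hN _ (le_max_left _ _), ?_⟩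
    have h1 : ∀ k, ContMDiffAt IB IP ∞ (q (j + 1 + k)).1 x := by
      intro k
      induction k with
      | zero => exact hnext3 j (q j) x hj
      | succ k ih => exact hnext2 _ _ x ih
    obtain ⟨k, hk⟩ := Nat.exists_eq_add_of_le (le_max_right N (j + 1))
    rw [hk]
    exact h1 k
  refine ⟨Q, fun x => ?_, fun x => ?_⟩
  · obtain ⟨n, hn, hn'⟩ := hev x
    exact hn'.congr_of_eventuallyEq hn.symm
  · obtain ⟨n, hn, -⟩ := hev x
    rw [← hn.self_of_nhds]
    exact (q n).2.2.1 x

/-- A smooth map from a contractible manifold lifts along a locally trivial submersion. -/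
theorem exists_smooth_lift_of_contractible [SecondCountableTopology B]
    (hB : IsEmpty B ∨ ContractibleSpace B) {π : P → M} (hπ : HasVerticalCharts F IP IM π)
    (hπ' : HasLocalTransports π) (hπs : Surjective π) {f : B → M} (hf : ContMDiff IB IM ∞ f) :
    ∃ s : B → P, ContMDiff IB IP ∞ s ∧ ∀ x, π (s x) = f x := by
  have : LocallyCompactSpace HB := IB.locallyCompactSpace
  have : LocallyCompactSpace B := ChartedSpace.locallyCompactSpace HB B
  rcases hB with h | h
  · exact ⟨fun x => h.elim x, fun x => h.elim x, fun x => h.elim x⟩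
  · obtain ⟨s, hs, hsf⟩ := hπ'.exists_lift_of_contractible hπs hf.continuous
    exact hπ.exists_smooth_lift hf hs hsf

end Smoothing

section FiberwiseInverse

variable {EM EG EK : Type*} [NormedAddCommGroup EM] [NormedSpace ℝ EM]
  [NormedAddCommGroup EG] [NormedSpace ℝ EG] [NormedAddCommGroup EK] [NormedSpace ℝ EK]

/-- The partial derivative of `f` at `u` is invertible if `f (u.1, ·)` has a local inverse that is
differentiable at `f u`. -/
theorem DifferentiableAt.isInvertible_fderiv_comp_inr {E : Type*} [NormedAddCommGroup E]
    [NormedSpace ℝ E] {f : E × EG → EK} {u : E × EG} (hf : DifferentiableAt ℝ f u)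
    {h : EK → EG} (hh : DifferentiableAt ℝ h (f u)) (hhu : h (f u) = u.2)
    (hhf : ∀ᶠ y in 𝓝 u.2, h (f (u.1, y)) = y) (hfh : ∀ᶠ z in 𝓝 (f u), f (u.1, h z) = z) :
    (fderiv ℝ f u ∘L .inr ℝ E EG).IsInvertible := by
  have hD : HasFDerivAt (fun y => f (u.1, y)) (fderiv ℝ f u ∘L .inr ℝ E EG) u.2 :=
    HasFDerivAt.comp (f := fun y => (u.1, y)) u.2 (g := f) hf.hasFDerivAt
      (hasFDerivAt_prodMk_right u.1 u.2)
  have h1 : HasFDerivAt (fun y => h (f (u.1, y)))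
      (fderiv ℝ h (f u) ∘L (fderiv ℝ f u ∘L .inr ℝ E EG)) u.2 :=
    HasFDerivAt.comp u.2 (g := h) hh.hasFDerivAt hD
  have h2 : HasFDerivAt (fun z => f (u.1, h z))
      ((fderiv ℝ f u ∘L .inr ℝ E EG) ∘L fderiv ℝ h (f u)) (f u) := by
    refine HasFDerivAt.comp (f u) (g := fun y => f (u.1, y)) ?_ hh.hasFDerivAt
    rw [hhu]
    exact hD
  refine ContinuousLinearMap.IsInvertible.of_inverse (g := fderiv ℝ h (f u)) ?_ ?_
  · exact h2.unique ((hasFDerivAt_id _).congr_of_eventuallyEq hfh)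
  · exact h1.unique ((hasFDerivAt_id _).congr_of_eventuallyEq hhf)

theorem contMDiffAt_extChartAt_symm {E X : Type*} [NormedAddCommGroup E] [NormedSpace ℝ E]
    [TopologicalSpace X] [ChartedSpace E X] [IsManifold 𝓘(ℝ, E) ∞ X] (x : X) :
    ContMDiffAt 𝓘(ℝ, E) 𝓘(ℝ, E) ∞ (extChartAt 𝓘(ℝ, E) x).symm (extChartAt 𝓘(ℝ, E) x x) :=
  (contMDiffOn_extChartAt_symm x).contMDiffAt (extChartAt_target_mem_nhds x)

variable {M G K : Type*} [TopologicalSpace M] [ChartedSpace EM M] [IsManifold 𝓘(ℝ, EM) ∞ M]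
  [TopologicalSpace G] [ChartedSpace EG G] [IsManifold 𝓘(ℝ, EG) ∞ G]
  [TopologicalSpace K] [ChartedSpace EK K] [IsManifold 𝓘(ℝ, EK) ∞ K]

variable [CompleteSpace EM] [CompleteSpace EG] [CompleteSpace EK]

/-- The inverses of a smooth family of diffeomorphisms form a smooth family. -/
theorem contMDiffAt_fiberwise_inverse {θ : M × G → K} {η : M × K → G} {m₀ : M} {k₀ : K}
    {V : Set M} (hV : V ∈ 𝓝 m₀)
    (hθ : ContMDiffAt (𝓘(ℝ, EM).prod 𝓘(ℝ, EG)) 𝓘(ℝ, EK) ∞ θ (m₀, η (m₀, k₀)))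
    (hη : ContMDiff 𝓘(ℝ, EK) 𝓘(ℝ, EG) ∞ fun k => η (m₀, k))
    (hηθ : ∀ m ∈ V, ∀ g, η (m, θ (m, g)) = g) (hθη : ∀ m ∈ V, ∀ k, θ (m, η (m, k)) = k) :
    ContMDiffAt (𝓘(ℝ, EM).prod 𝓘(ℝ, EK)) 𝓘(ℝ, EG) ∞ η (m₀, k₀) := by
  have hm₀ : m₀ ∈ V := mem_of_mem_nhds hV
  obtain ⟨g₀, hg₀⟩ : ∃ g, η (m₀, k₀) = g := ⟨_, rfl⟩
  have hk₀ : θ (m₀, g₀) = k₀ := by rw [← hg₀, hθη _ hm₀]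
  rw [hg₀] at hθ
  set φ := extChartAt 𝓘(ℝ, EM) m₀
  set ψ := extChartAt 𝓘(ℝ, EG) g₀
  set ψ' := extChartAt 𝓘(ℝ, EK) k₀
  have eφ : φ.symm (φ m₀) = m₀ := extChartAt_to_inv m₀
  have eψ : ψ.symm (ψ g₀) = g₀ := extChartAt_to_inv g₀
  have eψ' : ψ'.symm (ψ' k₀) = k₀ := extChartAt_to_inv k₀
  have sφ : ContMDiffAt 𝓘(ℝ, EM) 𝓘(ℝ, EM) ∞ φ.symm (φ m₀) := contMDiffAt_extChartAt_symm m₀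
  have sψ : ContMDiffAt 𝓘(ℝ, EG) 𝓘(ℝ, EG) ∞ ψ.symm (ψ g₀) := contMDiffAt_extChartAt_symm g₀
  have sψ' : ContMDiffAt 𝓘(ℝ, EK) 𝓘(ℝ, EK) ∞ ψ'.symm (ψ' k₀) := contMDiffAt_extChartAt_symm k₀
  set f : (EM × EK) × EG → EK := fun q => ψ' (θ (φ.symm q.1.1, ψ.symm q.2)) - q.1.2 with hf
  set u : (EM × EK) × EG := ((φ m₀, ψ' k₀), ψ g₀) with hu
  have hfu : f u = 0 := by simp [hf, hu, eφ, eψ, hk₀]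
  have cdf : ContDiffAt ℝ ∞ f u := by
    refine ContDiffAt.sub ?_ (contDiff_snd.comp contDiff_fst).contDiffAt
    rw [← contMDiffAt_iff_contDiffAt]
    have h1 : ContMDiffAt 𝓘(ℝ, (EM × EK) × EG) 𝓘(ℝ, EM) ∞
        (fun q : (EM × EK) × EG => φ.symm q.1.1) u :=
      ContMDiffAt.comp (g := φ.symm) u sφ
        (contDiff_fst.comp contDiff_fst).contDiffAt.contMDiffAt
    have h2 : ContMDiffAt 𝓘(ℝ, (EM × EK) × EG) 𝓘(ℝ, EG) ∞
        (fun q : (EM × EK) × EG => ψ.symm q.2) u :=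
      ContMDiffAt.comp (g := ψ.symm) u sψ contDiff_snd.contDiffAt.contMDiffAt
    have h3 : ContMDiffAt 𝓘(ℝ, (EM × EK) × EG) 𝓘(ℝ, EK) ∞
        (fun q : (EM × EK) × EG => θ (φ.symm q.1.1, ψ.symm q.2)) u := by
      refine ContMDiffAt.comp (g := θ) u ?_ (h1.prodMk h2)
      simpa only [hu, eφ, eψ] using hθ
    refine ContMDiffAt.comp (g := ψ') u ?_ h3
    simp only [hu, eφ, eψ, hk₀]
    exact contMDiffAt_extChartAt
  have hinv : (fderiv ℝ f u ∘L .inr ℝ (EM × EK) EG).IsInvertible := by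
    refine DifferentiableAt.isInvertible_fderiv_comp_inr (cdf.differentiableAt (by simp))
      (h := fun z => ψ (η (m₀, ψ'.symm (z + ψ' k₀)))) ?_ ?_ ?_ ?_
    · have : ContDiffAt ℝ ∞ (fun z => ψ (η (m₀, ψ'.symm (z + ψ' k₀)))) (f u) := by
        rw [← contMDiffAt_iff_contDiffAt, hfu]
        have h1 : ContMDiffAt 𝓘(ℝ, EK) 𝓘(ℝ, EK) ∞ (fun z => ψ'.symm (z + ψ' k₀)) 0 := by
          refine ContMDiffAt.comp (g := ψ'.symm) 0 ?_
            (contDiff_id.add contDiff_const).contDiffAt.contMDiffAt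
          simpa using sψ'
        have h2 := hη.contMDiffAt.comp (0 : EK) h1
        refine ContMDiffAt.comp (g := ψ) (0 : EK) ?_ h2
        simp only [zero_add, eψ', hg₀]
        exact contMDiffAt_extChartAt
      exact this.differentiableAt (by simp)
    · simp only [hfu, zero_add, eψ', hg₀]
      rfl
    · have h1 : ∀ᶠ y in 𝓝 (ψ g₀), θ (m₀, ψ.symm y) ∈ ψ'.source := by
        have : ContinuousAt (fun y => θ (m₀, ψ.symm y)) (ψ g₀) := by
          refine ContinuousAt.comp (g := θ) ?_ (continuousAt_const.prodMk sψ.continuousAt)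
          rw [eψ]
          exact hθ.continuousAt
        refine this.eventually ?_
        simp only [eψ, hk₀]
        exact extChartAt_source_mem_nhds k₀
      filter_upwards [h1, extChartAt_target_mem_nhds (I := 𝓘(ℝ, EG)) g₀] with y hy hy'
      simp only [hf, hu, sub_add_cancel, eφ]
      rw [ψ'.left_inv hy, hηθ _ hm₀]
      exact ψ.right_inv hy'
    · rw [hfu]
      have h0 : ContinuousAt (fun z => ψ'.symm (z + ψ' k₀)) 0 := by
        refine ContinuousAt.comp (g := ψ'.symm) ?_ (by fun_prop)
        simpa using sψ'.continuousAt
      have h1 : ∀ᶠ z in 𝓝 (0 : EK), η (m₀, ψ'.symm (z + ψ' k₀)) ∈ ψ.source := by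
        have := hη.continuous.continuousAt.comp h0
        refine this.eventually ?_
        simp only [comp_apply, zero_add, eψ', hg₀]
        exact extChartAt_source_mem_nhds g₀
      have h2 : ∀ᶠ z in 𝓝 (0 : EK), z + ψ' k₀ ∈ ψ'.target := by
        have : ContinuousAt (fun z : EK => z + ψ' k₀) 0 := by fun_prop
        refine this.eventually ?_
        simp only [zero_add]
        exact extChartAt_target_mem_nhds k₀
      filter_upwards [h1, h2] with z hz hz'
      simp only [hf, hu, eφ]
      rw [ψ.left_inv hz, hθη _ hm₀, ψ'.right_inv hz', add_sub_cancel_right]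
  set imp := cdf.implicitFunction (by simp) hinv
  have himp : ContDiffAt ℝ ∞ imp u.1 := cdf.contDiffAt_implicitFunction (by simp) hinv
  have himpu : imp u.1 = ψ g₀ := cdf.implicitFunction_apply_self (by simp) hinv
  have himpf : ∀ᶠ x in 𝓝 u.1, f (x, imp x) = 0 := by
    have := cdf.eventually_apply_implicitFunction (by simp) hinv
    rwa [hfu] at this
  have hφψ : ContMDiffAt (𝓘(ℝ, EM).prod 𝓘(ℝ, EK)) 𝓘(ℝ, EM × EK) ∞
      (fun q : M × K => (φ q.1, ψ' q.2)) (m₀, k₀) := by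
    exact (ContMDiffAt.comp (g := φ) (m₀, k₀) contMDiffAt_extChartAt contMDiffAt_fst).prodMk_space
      (ContMDiffAt.comp (g := ψ') (m₀, k₀) contMDiffAt_extChartAt contMDiffAt_snd)
  have hη' : ContMDiffAt (𝓘(ℝ, EM).prod 𝓘(ℝ, EK)) 𝓘(ℝ, EG) ∞
      (fun q : M × K => ψ.symm (imp (φ q.1, ψ' q.2))) (m₀, k₀) := by
    refine ContMDiffAt.comp (g := ψ.symm) (m₀, k₀) ?_
      (ContMDiffAt.comp (g := imp) (m₀, k₀) himp.contMDiffAt hφψ)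
    rwa [show imp (φ m₀, ψ' k₀) = ψ g₀ from himpu]
  refine hη'.congr_of_eventuallyEq ?_
  have e1 : ∀ᶠ q : M × K in 𝓝 (m₀, k₀), q.1 ∈ V := continuousAt_fst.eventually hV
  have e2 : ∀ᶠ q : M × K in 𝓝 (m₀, k₀), q.1 ∈ φ.source :=
    continuousAt_fst.eventually (extChartAt_source_mem_nhds m₀)
  have e3 : ∀ᶠ q : M × K in 𝓝 (m₀, k₀), q.2 ∈ ψ'.source :=
    continuousAt_snd.eventually (extChartAt_source_mem_nhds k₀)
  have e4 : ∀ᶠ q : M × K in 𝓝 (m₀, k₀), f ((φ q.1, ψ' q.2), imp (φ q.1, ψ' q.2)) = 0 :=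
    hφψ.continuousAt.eventually himpf
  have e5 : ∀ᶠ q : M × K in 𝓝 (m₀, k₀),
      θ (q.1, ψ.symm (imp (φ q.1, ψ' q.2))) ∈ ψ'.source := by
    have : ContinuousAt (fun q : M × K => θ (q.1, ψ.symm (imp (φ q.1, ψ' q.2)))) (m₀, k₀) := by
      refine ContinuousAt.comp (g := θ) ?_ (continuousAt_fst.prodMk hη'.continuousAt)
      simp only
      rw [show imp (φ m₀, ψ' k₀) = ψ g₀ from himpu, eψ]
      exact hθ.continuousAt
    refine this.eventually ?_
    simp only
    rw [show imp (φ m₀, ψ' k₀) = ψ g₀ from himpu, eψ, hk₀]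
    exact extChartAt_source_mem_nhds k₀
  filter_upwards [e1, e2, e3, e4, e5] with q h1 h2 h3 h4 h5
  have h6 : ψ' (θ (q.1, ψ.symm (imp (φ q.1, ψ' q.2)))) = ψ' q.2 := by
    have := sub_eq_zero.1 h4
    simpa only [φ.left_inv h2] using this
  have h7 := ψ'.injOn h5 h3 h6
  have h8 := hηθ _ h1 (ψ.symm (imp (φ q.1, ψ' q.2)))
  rw [h7] at h8
  exact h8

end FiberwiseInverse

noncomputable section

/-! ### The adapted extension of a cocycle -/

section CechMaps

variable {EN : Type*} [NormedAddCommGroup EN] [NormedSpace ℝ EN]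
  {N : Type u} [TopologicalSpace N] [ChartedSpace EN N]
  {I : Type u} (U : I → Opens N)

theorem Coprod.eventually_fst_eq {ι : Type*} {V : ι → Opens N} (q : Coprod V) :
    ∀ᶠ q' in 𝓝 q, q'.1 = q.1 := by
  have : IsOpen (range fun y : V q.1 => (⟨q.1, y⟩ : Coprod V)) := isOpen_range_sigmaMk
  filter_upwards [this.mem_nhds ⟨q.2, rfl⟩]
  rintro _ ⟨y, rfl⟩
  rfl

open Classical in
/-- The point `x_ijk` determined by `x_ij` and `x_jk` (with an irrelevant value on non-composable
pairs). -/
def cechTriple {U : I → Opens N} (a b : Cech1 U) : Cech2 U :=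
  if h : a.val ∈ U b.1.2 then cech2 a.1.1 a.1.2 b.1.2 a.val a.2.2.1 a.2.2.2 h
  else cech2 a.1.1 a.1.2 a.1.2 a.val a.2.2.1 a.2.2.2 a.2.2.2

theorem cechTriple_mk {U : I → Opens N} (i j j' k : I) (x : N) (hi : x ∈ U i) (hj : x ∈ U j)
    (hj' : x ∈ U j') (hk : x ∈ U k) :
    cechTriple (cech1 i j x hi hj) (cech1 j' k x hj' hk) = cech2 i j k x hi hj hk :=
  dif_pos hk

variable [IsManifold 𝓘(ℝ, EN) ∞ N]

theorem contMDiffOn_cechTriple :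
    ContMDiffOn (𝓘(ℝ, EN).prod 𝓘(ℝ, EN)) 𝓘(ℝ, EN) ∞
      (fun p : Cech1 U × Cech1 U => cechTriple p.1 p.2)
      {p | (cechGroupoid (EN := EN) U).tgt p.1 = (cechGroupoid (EN := EN) U).src p.2} := by
  have hval : ∀ p : Cech1 U × Cech1 U, (cechTriple p.1 p.2).val = p.1.val := by
    intro p
    unfold cechTriple
    split_ifs <;> rfl
  have h3 : ∀ q : Cech1 U × Cech1 U,
      (cechGroupoid (EN := EN) U).tgt q.1 = (cechGroupoid (EN := EN) U).src q.2 →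
      (cechTriple q.1 q.2).1 = (q.1.1.1, q.1.1.2, q.2.1.2) := by
    rintro ⟨a, b⟩ hq
    obtain ⟨i, j, k, x, hi, hj, hk, rfl, rfl⟩ := Cech1.composable hq
    rw [cechTriple_mk]
    rfl
  intro p hp
  apply Coprod.contMDiffWithinAt_of_val
  · have h2 := ((continuous_fst.tendsto p).eventually (Coprod.eventually_fst_eq p.1)).and
      ((continuous_snd.tendsto p).eventually (Coprod.eventually_fst_eq p.2))
    filter_upwards [nhdsWithin_le_nhds h2, self_mem_nhdsWithin] with q hq hq'
    rw [h3 q hq', h3 p hp, hq.1, hq.2]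
  · simp only [hval]
    exact (Coprod.contMDiff_val.comp contMDiff_fst).contMDiffAt.contMDiffWithinAt

/-- The inclusions `x ↦ x_j`, `∐ Wⱼ → ∐ Vᵢ`, composed with a projection, are submersions. -/
theorem Coprod.incl_comp_snd_isSubmersion {ι κ : Type*} {W : κ → Opens N} {V : ι → Opens N}
    (k : κ → ι) (h : ∀ j, W j ≤ V (k j)) {EG : Type*} [NormedAddCommGroup EG] [NormedSpace ℝ EG]
    {G : Type*} [TopologicalSpace G] [ChartedSpace EG G] [IsManifold 𝓘(ℝ, EG) ∞ G] :
    IsSubmersion (𝓘(ℝ, EG).prod 𝓘(ℝ, EN)) 𝓘(ℝ, EN) ∞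
      (fun r : G × Coprod W => (Coprod.incl k h r.2 : Coprod V)) := by
  refine IsSubmersionOfComplement.isSubmersion (F := EG) fun x => ?_
  refine IsSubmersionAtOfComplement.mk_of_continuousAt
    ((Coprod.continuous_incl k h).comp continuous_snd).continuousAt
    (ContinuousLinearEquiv.prodComm ℝ EG EN)
    (chartAt (ModelProd EG EN) x) (chartAt EN (Coprod.incl k h x.2)) (mem_chart_source _ _)
    (mem_chart_source _ _) (IsManifold.chart_mem_maximalAtlas _)
    (IsManifold.chart_mem_maximalAtlas _) ?_
  intro z hz
  have hz' : z.2 ∈ (chartAt EN x.2).target := by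
    simp only [OpenPartialHomeomorph.extend, mfld_simps] at hz
    exact hz.2
  obtain ⟨y, hy, hyz⟩ : ∃ y : W x.2.1, (chartAt EN x.2).symm z.2 = ⟨x.2.1, y⟩ ∧
      chartAt EN x.2.val y.1 = z.2 := by
    obtain ⟨y, hy1, hy2⟩ := (chartAt EN x.2).map_target hz'
    refine ⟨y, hy2.symm, ?_⟩
    have := (chartAt EN x.2).right_inv hz'
    rw [← hy2] at this
    rw [← this]
    exact (Coprod.chartAt_mk x.2 x.2.1 rfl y.1 y.2).symm
  have hzy : ((chartAt (ModelProd EG EN) x).extend (𝓘(ℝ, EG).prod 𝓘(ℝ, EN))).symm z =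
      ((chartAt EG x.1).symm z.1, (chartAt EN x.2).symm z.2) := by
    rfl
  rw [comp_apply, comp_apply, hzy, hy,
    show (Coprod.incl k h ⟨x.2.1, y⟩ : Coprod V) = ⟨k x.2.1, y.1, h _ y.2⟩ from rfl,
    OpenPartialHomeomorph.extend_coe, comp_apply,
    Coprod.chartAt_mk (Coprod.incl k h x.2) (k x.2.1) rfl]
  exact hyz

end CechMaps

namespace NonabelianCocycle

variable {EN : Type*} [NormedAddCommGroup EN] [NormedSpace ℝ EN]
  {N : Type u} [TopologicalSpace N] [ChartedSpace EN N]
  {I : Type u} {U : I → Opens N} [IsManifold 𝓘(ℝ, EN) ∞ N]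
  {EG EH : Type*} [NormedAddCommGroup EG] [NormedSpace ℝ EG]
  [NormedAddCommGroup EH] [NormedSpace ℝ EH]
  {G H : Type u} [Group G] [TopologicalSpace G] [ChartedSpace EG G] [LieGroup 𝓘(ℝ, EG) ∞ G]
  [Group H] [TopologicalSpace H] [ChartedSpace EH H] [LieGroup 𝓘(ℝ, EH) ∞ H]
  {X : LieCrossedModule 𝓘(ℝ, EG) G 𝓘(ℝ, EH) H}

section Identities

variable (c : NonabelianCocycle (EN := EN) U X)

theorem lam_ii (i : I) (x : N) (hi : x ∈ U i) : c.lam (cech1 i i x hi hi) = 1 := by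
  have h := c.ρ_g i i i x hi hi hi
  rw [c.g_iij, map_one, one_mul] at h
  simpa using h

theorem g_ijj (i j : I) (x : N) (hi : x ∈ U i) (hj : x ∈ U j) :
    c.g (cech2 i j j x hi hj hj) = 1 := by
  have h := c.g_mul_g i j j j x hi hj hj hj
  rw [c.g_iij, map_one, one_mul] at h
  simpa using h

theorem g_iji (i j : I) (x : N) (hi : x ∈ U i) (hj : x ∈ U j) :
    c.g (cech2 i j i x hi hj hi) =
      X.act (c.lam (cech1 i j x hi hj)) (c.g (cech2 j i j x hj hi hj)) := by
  have h := c.g_mul_g i j i j x hi hj hi hj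
  rwa [c.g_iij, c.g_ijj, mul_one, mul_one] at h

theorem act_lam_act_lam (i j k : I) (x : N) (hi : x ∈ U i) (hj : x ∈ U j) (hk : x ∈ U k) (y : G) :
    X.act (c.lam (cech1 i j x hi hj)) (X.act (c.lam (cech1 j k x hj hk)) y) =
      c.g (cech2 i j k x hi hj hk) * X.act (c.lam (cech1 i k x hi hk)) y *
        (c.g (cech2 i j k x hi hj hk))⁻¹ := by
  rw [← MulAut.mul_apply, ← map_mul, ← c.ρ_g, map_mul, MulAut.mul_apply, X.act_ρ]

end Identities

/-- The product `(g, x_ij) • (g', x_jk) = (g λ_ij(g') g_ijk, x_ik)`. -/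
def modelMul (c : NonabelianCocycle (EN := EN) U X) (a b : G × Cech1 U) : G × Cech1 U :=
  (a.1 * X.act (c.lam a.2) b.1 * c.g (cechTriple a.2 b.2), cechMul a.2 b.2)

theorem modelMul_mk (c : NonabelianCocycle (EN := EN) U X) (i j k : I) (x : N) (hi : x ∈ U i)
    (hj : x ∈ U j) (hk : x ∈ U k) (g g' : G) :
    c.modelMul (g, cech1 i j x hi hj) (g', cech1 j k x hj hk) =
      (g * X.act (c.lam (cech1 i j x hi hj)) g' * c.g (cech2 i j k x hi hj hk),
        cech1 i k x hi hk) := by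
  rw [modelMul, cechTriple_mk, cechMul_mk]

/-- The inverse of `(g, x_ij)`. -/
def modelInv (c : NonabelianCocycle (EN := EN) U X) (a : G × Cech1 U) : G × Cech1 U :=
  (X.act (c.lam a.2)⁻¹ (a.1⁻¹ * (c.g (cechTriple a.2 ((cechGroupoid (EN := EN) U).inv a.2)))⁻¹),
    (cechGroupoid (EN := EN) U).inv a.2)

theorem modelInv_mk (c : NonabelianCocycle (EN := EN) U X) (i j : I) (x : N) (hi : x ∈ U i)
    (hj : x ∈ U j) (g : G) :
    c.modelInv (g, cech1 i j x hi hj) =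
      (X.act (c.lam (cech1 i j x hi hj))⁻¹ (g⁻¹ * (c.g (cech2 i j i x hi hj hi))⁻¹),
        cech1 j i x hj hi) := by
  rw [modelInv, show (cechGroupoid (EN := EN) U).inv (cech1 i j x hi hj) = cech1 j i x hj hi
    from rfl, cechTriple_mk]

theorem act_inv_act (X : LieCrossedModule 𝓘(ℝ, EG) G 𝓘(ℝ, EH) H) (h : H) (y : G) :
    X.act h⁻¹ (X.act h y) = y := by
  rw [← MulAut.mul_apply, ← map_mul, inv_mul_cancel, map_one, MulAut.one_apply]

theorem act_act_inv (X : LieCrossedModule 𝓘(ℝ, EG) G 𝓘(ℝ, EH) H) (h : H) (y : G) :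
    X.act h (X.act h⁻¹ y) = y := by
  rw [← MulAut.mul_apply, ← map_mul, mul_inv_cancel, map_one, MulAut.one_apply]

theorem exists_eq_cech1 (a : Cech1 U) : ∃ i j x hi hj, a = cech1 i j x hi hj :=
  ⟨a.1.1, a.1.2, a.2.1, a.2.2.1, a.2.2.2, rfl⟩

/-- The Lie groupoid `G × ∐ U_ij ⇉ ∐ U_i` of a cocycle. -/
def modelGroupoid (c : NonabelianCocycle (EN := EN) U X) :
    LieGroupoid (𝓘(ℝ, EG).prod 𝓘(ℝ, EN)) (G × Cech1 U) 𝓘(ℝ, EN) (Cech0 U) where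
  src r := (cechGroupoid (EN := EN) U).src r.2
  tgt r := (cechGroupoid (EN := EN) U).tgt r.2
  unit m := (1, (cechGroupoid (EN := EN) U).unit m)
  inv := c.modelInv
  mul := c.modelMul
  src_unit _ := rfl
  tgt_unit _ := rfl
  src_inv _ := rfl
  tgt_inv _ := rfl
  src_mul a b h := (cechGroupoid (EN := EN) U).src_mul a.2 b.2 h
  tgt_mul a b h := (cechGroupoid (EN := EN) U).tgt_mul a.2 b.2 h
  mul_assoc := by
    rintro ⟨g, a⟩ ⟨g', b⟩ ⟨g'', b'⟩ h h'
    obtain ⟨i, j, k, x, hi, hj, hk, rfl, rfl⟩ := Cech1.composable h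
    obtain ⟨k', l, y, hk', hl, rfl⟩ := exists_eq_cech1 b'
    obtain rfl : k = k' := congrArg Sigma.fst h'
    obtain rfl : x = y := congrArg Coprod.val h'
    rw [modelMul_mk, modelMul_mk, modelMul_mk, modelMul_mk]
    refine Prod.ext ?_ rfl
    simp only [map_mul, c.act_lam_act_lam i j k x hi hj hk]
    have := c.g_mul_g i j k l x hi hj hk hl
    simp only [mul_assoc]
    rw [← this]
    simp
  unit_mul := by
    rintro ⟨g, a⟩
    obtain ⟨i, j, x, hi, hj, rfl⟩ := exists_eq_cech1 a
    refine (c.modelMul_mk i i j x hi hi hj 1 g).trans ?_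
    rw [lam_ii, g_iij, map_one, MulAut.one_apply, one_mul, mul_one]
  mul_unit := by
    rintro ⟨g, a⟩
    obtain ⟨i, j, x, hi, hj, rfl⟩ := exists_eq_cech1 a
    refine (c.modelMul_mk i j j x hi hj hj g 1).trans ?_
    rw [g_ijj, map_one, mul_one, mul_one]
  mul_inv := by
    rintro ⟨g, a⟩
    obtain ⟨i, j, x, hi, hj, rfl⟩ := exists_eq_cech1 a
    rw [modelInv_mk, modelMul_mk, act_act_inv]
    refine Prod.ext ?_ rfl
    simp
  inv_mul := by
    rintro ⟨g, a⟩
    obtain ⟨i, j, x, hi, hj, rfl⟩ := exists_eq_cech1 a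
    rw [modelInv_mk, modelMul_mk]
    refine Prod.ext ?_ rfl
    apply (X.act (c.lam (cech1 i j x hi hj))).injective
    simp only [map_mul, map_one, act_act_inv, c.act_lam_act_lam i j i x hi hj hi, ← g_iji, lam_ii,
      MulAut.one_apply]
    group
  src_submersion := Coprod.incl_comp_snd_isSubmersion Prod.fst fun _ => inf_le_left
  tgt_submersion := Coprod.incl_comp_snd_isSubmersion Prod.snd fun _ => inf_le_right
  smooth_unit := contMDiff_const.prodMk (cechGroupoid (EN := EN) U).smooth_unit
  smooth_inv := by
    have hinv : ContMDiff (𝓘(ℝ, EG).prod 𝓘(ℝ, EN)) 𝓘(ℝ, EN) ∞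
        fun a : G × Cech1 U => (cechGroupoid (EN := EN) U).inv a.2 :=
      (cechGroupoid (EN := EN) U).smooth_inv.comp contMDiff_snd
    have ht : ContMDiff (𝓘(ℝ, EG).prod 𝓘(ℝ, EN)) 𝓘(ℝ, EN) ∞
        fun a : G × Cech1 U => cechTriple a.2 ((cechGroupoid (EN := EN) U).inv a.2) := by
      rw [← contMDiffOn_univ]
      exact (contMDiffOn_cechTriple U).comp (contMDiff_snd.prodMk hinv).contMDiffOn
        fun a _ => ((cechGroupoid (EN := EN) U).src_inv a.2).symm
    have h1 : ContMDiff (𝓘(ℝ, EG).prod 𝓘(ℝ, EN)) 𝓘(ℝ, EG) ∞ fun a : G × Cech1 U =>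
        a.1⁻¹ * (c.g (cechTriple a.2 ((cechGroupoid (EN := EN) U).inv a.2)))⁻¹ :=
      contMDiff_fst.inv.mul (c.g.contMDiff.comp ht).inv
    exact (X.smooth_act.comp ((c.lam.contMDiff.comp contMDiff_snd).inv.prodMk h1)).prodMk hinv
  smooth_mul := by
    have h1 : ContMDiff ((𝓘(ℝ, EG).prod 𝓘(ℝ, EN)).prod (𝓘(ℝ, EG).prod 𝓘(ℝ, EN)))
        (𝓘(ℝ, EN).prod 𝓘(ℝ, EN)) ∞
        fun p : (G × Cech1 U) × (G × Cech1 U) => (p.1.2, p.2.2) :=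
      (contMDiff_snd.comp contMDiff_fst).prodMk (contMDiff_snd.comp contMDiff_snd)
    have h2 : ContMDiff ((𝓘(ℝ, EG).prod 𝓘(ℝ, EN)).prod (𝓘(ℝ, EG).prod 𝓘(ℝ, EN))) 𝓘(ℝ, EG) ∞
        fun p : (G × Cech1 U) × (G × Cech1 U) => p.1.1 * X.act (c.lam p.1.2) p.2.1 :=
      (contMDiff_fst.comp contMDiff_fst).mul (X.smooth_act.comp
        ((c.lam.contMDiff.comp (contMDiff_snd.comp contMDiff_fst)).prodMk
          (contMDiff_fst.comp contMDiff_snd)))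
    refine ContMDiffOn.prodMk (h2.contMDiffOn.mul ?_) ?_
    · exact c.g.contMDiff.comp_contMDiffOn
        ((contMDiffOn_cechTriple U).comp h1.contMDiffOn fun p hp => hp)
    · exact (cechGroupoid (EN := EN) U).smooth_mul.comp h1.contMDiffOn fun p hp => hp

/-- The extension `G × ∐ U_ij → ∐ U_ij` of a cocycle. -/
def modelExtension (c : NonabelianCocycle (EN := EN) U X) :
    LieGroupoidGExtension 𝓘(ℝ, EG) G (cechGroupoid (EN := EN) U)
      (𝓘(ℝ, EG).prod 𝓘(ℝ, EN)) (G × Cech1 U) where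
  gpd := c.modelGroupoid
  φ := Prod.snd
  φ_hom :=
    { smooth := contMDiff_snd
      map_src := fun _ => rfl
      map_tgt := fun _ => rfl
      map_unit := fun _ => rfl
      map_mul := fun _ _ _ => rfl }
  φ_surjective a := ⟨(1, a), rfl⟩
  φ_submersion := Coprod.incl_comp_snd_isSubmersion id fun _ => le_rfl
  kernel_locTriv _ := by
    refine ⟨univ, isOpen_univ, mem_univ _,
      fun q => (q.2, (cechGroupoid (EN := EN) U).unit q.1), Prod.fst,
      (contMDiff_snd.prodMk ((cechGroupoid (EN := EN) U).smooth_unit.comp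
        contMDiff_fst)).contMDiffOn, contMDiff_fst.contMDiffOn, fun _ _ _ => ⟨rfl, rfl⟩, ?_, ?_⟩
    · rintro m _ ⟨g, a⟩ rfl
      rfl
    · rintro ⟨i, x, hi⟩ _ g g'
      change (g * g', cech1 i i x hi hi) =
        c.modelMul (g, cech1 i i x hi hi) (g', cech1 i i x hi hi)
      rw [modelMul_mk, lam_ii, g_iij, map_one, MulAut.one_apply, mul_one]

/-- The principal bundle `∐ U_i × H` over the groupoid of a cocycle, with the action
`(g, x_ij) ⋆ (x_j, h) = (x_i, ρ(g) λ_ij h)`. -/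
def modelBundle (c : NonabelianCocycle (EN := EN) U X) :
    GroupoidPrincipalBundle 𝓘(ℝ, EH) H c.modelGroupoid
      (𝓘(ℝ, EN).prod 𝓘(ℝ, EH)) (Cech0 U × H) where
  proj := Prod.fst
  ract p h := (p.1, p.2 * h)
  smooth_proj := contMDiff_fst
  smooth_ract := (contMDiff_fst.comp contMDiff_fst).prodMk
    ((contMDiff_snd.comp contMDiff_fst).mul contMDiff_snd)
  ract_one p := by simp
  ract_mul p h h' := by simp [mul_assoc]
  proj_ract _ _ := rfl
  locTriv m := by
    refine ⟨{ toOpenPartialHomeomorph := OpenPartialHomeomorph.refl _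
              baseSet := univ
              open_baseSet := isOpen_univ
              source_eq := rfl
              target_eq := by simp
              proj_toFun := fun _ _ => rfl }, mem_univ _, contMDiff_id.contMDiffOn,
      contMDiff_id.contMDiffOn, fun _ _ _ => rfl⟩
  act r p := ((cechGroupoid (EN := EN) U).src r.2, X.ρ r.1 * c.lam r.2 * p.2)
  smooth_act := ContMDiff.contMDiffOn <|
    ((cechGroupoid (EN := EN) U).src_submersion.contMDiff.comp
      (contMDiff_snd.comp contMDiff_fst)).prodMk
    (((X.smooth_ρ.comp (contMDiff_fst.comp contMDiff_fst)).mul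
      (c.lam.contMDiff.comp (contMDiff_snd.comp contMDiff_fst))).mul
      (contMDiff_snd.comp contMDiff_snd))
  proj_act _ _ _ := rfl
  unit_act := by
    rintro ⟨⟨i, x, hi⟩, h⟩
    refine Prod.ext rfl ?_
    change X.ρ 1 * c.lam (cech1 i i x hi hi) * h = h
    rw [lam_ii, map_one, one_mul, one_mul]
  mul_act := by
    rintro ⟨g, a⟩ ⟨g', b⟩ ⟨m, h⟩ hab -
    obtain ⟨i, j, k, x, hi, hj, hk, rfl, rfl⟩ := Cech1.composable hab
    refine Prod.ext ((cechGroupoid (EN := EN) U).src_mul _ _ hab) ?_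
    change X.ρ (c.modelMul _ _).1 * c.lam (c.modelMul _ _).2 * h = _
    rw [modelMul_mk]
    simp only [map_mul, X.ρ_act, mul_assoc]
    rw [← mul_assoc (X.ρ (c.g _)), c.ρ_g]
    group
  act_ract _ _ _ _ := by simp [mul_assoc]

/-- The isomorphisms `χ(x_i, h)(g) = (h(g), x_ii)`. -/
def modelBand (c : NonabelianCocycle (EN := EN) U X) (p : Cech0 U × H) :
    c.modelExtension.BandFibre p.1 where
  toFun g := (X.act p.2 g, (cechGroupoid (EN := EN) U).unit p.1)
  mem_kernel _ := rfl
  map_mul g g' := by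
    obtain ⟨⟨i, x, hi⟩, h⟩ := p
    change (X.act h (g * g'), cech1 i i x hi hi) =
      c.modelMul (X.act h g, cech1 i i x hi hi) (X.act h g', cech1 i i x hi hi)
    rw [modelMul_mk, lam_ii, g_iij, map_one, MulAut.one_apply, mul_one, map_mul]
  smooth := (X.smooth_act.comp (contMDiff_const.prodMk contMDiff_id)).prodMk contMDiff_const
  exists_inverse := by
    refine ⟨fun r => X.act p.2⁻¹ r.1,
      (X.smooth_act.comp (contMDiff_const.prodMk contMDiff_fst)).contMDiffOn,
      fun g => act_inv_act X _ _, ?_⟩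
    rintro ⟨g, a⟩ rfl
    exact Prod.ext (act_act_inv X _ _) rfl

/-- The `G → H`-extension of a cocycle. -/
def modelOn (c : NonabelianCocycle (EN := EN) U X) :
    GHExtensionOn X (cechGroupoid (EN := EN) U)
      (𝓘(ℝ, EG).prod 𝓘(ℝ, EN)) (G × Cech1 U) (𝓘(ℝ, EN).prod 𝓘(ℝ, EH)) (Cech0 U × H) where
  toLieGroupoidGExtension := c.modelExtension
  bundle := c.modelBundle
  χ := c.modelBand
  smooth_χ := (X.smooth_act.comp ((contMDiff_snd.comp contMDiff_fst).prodMk contMDiff_snd)).prodMk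
    ((cechGroupoid (EN := EN) U).smooth_unit.comp (contMDiff_fst.comp contMDiff_fst))
  χ_ract p h g := by
    refine Prod.ext ?_ rfl
    change X.act (p.2 * h) g = X.act p.2 (X.act h g)
    rw [map_mul, MulAut.mul_apply]
  χ_act := by
    rintro ⟨g, a⟩ ⟨⟨j', y, hj'⟩, h⟩ k ha
    obtain ⟨i, j, x, hi, hj, rfl⟩ := exists_eq_cech1 a
    obtain rfl : j = j' := congrArg Sigma.fst ha
    obtain rfl : x = y := congrArg Coprod.val ha
    change (X.act (X.ρ g * c.lam (cech1 i j x hi hj) * h) k, cech1 i i x hi hi) =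
      c.modelMul (c.modelMul (g, cech1 i j x hi hj) (X.act h k, cech1 j j x hj hj))
        (c.modelInv (g, cech1 i j x hi hj))
    rw [modelInv_mk, modelMul_mk, modelMul_mk]
    refine Prod.ext ?_ rfl
    simp only [g_ijj, act_act_inv, map_mul, MulAut.mul_apply, X.act_ρ]
    group
  ract_ρ := by
    rintro ⟨⟨i, x, hi⟩, h⟩ g
    refine Prod.ext rfl ?_
    change h * X.ρ g = X.ρ (X.act h g) * c.lam (cech1 i i x hi hi) * h
    rw [lam_ii, X.ρ_act]
    group

/-- The adapted extension of a cocycle. -/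
def model (c : NonabelianCocycle (EN := EN) U X) : AdaptedExtension (EN := EN) U X :=
  ⟨c.modelOn,
    { φ_eq := fun _ => rfl
      proj_eq := fun _ => rfl
      ract_eq := fun _ _ _ => rfl
      χ_eq := fun _ _ _ _ _ => rfl
      mul_eq := fun i j x hi hj g g' => by
        refine (c.modelMul_mk i i j x hi hi hj g g').trans ?_
        rw [lam_ii, g_iij, map_one, MulAut.one_apply, mul_one] }⟩

end NonabelianCocycle

end

noncomputable section

/-! ### Lie groupoids and bands -/

section Groupoids

variable {EΓ HΓ EM HM : Type*} [NormedAddCommGroup EΓ] [NormedSpace ℝ EΓ] [TopologicalSpace HΓ]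
  [NormedAddCommGroup EM] [NormedSpace ℝ EM] [TopologicalSpace HM]
  {IΓ : ModelWithCorners ℝ EΓ HΓ} {Γ : Type*} [TopologicalSpace Γ] [ChartedSpace HΓ Γ]
  {IM : ModelWithCorners ℝ EM HM} {M : Type*} [TopologicalSpace M] [ChartedSpace HM M]

theorem LieGroupoid.inv_mul_cancel_left (𝒢 : LieGroupoid IΓ Γ IM M) {a b : Γ}
    (h : 𝒢.tgt a = 𝒢.src b) : 𝒢.mul (𝒢.inv a) (𝒢.mul a b) = b := by
  rw [← 𝒢.mul_assoc _ _ _ (𝒢.tgt_inv a) h, 𝒢.inv_mul, h, 𝒢.unit_mul]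

theorem LieGroupoid.inv_mul_cancel_right (𝒢 : LieGroupoid IΓ Γ IM M) {a b : Γ}
    (h : 𝒢.tgt a = 𝒢.tgt b) : 𝒢.mul (𝒢.mul a (𝒢.inv b)) b = a := by
  rw [𝒢.mul_assoc _ _ _ (h.trans (𝒢.src_inv b).symm) (𝒢.tgt_inv b), 𝒢.inv_mul, ← h, 𝒢.mul_unit]

theorem LieGroupoid.mul_inv_cancel_right (𝒢 : LieGroupoid IΓ Γ IM M) {a b : Γ}
    (h : 𝒢.tgt a = 𝒢.src b) : 𝒢.mul (𝒢.mul a b) (𝒢.inv b) = a := by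
  rw [𝒢.mul_assoc _ _ _ h (𝒢.src_inv b).symm, 𝒢.mul_inv, ← h, 𝒢.mul_unit]

theorem LieGroupoid.eq_unit_of_mul_self (𝒢 : LieGroupoid IΓ Γ IM M) {a : Γ}
    (h : 𝒢.tgt a = 𝒢.src a) (ha : 𝒢.mul a a = a) : a = 𝒢.unit (𝒢.src a) := by
  have h1 := 𝒢.inv_mul_cancel_left h
  rw [ha, 𝒢.inv_mul, h] at h1
  exact h1.symm

variable {EG HG ER HR : Type*} [NormedAddCommGroup EG] [NormedSpace ℝ EG] [TopologicalSpace HG]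
  [NormedAddCommGroup ER] [NormedSpace ℝ ER] [TopologicalSpace HR]
  {IG : ModelWithCorners ℝ EG HG} {G : Type*} [Group G] [TopologicalSpace G] [ChartedSpace HG G]
  {𝒢 : LieGroupoid IΓ Γ IM M}
  {IR : ModelWithCorners ℝ ER HR} {R : Type*} [TopologicalSpace R] [ChartedSpace HR R]
  {A : LieGroupoidGExtension IG G 𝒢 IR R}

theorem LieGroupoidGExtension.src_of_mem_kernel {m : M} {r : R} (h : A.φ r = 𝒢.unit m) :
    A.gpd.src r = m := by
  rw [← A.φ_hom.map_src, h, 𝒢.src_unit]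

theorem LieGroupoidGExtension.tgt_of_mem_kernel {m : M} {r : R} (h : A.φ r = 𝒢.unit m) :
    A.gpd.tgt r = m := by
  rw [← A.φ_hom.map_tgt, h, 𝒢.tgt_unit]

theorem LieGroupoidGExtension.BandFibre.src_toFun {m : M} (b : A.BandFibre m) (g : G) :
    A.gpd.src (b.toFun g) = m :=
  A.src_of_mem_kernel (b.mem_kernel g)

theorem LieGroupoidGExtension.BandFibre.tgt_toFun {m : M} (b : A.BandFibre m) (g : G) :
    A.gpd.tgt (b.toFun g) = m :=
  A.tgt_of_mem_kernel (b.mem_kernel g)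

theorem LieGroupoidGExtension.BandFibre.map_one {m : M} (b : A.BandFibre m) :
    b.toFun 1 = A.gpd.unit m := by
  have h := A.gpd.eq_unit_of_mul_self (a := b.toFun 1)
    ((b.tgt_toFun 1).trans (b.src_toFun 1).symm) (by rw [← b.map_mul, one_mul])
  rwa [b.src_toFun] at h

end Groupoids

/-! ### Adapted coordinates on extensions -/

section Frames

variable {EN : Type*} [NormedAddCommGroup EN] [NormedSpace ℝ EN]
  {N : Type u} [TopologicalSpace N] [ChartedSpace EN N]
  {I : Type u} {U : I → Opens N} [IsManifold 𝓘(ℝ, EN) ∞ N]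
  {EG EH : Type*} [NormedAddCommGroup EG] [NormedSpace ℝ EG]
  [NormedAddCommGroup EH] [NormedSpace ℝ EH]
  {G H : Type u} [Group G] [TopologicalSpace G] [ChartedSpace EG G] [LieGroup 𝓘(ℝ, EG) ∞ G]
  [Group H] [TopologicalSpace H] [ChartedSpace EH H] [LieGroup 𝓘(ℝ, EH) ∞ H]
  {X : LieCrossedModule 𝓘(ℝ, EG) G 𝓘(ℝ, EH) H}
  {ER HR EP HP : Type*} [NormedAddCommGroup ER] [NormedSpace ℝ ER] [TopologicalSpace HR]
  [NormedAddCommGroup EP] [NormedSpace ℝ EP] [TopologicalSpace HP]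
  {IR : ModelWithCorners ℝ ER HR} {R : Type*} [TopologicalSpace R] [ChartedSpace HR R]
  {IP : ModelWithCorners ℝ EP HP} {P : Type*} [TopologicalSpace P] [ChartedSpace HP P]

/-- Coordinates in which an extension of the Čech groupoid is adapted. -/
structure GHExtensionOn.Frame (A : GHExtensionOn X (cechGroupoid (EN := EN) U) IR R IP P) where
  Φ : (G × Cech1 U) ≃ₘ^∞⟮𝓘(ℝ, EG).prod 𝓘(ℝ, EN), IR⟯ R
  Ψ : (Cech0 U × H) ≃ₘ^∞⟮𝓘(ℝ, EN).prod 𝓘(ℝ, EH), IP⟯ P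
  φ_Φ : ∀ r, A.φ (Φ r) = r.2
  proj_Ψ : ∀ p, A.bundle.proj (Ψ p) = p.1
  Ψ_mul : ∀ x h h', Ψ (x, h * h') = A.bundle.ract (Ψ (x, h)) h'
  χ_Ψ : ∀ i x (hi : x ∈ U i) h g,
    (A.χ (Ψ (cech0 i x hi, h))).toFun g = Φ (X.act h g, cech1 i i x hi hi)
  Φ_mul : ∀ i j x (hi : x ∈ U i) (hj : x ∈ U j) g g',
    Φ (g * g', cech1 i j x hi hj) =
      A.gpd.mul (Φ (g, cech1 i i x hi hi)) (Φ (g', cech1 i j x hi hj))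

/-- The tautological coordinates on an adapted extension. -/
def AdaptedExtension.frame (A : AdaptedExtension (EN := EN) U X) : A.1.Frame where
  Φ := Diffeomorph.refl _ _ _
  Ψ := Diffeomorph.refl _ _ _
  φ_Φ := A.2.φ_eq
  proj_Ψ := A.2.proj_eq
  Ψ_mul x h h' := (A.2.ract_eq x h h').symm
  χ_Ψ := A.2.χ_eq
  Φ_mul i j x hi hj g g' := (A.2.mul_eq i j x hi hj g g').symm

namespace GHExtensionOn.Frame

variable {A : GHExtensionOn X (cechGroupoid (EN := EN) U) IR R IP P} (f : A.Frame)

theorem src_Φ (r : G × Cech1 U) : A.gpd.src (f.Φ r) = (cechGroupoid (EN := EN) U).src r.2 := by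
  rw [← A.φ_hom.map_src, f.φ_Φ]

theorem tgt_Φ (r : G × Cech1 U) : A.gpd.tgt (f.Φ r) = (cechGroupoid (EN := EN) U).tgt r.2 := by
  rw [← A.φ_hom.map_tgt, f.φ_Φ]

theorem tgt_Φ_eq_src_Φ {r s : G × Cech1 U}
    (h : (cechGroupoid (EN := EN) U).tgt r.2 = (cechGroupoid (EN := EN) U).src s.2) :
    A.gpd.tgt (f.Φ r) = A.gpd.src (f.Φ s) := by
  rw [f.tgt_Φ, f.src_Φ, h]

theorem tgt_Φ_eq_proj_Ψ {r : G × Cech1 U} {p : Cech0 U × H}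
    (h : (cechGroupoid (EN := EN) U).tgt r.2 = p.1) :
    A.gpd.tgt (f.Φ r) = A.bundle.proj (f.Ψ p) := by
  rw [f.tgt_Φ, f.proj_Ψ, h]

/-- The coordinate `λ`. -/
def lamFun (a : Cech1 U) : H :=
  (f.Ψ.symm (A.bundle.act (f.Φ (1, a)) (f.Ψ ((cechGroupoid (EN := EN) U).tgt a, 1)))).2

theorem contMDiff_lamFun : ContMDiff 𝓘(ℝ, EN) 𝓘(ℝ, EH) ∞ f.lamFun := by
  refine contMDiff_snd.comp (f.Ψ.symm.contMDiff.comp ?_)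
  rw [← contMDiffOn_univ]
  refine A.bundle.smooth_act.comp (ContMDiff.contMDiffOn
    ((f.Φ.contMDiff.comp (contMDiff_const.prodMk contMDiff_id)).prodMk
      (f.Ψ.contMDiff.comp ((cechGroupoid (EN := EN) U).tgt_submersion.contMDiff.prodMk
        contMDiff_const)))) ?_
  intro a _
  exact f.tgt_Φ_eq_proj_Ψ rfl

theorem act_Φ_one (i j : I) (x : N) (hi : x ∈ U i) (hj : x ∈ U j) :
    A.bundle.act (f.Φ (1, cech1 i j x hi hj)) (f.Ψ (cech0 j x hj, 1)) =
      f.Ψ (cech0 i x hi, f.lamFun (cech1 i j x hi hj)) := by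
  set z := A.bundle.act (f.Φ (1, cech1 i j x hi hj)) (f.Ψ (cech0 j x hj, 1)) with hz
  have h1 : (f.Ψ.symm z).1 = cech0 i x hi := by
    rw [← f.proj_Ψ, Diffeomorph.apply_symm_apply, hz, A.bundle.proj_act, f.src_Φ]
    · rfl
    · exact f.tgt_Φ_eq_proj_Ψ rfl
  have h2 : f.Ψ.symm z = (cech0 i x hi, f.lamFun (cech1 i j x hi hj)) := Prod.ext h1 rfl
  rw [← h2, Diffeomorph.apply_symm_apply]

theorem ract_Ψ (x : Cech0 U) (h : H) : A.bundle.ract (f.Ψ (x, 1)) h = f.Ψ (x, h) := by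
  rw [← f.Ψ_mul, one_mul]

theorem χ_Ψ_one (i : I) (x : N) (hi : x ∈ U i) (g : G) :
    (A.χ (f.Ψ (cech0 i x hi, 1))).toFun g = f.Φ (g, cech1 i i x hi hi) := by
  rw [f.χ_Ψ, map_one, MulAut.one_apply]

theorem Φ_unit (i : I) (x : N) (hi : x ∈ U i) :
    f.Φ (1, cech1 i i x hi hi) = A.gpd.unit (cech0 i x hi) := by
  rw [← f.χ_Ψ_one, (A.χ _).map_one, f.proj_Ψ]

theorem Φ_eq (i j : I) (x : N) (hi : x ∈ U i) (hj : x ∈ U j) (g : G) :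
    f.Φ (g, cech1 i j x hi hj) =
      A.gpd.mul (f.Φ (g, cech1 i i x hi hi)) (f.Φ (1, cech1 i j x hi hj)) := by
  rw [← f.Φ_mul, mul_one]

theorem act_ii (i : I) (x : N) (hi : x ∈ U i) (g : G) (h : H) :
    A.bundle.act (f.Φ (g, cech1 i i x hi hi)) (f.Ψ (cech0 i x hi, h)) =
      f.Ψ (cech0 i x hi, X.ρ g * h) := by
  have h1 : A.bundle.act (f.Φ (g, cech1 i i x hi hi)) (f.Ψ (cech0 i x hi, 1)) =
      f.Ψ (cech0 i x hi, X.ρ g) := by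
    rw [← f.χ_Ψ_one, ← A.ract_ρ, f.ract_Ψ]
  rw [f.Ψ_mul, ← h1, A.bundle.act_ract, f.ract_Ψ]
  exact f.tgt_Φ_eq_proj_Ψ rfl

theorem act_Φ (i j : I) (x : N) (hi : x ∈ U i) (hj : x ∈ U j) (g : G) (h : H) :
    A.bundle.act (f.Φ (g, cech1 i j x hi hj)) (f.Ψ (cech0 j x hj, h)) =
      f.Ψ (cech0 i x hi, X.ρ g * f.lamFun (cech1 i j x hi hj) * h) := by
  have ht : ∀ h : H, A.gpd.tgt (f.Φ (1, cech1 i j x hi hj)) =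
      A.bundle.proj (f.Ψ (cech0 j x hj, h)) := fun h => f.tgt_Φ_eq_proj_Ψ rfl
  have h1 : A.bundle.act (f.Φ (1, cech1 i j x hi hj)) (f.Ψ (cech0 j x hj, h)) =
      f.Ψ (cech0 i x hi, f.lamFun (cech1 i j x hi hj) * h) := by
    rw [f.Ψ_mul, ← f.act_Φ_one, A.bundle.act_ract _ _ _ (ht _), f.ract_Ψ]
  rw [f.Φ_eq, A.bundle.mul_act _ _ _ (f.tgt_Φ_eq_src_Φ rfl) (ht _), h1,
    f.act_ii, mul_assoc]

/-- The maps `x_ijk ↦ x_ij`. -/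
def face01 (b : Cech2 U) : Cech1 U :=
  Coprod.incl (fun t : I × I × I => (t.1, t.2.1)) (fun _ => inf_le_left) b

/-- The maps `x_ijk ↦ x_jk`. -/
def face12 (b : Cech2 U) : Cech1 U :=
  Coprod.incl (fun t : I × I × I => (t.2.1, t.2.2)) (fun _ => inf_le_inf_right _ inf_le_right) b

/-- The coordinate `𝐠`. -/
def gFun (b : Cech2 U) : G :=
  (f.Φ.symm (A.gpd.mul (f.Φ (1, face01 b)) (f.Φ (1, face12 b)))).1

theorem contMDiff_gFun : ContMDiff 𝓘(ℝ, EN) 𝓘(ℝ, EG) ∞ f.gFun := by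
  refine contMDiff_fst.comp (f.Φ.symm.contMDiff.comp ?_)
  rw [← contMDiffOn_univ]
  refine A.gpd.smooth_mul.comp (ContMDiff.contMDiffOn
    ((f.Φ.contMDiff.comp (contMDiff_const.prodMk (Coprod.incl_isSubmersion _ _).contMDiff)).prodMk
      (f.Φ.contMDiff.comp
        (contMDiff_const.prodMk (Coprod.incl_isSubmersion _ _).contMDiff)))) ?_
  intro b _
  exact f.tgt_Φ_eq_src_Φ rfl

theorem mul_Φ_one (i j k : I) (x : N) (hi : x ∈ U i) (hj : x ∈ U j) (hk : x ∈ U k) :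
    A.gpd.mul (f.Φ (1, cech1 i j x hi hj)) (f.Φ (1, cech1 j k x hj hk)) =
      f.Φ (f.gFun (cech2 i j k x hi hj hk), cech1 i k x hi hk) := by
  set z := A.gpd.mul (f.Φ (1, cech1 i j x hi hj)) (f.Φ (1, cech1 j k x hj hk)) with hz
  have h1 : (f.Φ.symm z).2 = cech1 i k x hi hk := by
    rw [← f.φ_Φ, Diffeomorph.apply_symm_apply, hz, A.φ_hom.map_mul, f.φ_Φ, f.φ_Φ]
    · exact cechMul_mk i j j k x hi hj hj hk
    · exact f.tgt_Φ_eq_src_Φ rfl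
  have h2 : f.Φ.symm z = (f.gFun (cech2 i j k x hi hj hk), cech1 i k x hi hk) := Prod.ext rfl h1
  rw [← h2, Diffeomorph.apply_symm_apply]

theorem mul_ii (i j : I) (x : N) (hi : x ∈ U i) (hj : x ∈ U j) (g' : G) :
    A.gpd.mul (f.Φ (1, cech1 i j x hi hj)) (f.Φ (g', cech1 j j x hj hj)) =
      f.Φ (X.act (f.lamFun (cech1 i j x hi hj)) g', cech1 i j x hi hj) := by
  have h1 : A.gpd.tgt (f.Φ (1, cech1 i j x hi hj)) =
      A.bundle.proj (f.Ψ (cech0 j x hj, 1)) := f.tgt_Φ_eq_proj_Ψ rfl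
  have h2 := A.χ_act _ _ g' h1
  rw [f.χ_Ψ_one, f.act_Φ_one, f.χ_Ψ] at h2
  rw [f.Φ_eq i j x hi hj (X.act _ _), h2, A.gpd.inv_mul_cancel_right]
  rw [A.gpd.tgt_mul, f.tgt_Φ, f.tgt_Φ]
  · rfl
  · exact f.tgt_Φ_eq_src_Φ rfl

theorem mul_Φ (i j k : I) (x : N) (hi : x ∈ U i) (hj : x ∈ U j) (hk : x ∈ U k) (g g' : G) :
    A.gpd.mul (f.Φ (g, cech1 i j x hi hj)) (f.Φ (g', cech1 j k x hj hk)) =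
      f.Φ (g * X.act (f.lamFun (cech1 i j x hi hj)) g' * f.gFun (cech2 i j k x hi hj hk),
        cech1 i k x hi hk) := by
  have hc : ∀ (i j k : I) (hi : x ∈ U i) (hj : x ∈ U j) (hk : x ∈ U k) (g g' : G),
      A.gpd.tgt (f.Φ (g, cech1 i j x hi hj)) = A.gpd.src (f.Φ (g', cech1 j k x hj hk)) :=
    fun i j k hi hj hk g g' => f.tgt_Φ_eq_src_Φ rfl
  have h1 : A.gpd.mul (f.Φ (1, cech1 i j x hi hj)) (f.Φ (g', cech1 j k x hj hk)) =
      f.Φ (X.act (f.lamFun (cech1 i j x hi hj)) g' * f.gFun (cech2 i j k x hi hj hk),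
        cech1 i k x hi hk) := by
    rw [f.Φ_eq j k, ← A.gpd.mul_assoc _ _ _ (hc i j j hi hj hj _ _) (hc j j k hj hj hk _ _),
      f.mul_ii, f.Φ_eq i j, A.gpd.mul_assoc _ _ _ (hc i i j hi hi hj _ _) (hc i j k hi hj hk _ _),
      f.mul_Φ_one, ← f.Φ_mul]
  rw [f.Φ_eq i j, A.gpd.mul_assoc _ _ _ (hc i i j hi hi hj _ _) (hc i j k hi hj hk _ _), h1,
    ← f.Φ_mul, mul_assoc]

/-- The cocycle of an extension in adapted coordinates. -/
def cocycle : NonabelianCocycle (EN := EN) U X where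
  lam := ⟨f.lamFun, f.contMDiff_lamFun⟩
  g := ⟨f.gFun, f.contMDiff_gFun⟩
  ρ_g i j k x hi hj hk := by
    have h1 := A.bundle.mul_act (f.Φ (1, cech1 i j x hi hj)) (f.Φ (1, cech1 j k x hj hk))
      (f.Ψ (cech0 k x hk, 1)) (f.tgt_Φ_eq_src_Φ rfl)
      (f.tgt_Φ_eq_proj_Ψ rfl)
    rw [f.mul_Φ_one, f.act_Φ, f.act_Φ, f.act_Φ] at h1
    simpa using congrArg Prod.snd (f.Ψ.injective h1)
  g_mul_g i j k l x hi hj hk hl := by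
    have h1 := A.gpd.mul_assoc (f.Φ (1, cech1 i j x hi hj)) (f.Φ (1, cech1 j k x hj hk))
      (f.Φ (1, cech1 k l x hk hl)) (f.tgt_Φ_eq_src_Φ rfl)
      (f.tgt_Φ_eq_src_Φ rfl)
    rw [f.mul_Φ_one, f.mul_Φ_one, f.mul_Φ, f.mul_Φ] at h1
    simpa using congrArg Prod.fst (f.Φ.injective h1)
  g_iij i j x hi hj := by
    have h1 := A.gpd.unit_mul (f.Φ (1, cech1 i j x hi hj))
    rw [f.src_Φ, show (cechGroupoid (EN := EN) U).src ((1 : G), cech1 i j x hi hj).2 =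
      cech0 i x hi from rfl, ← f.Φ_unit, f.mul_Φ_one] at h1
    exact congrArg Prod.fst (f.Φ.injective h1)

/-- An extension with adapted coordinates is isomorphic to the extension of its cocycle. -/
theorem isomorphic_model : f.cocycle.modelOn.Isomorphic A := by
  refine ⟨⟨f.Φ, f.Ψ, f.φ_Φ, ?_, f.proj_Ψ, fun p h => f.Ψ_mul _ _ _, ?_, ?_⟩⟩
  · rintro ⟨g, a⟩ ⟨g', b⟩ hab
    obtain ⟨i, j, k, x, hi, hj, hk, rfl, rfl⟩ := Cech1.composable hab
    rw [f.mul_Φ]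
    exact congrArg f.Φ (f.cocycle.modelMul_mk i j k x hi hj hk g g')
  · rintro ⟨g, a⟩ ⟨⟨j', y, hj'⟩, h⟩ hab
    obtain ⟨i, j, x, hi, hj, rfl⟩ := NonabelianCocycle.exists_eq_cech1 a
    obtain rfl : j = j' := congrArg Sigma.fst hab
    obtain rfl : x = y := congrArg Coprod.val hab
    exact (f.act_Φ i j x hi hj g h).symm
  · rintro ⟨⟨i, x, hi⟩, h⟩ g
    exact (f.χ_Ψ i x hi h g).symm

end GHExtensionOn.Frame

theorem AdaptedExtension.hasCocycle (A : AdaptedExtension (EN := EN) U X) :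
    A.HasCocycle A.frame.cocycle where
  act_eq := A.frame.act_Φ_one
  mul_eq := A.frame.mul_Φ_one

/-! ### Isomorphisms of the extensions of cocycles -/

namespace NonabelianCocycle

theorem Relates.modelOn_isomorphic {c c' : NonabelianCocycle (EN := EN) U X}
    {r : C^∞⟮𝓘(ℝ, EN), Cech0 U; 𝓘(ℝ, EH), H⟯} {v : C^∞⟮𝓘(ℝ, EN), Cech1 U; 𝓘(ℝ, EG), G⟯}
    (h : c.Relates c' r v) : c.modelOn.Isomorphic c'.modelOn := by
  have hr : ContMDiff (𝓘(ℝ, EG).prod 𝓘(ℝ, EN)) 𝓘(ℝ, EH) ∞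
      fun q : G × Cech1 U => r ((cechGroupoid (EN := EN) U).src q.2) :=
    r.contMDiff.comp ((cechGroupoid (EN := EN) U).src_submersion.contMDiff.comp contMDiff_snd)
  have hv : ContMDiff (𝓘(ℝ, EG).prod 𝓘(ℝ, EN)) 𝓘(ℝ, EG) ∞ fun q : G × Cech1 U => v q.2 :=
    v.contMDiff.comp contMDiff_snd
  have hr0 : ContMDiff (𝓘(ℝ, EN).prod 𝓘(ℝ, EH)) 𝓘(ℝ, EH) ∞ fun p : Cech0 U × H => r p.1 :=
    r.contMDiff.comp contMDiff_fst
  let Φ : (G × Cech1 U) ≃ₘ^∞⟮𝓘(ℝ, EG).prod 𝓘(ℝ, EN), 𝓘(ℝ, EG).prod 𝓘(ℝ, EN)⟯ (G × Cech1 U) :=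
    { toFun := fun q => (X.act (r ((cechGroupoid (EN := EN) U).src q.2)) q.1 * (v q.2)⁻¹, q.2)
      invFun := fun q =>
        (X.act (r ((cechGroupoid (EN := EN) U).src q.2))⁻¹ (q.1 * v q.2), q.2)
      left_inv := fun q => by simp
      right_inv := fun q => by simp
      contMDiff_toFun :=
        ((X.smooth_act.comp (hr.prodMk contMDiff_fst)).mul hv.inv).prodMk contMDiff_snd
      contMDiff_invFun :=
        (X.smooth_act.comp (hr.inv.prodMk (contMDiff_fst.mul hv))).prodMk contMDiff_snd }
  let Ψ : (Cech0 U × H) ≃ₘ^∞⟮𝓘(ℝ, EN).prod 𝓘(ℝ, EH), 𝓘(ℝ, EN).prod 𝓘(ℝ, EH)⟯ (Cech0 U × H) :=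
    { toFun := fun p => (p.1, r p.1 * p.2)
      invFun := fun p => (p.1, (r p.1)⁻¹ * p.2)
      left_inv := fun p => by simp
      right_inv := fun p => by simp
      contMDiff_toFun := contMDiff_fst.prodMk (hr0.mul contMDiff_snd)
      contMDiff_invFun := contMDiff_fst.prodMk (hr0.inv.mul contMDiff_snd) }
  have hvii : ∀ i x (hi : x ∈ U i), v (cech1 i i x hi hi) = 1 := by
    intro i x hi
    have := h.g_eq i i i x hi hi hi
    simpa [g_iij, lam_ii] using this
  refine ⟨⟨Φ, Ψ, fun _ => rfl, ?_, fun _ => rfl, fun p h => ?_, ?_, ?_⟩⟩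
  · rintro ⟨g, a⟩ ⟨g', b⟩ hab
    obtain ⟨i, j, k, x, hi, hj, hk, rfl, rfl⟩ := Cech1.composable hab
    change Φ (c.modelMul _ _) = c'.modelMul (Φ _) (Φ _)
    rw [modelMul_mk]
    change _ = c'.modelMul (X.act (r (cech0 i x hi)) g * (v (cech1 i j x hi hj))⁻¹,
      cech1 i j x hi hj) (X.act (r (cech0 j x hj)) g' * (v (cech1 j k x hj hk))⁻¹,
      cech1 j k x hj hk)
    rw [modelMul_mk]
    refine Prod.ext ?_ rfl
    change X.act (r (cech0 i x hi)) (_ * _ * _) * (v (cech1 i k x hi hk))⁻¹ = _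
    have e1 : X.act (c'.lam (cech1 i j x hi hj)) (X.act (r (cech0 j x hj)) g') =
        v (cech1 i j x hi hj) * X.act (r (cech0 i x hi)) (X.act (c.lam (cech1 i j x hi hj)) g') *
          (v (cech1 i j x hi hj))⁻¹ := by
      rw [← X.act_ρ, ← MulAut.mul_apply, ← MulAut.mul_apply, ← MulAut.mul_apply, ← map_mul,
        ← map_mul, ← map_mul, h.lam_eq]
      congr 2
      group
    have e2 := h.g_eq i j k x hi hj hk
    have e3 : X.act (r (cech0 i x hi)) (c.g (cech2 i j k x hi hj hk)) =
        (v (cech1 i j x hi hj))⁻¹ *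
          (X.act (c'.lam (cech1 i j x hi hj)) (v (cech1 j k x hj hk)))⁻¹ *
          (c'.g (cech2 i j k x hi hj hk) * v (cech1 i k x hi hk)) := by
      rw [e2]
      group
    simp only [map_mul, map_inv, e1, e3]
    group
  · exact congrArg (Prod.mk p.1) (mul_assoc _ _ _).symm
  · rintro ⟨g, a⟩ ⟨⟨j', y, hj'⟩, k⟩ hab
    obtain ⟨i, j, x, hi, hj, rfl⟩ := exists_eq_cech1 a
    obtain rfl : j = j' := congrArg Sigma.fst hab
    obtain rfl : x = y := congrArg Coprod.val hab
    refine Prod.ext rfl ?_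
    change r (cech0 i x hi) * (X.ρ g * c.lam (cech1 i j x hi hj) * k) =
      X.ρ (X.act (r (cech0 i x hi)) g * (v (cech1 i j x hi hj))⁻¹) *
        c'.lam (cech1 i j x hi hj) * (r (cech0 j x hj) * k)
    rw [h.lam_eq, map_mul, X.ρ_act, map_inv]
    group
  · rintro ⟨⟨i, x, hi⟩, k⟩ g
    refine Prod.ext ?_ rfl
    change X.act (r (cech0 i x hi)) (X.act k g) * (v (cech1 i i x hi hi))⁻¹ =
      X.act (r (cech0 i x hi) * k) g
    rw [hvii, inv_one, mul_one, map_mul, MulAut.mul_apply]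

theorem cohomologous_of_modelOn_isomorphic {c c' : NonabelianCocycle (EN := EN) U X}
    (h : c.modelOn.Isomorphic c'.modelOn) : c.Cohomologous c' := by
  obtain ⟨f⟩ := h
  have hfΦ : ∀ r, (f.Φ r).2 = r.2 := f.map_φ
  have hfΨ : ∀ p, (f.Ψ p).1 = p.1 := f.map_proj
  let r : C^∞⟮𝓘(ℝ, EN), Cech0 U; 𝓘(ℝ, EH), H⟯ := ⟨fun x => (f.Ψ (x, 1)).2,
    contMDiff_snd.comp (f.Ψ.contMDiff.comp (contMDiff_id.prodMk contMDiff_const))⟩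
  let w : C^∞⟮𝓘(ℝ, EN), Cech1 U; 𝓘(ℝ, EG), G⟯ := ⟨fun a => (f.Φ (1, a)).1,
    contMDiff_fst.comp (f.Φ.contMDiff.comp (contMDiff_const.prodMk contMDiff_id))⟩
  have hΨ1 : ∀ x, f.Ψ (x, 1) = (x, r x) := fun x => Prod.ext (hfΨ _) rfl
  have hΦ1 : ∀ a, f.Φ (1, a) = (w a, a) := fun a => Prod.ext rfl (hfΦ _)
  have hΨ : ∀ x k, f.Ψ (x, k) = (x, r x * k) := by
    intro x k
    have := f.map_ract (x, 1) k
    rw [hΨ1] at this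
    change f.Ψ (x, 1 * k) = (x, r x * k) at this
    rwa [one_mul] at this
  have hΦii : ∀ i x (hi : x ∈ U i) g,
      f.Φ (g, cech1 i i x hi hi) = (X.act (r (cech0 i x hi)) g, cech1 i i x hi hi) := by
    intro i x hi g
    have := f.map_χ (cech0 i x hi, 1) g
    rw [hΨ1] at this
    change f.Φ (X.act 1 g, cech1 i i x hi hi) =
      (X.act (r (cech0 i x hi)) g, cech1 i i x hi hi) at this
    rwa [map_one, MulAut.one_apply] at this
  have hΦ : ∀ i j x (hi : x ∈ U i) (hj : x ∈ U j) g, f.Φ (g, cech1 i j x hi hj) =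
      (X.act (r (cech0 i x hi)) g * w (cech1 i j x hi hj), cech1 i j x hi hj) := by
    intro i j x hi hj g
    have := f.map_mul (g, cech1 i i x hi hi) (1, cech1 i j x hi hj) rfl
    rw [hΦii, hΦ1] at this
    change f.Φ (c.modelMul _ _) = c'.modelMul _ _ at this
    rw [modelMul_mk, modelMul_mk] at this
    simpa [lam_ii, g_iij] using this
  refine ⟨r, w⁻¹, ?_, ?_⟩
  · intro i j x hi hj
    have := f.map_act (1, cech1 i j x hi hj) (cech0 j x hj, 1) rfl
    rw [hΦ1, hΨ1] at this
    change f.Ψ (cech0 i x hi, X.ρ 1 * c.lam (cech1 i j x hi hj) * 1) =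
      (cech0 i x hi, X.ρ (w (cech1 i j x hi hj)) * c'.lam (cech1 i j x hi hj) *
        r (cech0 j x hj)) at this
    rw [hΨ, map_one, one_mul, mul_one] at this
    have e := congrArg Prod.snd this
    simp only at e
    rw [contMDiffMap_inv_apply, map_inv, mul_assoc (X.ρ _)⁻¹, e]
    group
  · intro i j k x hi hj hk
    have := f.map_mul (1, cech1 i j x hi hj) (1, cech1 j k x hj hk) rfl
    rw [hΦ1, hΦ1] at this
    change f.Φ (c.modelMul _ _) = c'.modelMul _ _ at this
    rw [modelMul_mk, modelMul_mk, hΦ] at this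
    have e := congrArg Prod.fst this
    simp only [map_one, one_mul, mul_one] at e
    simp only [contMDiffMap_inv_apply, map_inv]
    have e' := eq_mul_inv_of_mul_eq e
    rw [e']
    group

end NonabelianCocycle

end Frames

end

noncomputable section

/-! ### Smooth maps on disjoint unions -/

section Sigma

variable {ι : Type*} {X : ι → Type*} [∀ i, TopologicalSpace (X i)]
  {EM HM : Type*} [NormedAddCommGroup EM] [NormedSpace ℝ EM] [TopologicalSpace HM] [Nonempty HM]
  {IM : ModelWithCorners ℝ EM HM} [∀ i, ChartedSpace HM (X i)]
  {EY HY Y : Type*} [NormedAddCommGroup EY] [NormedSpace ℝ EY] [TopologicalSpace HY]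
  {IY : ModelWithCorners ℝ EY HY} [TopologicalSpace Y] [ChartedSpace HY Y]

theorem contMDiff_sigma {f : (Σ i, X i) → Y}
    (hf : ∀ i, ContMDiff IM IY ∞ fun x : X i => f ⟨i, x⟩) : ContMDiff IM IY ∞ f := by
  rintro ⟨i, x⟩
  have h := hf i x
  rw [contMDiffAt_iff] at h ⊢
  refine ⟨?_, ?_⟩
  · exact (IsOpenEmbedding.sigmaMk (σ := X)).continuousAt_iff.1 h.1
  · convert h.2 using 1
    · rfl
    · simp only [extChartAt_coe, comp_apply]
      rw [sigma_chartAt, OpenPartialHomeomorph.lift_openEmbedding_apply]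

end Sigma

/-! ### Submersions and principal bundles are locally projections -/

section VerticalCharts

theorem Manifold.IsSubmersionOfComplement.hasVerticalCharts
    {F E E' H' H'' : Type*} [NormedAddCommGroup F] [NormedSpace ℝ F]
    [NormedAddCommGroup E] [NormedSpace ℝ E] [TopologicalSpace H']
    [NormedAddCommGroup E'] [NormedSpace ℝ E'] [TopologicalSpace H'']
    {I : ModelWithCorners ℝ E H'} [I.Boundaryless] {J : ModelWithCorners ℝ E' H''}
    {P M : Type*} [TopologicalSpace P] [ChartedSpace H' P] [IsManifold I ∞ P]
    [TopologicalSpace M] [ChartedSpace H'' M] [IsManifold J ∞ M] {f : P → M}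
    (hf : IsSubmersionOfComplement F I J ∞ f) : HasVerticalCharts F I J f := by
  intro p
  have h := hf p
  set φ := h.domChart.extend I with hφ
  set ψ := h.codChart.extend J with hψ
  have hφs : ∀ q ∈ h.domChart.source, q ∈ φ.source := fun q hq => by
    rwa [hφ, OpenPartialHomeomorph.extend_source]
  have hψs : ∀ m ∈ h.codChart.source, m ∈ ψ.source := fun q hq => by
    rwa [hψ, OpenPartialHomeomorph.extend_source]
  have hsrc := h.source_subset_preimage_source
  have hw : ∀ q ∈ h.domChart.source, (h.equiv (φ q)).1 = ψ (f q) := by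
    intro q hq
    have := h.writtenInCharts (φ.map_source (hφs q hq))
    simp only [comp_apply] at this
    rw [← this, ← hφ, φ.left_inv (hφs q hq)]
  have hψc : ContMDiffOn (J.prod 𝓘(ℝ, F)) 𝓘(ℝ, E) ∞
      (fun y : M × F => h.equiv.symm (ψ y.1, y.2)) (h.codChart.source ×ˢ univ) := by
    have h1 : ContMDiffOn (J.prod 𝓘(ℝ, F)) 𝓘(ℝ, E') ∞ (fun y : M × F => ψ y.1)
        (h.codChart.source ×ˢ univ) :=
      (OpenPartialHomeomorph.contMDiffOn_extend h.codChart_mem_maximalAtlas).comp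
        contMDiff_fst.contMDiffOn fun y hy => hy.1
    exact h.equiv.symm.contDiff.contMDiff.comp_contMDiffOn
      (h1.prodMk_space contMDiff_snd.contMDiffOn)
  have hsymm : ContMDiffOn 𝓘(ℝ, E) I ∞ φ.symm φ.target := by
    have := contMDiffOn_extend_symm h.domChart_mem_maximalAtlas
    rwa [← OpenPartialHomeomorph.extend_target'] at this
  refine ⟨h.domChart.source, fun q => (h.equiv (φ q)).2,
    (h.codChart.source ×ˢ univ) ∩ (fun y : M × F => h.equiv.symm (ψ y.1, y.2)) ⁻¹' φ.target,
    fun y => φ.symm (h.equiv.symm (ψ y.1, y.2)), h.domChart.open_source, h.mem_domChart_source,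
    ?_, ?_, ?_, ?_, ?_⟩
  · exact hψc.continuousOn.isOpen_inter_preimage (h.codChart.open_source.prod isOpen_univ)
      (OpenPartialHomeomorph.isOpen_extend_target _)
  · exact (contDiff_snd.comp h.equiv.contDiff).contMDiff.comp_contMDiffOn
      (OpenPartialHomeomorph.contMDiffOn_extend h.domChart_mem_maximalAtlas)
  · exact hsymm.comp (hψc.mono inter_subset_left) fun y hy => hy.2
  · intro q hq
    have h1 : h.equiv.symm (ψ (f q), (h.equiv (φ q)).2) = φ q := by
      rw [← hw q hq]
      exact h.equiv.symm_apply_apply _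
    refine ⟨⟨⟨hsrc hq, mem_univ _⟩, ?_⟩, ?_⟩
    · rw [mem_preimage, h1]
      exact φ.map_source (hφs q hq)
    · simp only [h1]
      exact φ.left_inv (hφs q hq)
  · rintro ⟨m, c⟩ ⟨⟨hm, -⟩, hc⟩
    have hq : φ.symm (h.equiv.symm (ψ m, c)) ∈ h.domChart.source := by
      have := φ.map_target hc
      rwa [hφ, OpenPartialHomeomorph.extend_source] at this
    refine ψ.injOn (hψs _ (hsrc hq)) (hψs _ hm) ?_
    rw [← hw _ hq, φ.right_inv hc, h.equiv.apply_symm_apply]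

namespace SmoothPrincipalBundle

variable {EH EM HM EP HP : Type*} [NormedAddCommGroup EH] [NormedSpace ℝ EH]
  [NormedAddCommGroup EM] [NormedSpace ℝ EM] [TopologicalSpace HM]
  [NormedAddCommGroup EP] [NormedSpace ℝ EP] [TopologicalSpace HP]
  {H : Type*} [Group H] [TopologicalSpace H] [ChartedSpace EH H] [LieGroup 𝓘(ℝ, EH) ∞ H]
  {IM : ModelWithCorners ℝ EM HM} {M : Type*} [TopologicalSpace M] [ChartedSpace HM M]
  {IP : ModelWithCorners ℝ EP HP} {P : Type*} [TopologicalSpace P] [ChartedSpace HP P]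
  (ℬ : SmoothPrincipalBundle 𝓘(ℝ, EH) H IM M IP P)

theorem proj_surjective : Surjective ℬ.proj := fun m => by
  obtain ⟨e, hm, -⟩ := ℬ.locTriv m
  exact ⟨e.toOpenPartialHomeomorph.symm (m, 1), e.proj_symm_apply' hm⟩

theorem hasLocalTransports : HasLocalTransports ℬ.proj := by
  intro m
  obtain ⟨e, hm, -⟩ := ℬ.locTriv m
  refine ⟨e.baseSet, fun q => e.toOpenPartialHomeomorph.symm (q.2, (e q.1).2), e.open_baseSet, hm,
    ?_, fun p y _ hy => e.proj_symm_apply' hy, fun p hp => ?_⟩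
  · refine e.continuousOn_invFun.comp (continuous_snd.continuousOn.prodMk
      (continuous_snd.comp_continuousOn (e.continuousOn_toFun.comp continuous_fst.continuousOn
        fun q hq => e.mem_source.2 hq.1))) fun q hq => e.mem_target.2 hq.2
  · exact e.symm_apply_mk_proj (e.mem_source.2 hp)

theorem hasVerticalCharts : HasVerticalCharts EH IP IM ℬ.proj := by
  intro p
  obtain ⟨e, hm, he, he', -⟩ := ℬ.locTriv (ℬ.proj p)
  set ψ := chartAt EH (e p).2
  have h2 : ContMDiffOn IP 𝓘(ℝ, EH) ∞ (fun q => (e q).2) e.source :=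
    contMDiff_snd.comp_contMDiffOn he
  refine ⟨e.source ∩ (fun q => (e q).2) ⁻¹' ψ.source, fun q => ψ (e q).2, e.baseSet ×ˢ ψ.target,
    fun y => e.toOpenPartialHomeomorph.symm (y.1, ψ.symm y.2),
    h2.continuousOn.isOpen_inter_preimage e.open_source ψ.open_source,
    ⟨e.mem_source.2 hm, mem_chart_source _ _⟩, e.open_baseSet.prod ψ.open_target, ?_, ?_, ?_, ?_⟩
  · exact (contMDiffOn_chart (I := 𝓘(ℝ, EH))).comp (h2.mono inter_subset_left) fun q hq => hq.2
  · refine he'.comp (contMDiff_fst.contMDiffOn.prodMk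
      ((contMDiffOn_chart_symm (I := 𝓘(ℝ, EH))).comp contMDiff_snd.contMDiffOn
        fun y hy => hy.2)) fun y hy => e.mem_target.2 hy.1
  · rintro q ⟨hq, hq'⟩
    refine ⟨⟨e.mem_source.1 hq, ψ.map_source hq'⟩, ?_⟩
    simp only [ψ.left_inv hq']
    exact e.symm_apply_mk_proj hq
  · rintro ⟨m, c⟩ ⟨hm, -⟩
    exact e.proj_symm_apply' hm

theorem existsUnique_ract {p q : P} (h : ℬ.proj p = ℬ.proj q) : ∃! k, ℬ.ract p k = q := by
  obtain ⟨e, hm, -, -, hr⟩ := ℬ.locTriv (ℬ.proj p)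
  have hp : p ∈ e.source := e.mem_source.2 hm
  have hq : q ∈ e.source := e.mem_source.2 (h ▸ hm)
  have hpr : ∀ k, ℬ.ract p k ∈ e.source := fun k => e.mem_source.2 (by rwa [ℬ.proj_ract])
  refine ⟨(e p).2⁻¹ * (e q).2, ?_, ?_⟩
  · refine e.injOn (hpr _) hq (Prod.ext ?_ ?_)
    · change (e _).1 = (e _).1
      rw [e.coe_fst (hpr _), e.coe_fst hq, ℬ.proj_ract, h]
    · change (e _).2 = (e _).2
      rw [hr p hp, mul_inv_cancel_left]
  · rintro k rfl
    rw [hr p hp, inv_mul_cancel_left]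

variable {ℬ} {s : M → P} (hs : ContMDiff IM IP ∞ s) (hsp : ∀ m, ℬ.proj (s m) = m)

/-- A smooth section trivializes a principal bundle. -/
def diffeomorphOfSection : (M × H) ≃ₘ^∞⟮IM.prod 𝓘(ℝ, EH), IP⟯ P where
  toFun q := ℬ.ract (s q.1) q.2
  invFun p := (ℬ.proj p, (ℬ.existsUnique_ract (hsp (ℬ.proj p))).choose)
  left_inv q := by
    have h1 : ℬ.proj (ℬ.ract (s q.1) q.2) = q.1 := by rw [ℬ.proj_ract, hsp]
    refine Prod.ext h1 ?_
    refine ((ℬ.existsUnique_ract (hsp (ℬ.proj (ℬ.ract (s q.1) q.2)))).choose_spec.2 q.2 ?_).symm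
    simp only [h1]
  right_inv p := (ℬ.existsUnique_ract (hsp (ℬ.proj p))).choose_spec.1
  contMDiff_toFun := ℬ.smooth_ract.comp ((hs.comp contMDiff_fst).prodMk contMDiff_snd)
  contMDiff_invFun := by
    refine ℬ.smooth_proj.prodMk fun p => ?_
    obtain ⟨e, hm, he, -, hr⟩ := ℬ.locTriv (ℬ.proj p)
    have hsrc : ∀ q ∈ e.source, s (ℬ.proj q) ∈ e.source := fun q hq =>
      e.mem_source.2 (by rw [hsp]; exact e.mem_source.1 hq)
    have h2 : ContMDiffOn IP 𝓘(ℝ, EH) ∞ (fun q => (e q).2) e.source :=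
      contMDiff_snd.comp_contMDiffOn he
    have h3 : ContMDiffOn IP 𝓘(ℝ, EH) ∞ (fun q => ((e (s (ℬ.proj q))).2)⁻¹ * (e q).2) e.source :=
      (h2.comp (hs.comp ℬ.smooth_proj).contMDiffOn hsrc).inv.mul h2
    have hn : e.source ∈ 𝓝 p := e.open_source.mem_nhds (e.mem_source.2 hm)
    refine (h3.contMDiffAt hn).congr_of_eventuallyEq ?_
    filter_upwards [hn] with q hq
    have h4 := (ℬ.existsUnique_ract (hsp (ℬ.proj q))).choose_spec.1
    have h5 := hr _ (hsrc q hq) (ℬ.existsUnique_ract (hsp (ℬ.proj q))).choose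
    simp only at h4
    rw [h4] at h5
    rw [h5, inv_mul_cancel_left]

theorem diffeomorphOfSection_apply (q : M × H) :
    diffeomorphOfSection hs hsp q = ℬ.ract (s q.1) q.2 := rfl

end SmoothPrincipalBundle

end VerticalCharts

/-! ### Extensions of Lie groupoids are locally trivial -/

section Extensions

variable {EΓ HΓ EM HM ER HR : Type*} [NormedAddCommGroup EΓ] [NormedSpace ℝ EΓ]
  [TopologicalSpace HΓ] [NormedAddCommGroup EM] [NormedSpace ℝ EM] [TopologicalSpace HM]
  [NormedAddCommGroup ER] [NormedSpace ℝ ER] [TopologicalSpace HR]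
  {IΓ : ModelWithCorners ℝ EΓ HΓ} {Γ : Type*} [TopologicalSpace Γ] [ChartedSpace HΓ Γ]
  {IM : ModelWithCorners ℝ EM HM} {M : Type*} [TopologicalSpace M] [ChartedSpace HM M]
  {𝒢 : LieGroupoid IΓ Γ IM M}
  {IR : ModelWithCorners ℝ ER HR} {R : Type*} [TopologicalSpace R] [ChartedSpace HR R]

theorem LieGroupoid.IsHom.map_inv {ℛ : LieGroupoid IR R IM M} {φ : R → Γ}
    (h : ℛ.IsHom 𝒢 φ) (r : R) : φ (ℛ.inv r) = 𝒢.inv (φ r) := by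
  have hc : 𝒢.tgt (φ r) = 𝒢.src (φ (ℛ.inv r)) := by rw [h.map_tgt, h.map_src, ℛ.src_inv]
  rw [← 𝒢.inv_mul_cancel_left hc, ← h.map_mul _ _ (ℛ.src_inv r).symm, ℛ.mul_inv, h.map_unit,
    ← h.map_src, ← 𝒢.tgt_inv, 𝒢.mul_unit]

variable {EG HG : Type*} [NormedAddCommGroup EG] [NormedSpace ℝ EG] [TopologicalSpace HG]
  {IG : ModelWithCorners ℝ EG HG} {G : Type*} [Group G] [TopologicalSpace G] [ChartedSpace HG G]
  (A : LieGroupoidGExtension IG G 𝒢 IR R)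

/-- The difference `r • s⁻¹` of two points of a fibre lies in the kernel. -/
theorem LieGroupoidGExtension.φ_mul_inv {r s : R} (h : A.φ r = A.φ s) :
    A.φ (A.gpd.mul r (A.gpd.inv s)) = 𝒢.unit (𝒢.src (A.φ r)) := by
  rw [A.φ_hom.map_mul, A.φ_hom.map_inv, h, 𝒢.mul_inv]
  rw [A.gpd.src_inv, ← A.φ_hom.map_tgt, h, A.φ_hom.map_tgt]

theorem LieGroupoidGExtension.hasLocalTransports {F : Type*} [NormedAddCommGroup F]
    [NormedSpace ℝ F] (hF : HasVerticalCharts F IR IΓ A.φ) : HasLocalTransports A.φ := by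
  intro y₀
  obtain ⟨r₀, rfl⟩ := A.φ_surjective y₀
  obtain ⟨O, v, E, w, -, hr₀, hE, -, hw, hOE, hEφ⟩ := hF r₀
  obtain ⟨V, hV, hmV, τ, κ, hτ, hκ, hτκ, hκτ, -⟩ := A.kernel_locTriv (𝒢.src (A.φ r₀))
  set D : Set Γ := (fun y => (y, v r₀)) ⁻¹' E ∩ 𝒢.src ⁻¹' V
  set S : Γ → R := fun y => w (y, v r₀)
  have hDo : IsOpen D := (hE.preimage (by fun_prop)).inter
    (hV.preimage 𝒢.src_submersion.contMDiff.continuous)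
  have hSφ : ∀ y ∈ D, A.φ (S y) = y := fun y hy => hEφ _ hy.1
  have hSc : ContinuousOn S D :=
    hw.continuousOn.comp (by fun_prop : Continuous fun y : Γ => (y, v r₀)).continuousOn
      fun y hy => hy.1
  have hk : ∀ r, A.φ r ∈ D → A.φ (A.gpd.mul r (A.gpd.inv (S (A.φ r)))) =
      𝒢.unit (𝒢.src (A.φ r)) := fun r hr => A.φ_mul_inv (hSφ _ hr).symm
  refine ⟨D, fun q => A.gpd.mul (τ (𝒢.src q.2, κ (A.gpd.mul q.1 (A.gpd.inv (S (A.φ q.1))))))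
    (S q.2), hDo, ⟨(hOE _ hr₀).1, hmV⟩, ?_, ?_, ?_⟩
  · have h1 : ContinuousOn (fun q : R × Γ => S (A.φ q.1)) ((A.φ ⁻¹' D) ×ˢ D) :=
      hSc.comp (A.φ_hom.smooth.continuous.comp continuous_fst).continuousOn fun q hq => hq.1
    have h2 : ContinuousOn (fun q : R × Γ => A.gpd.mul q.1 (A.gpd.inv (S (A.φ q.1))))
        ((A.φ ⁻¹' D) ×ˢ D) := by
      refine A.gpd.smooth_mul.continuousOn.comp (continuous_fst.continuousOn.prodMk
        (A.gpd.smooth_inv.continuous.comp_continuousOn h1)) fun q hq => ?_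
      change A.gpd.tgt q.1 = A.gpd.src (A.gpd.inv (S (A.φ q.1)))
      rw [A.gpd.src_inv, ← A.φ_hom.map_tgt, ← A.φ_hom.map_tgt, hSφ _ hq.1]
    have h3 := hκ.continuousOn.comp h2 fun q hq => ⟨_, hq.1.2, hk _ hq.1⟩
    have h4 : ContinuousOn (fun q : R × Γ => 𝒢.src q.2) ((A.φ ⁻¹' D) ×ˢ D) :=
      (𝒢.src_submersion.contMDiff.continuous.comp continuous_snd).continuousOn
    have h5 := hτ.continuousOn.comp (h4.prodMk h3) fun q hq => ⟨hq.2.2, mem_univ _⟩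
    refine A.gpd.smooth_mul.continuousOn.comp (h5.prodMk
      (hSc.comp continuous_snd.continuousOn fun q hq => hq.2)) fun q hq => ?_
    exact (A.tgt_of_mem_kernel (hτκ _ hq.2.2 _).1).trans
      (by
      change 𝒢.src q.2 = A.gpd.src (S q.2)
      rw [← A.φ_hom.map_src, hSφ _ hq.2])
  · intro r y hr hy
    have hc : A.gpd.tgt (τ (𝒢.src y, κ (A.gpd.mul r (A.gpd.inv (S (A.φ r)))))) =
        A.gpd.src (S y) :=
      (A.tgt_of_mem_kernel (hτκ _ hy.2 _).1).trans (by rw [← A.φ_hom.map_src, hSφ _ hy])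
    simp only
    rw [A.φ_hom.map_mul _ _ hc, (hτκ _ hy.2 _).1, hSφ _ hy, 𝒢.unit_mul]
  · intro r hr
    simp only
    rw [hκτ _ hr.2 _ (hk r hr)]
    refine A.gpd.inv_mul_cancel_right ?_
    rw [← A.φ_hom.map_tgt, ← A.φ_hom.map_tgt, hSφ _ hr]

end Extensions

end

noncomputable section

/-! ### The inverse of the band along a section -/

section BandInverse

variable {EG EM EΓ HΓ EH HH ER HR EP HP : Type*}
  [NormedAddCommGroup EG] [NormedSpace ℝ EG] [NormedAddCommGroup EM] [NormedSpace ℝ EM]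
  [NormedAddCommGroup EΓ] [NormedSpace ℝ EΓ] [TopologicalSpace HΓ]
  [NormedAddCommGroup EH] [NormedSpace ℝ EH] [TopologicalSpace HH]
  [NormedAddCommGroup ER] [NormedSpace ℝ ER] [TopologicalSpace HR]
  [NormedAddCommGroup EP] [NormedSpace ℝ EP] [TopologicalSpace HP]
  {G : Type*} [Group G] [TopologicalSpace G] [ChartedSpace EG G] [IsManifold 𝓘(ℝ, EG) ∞ G]
  {IH : ModelWithCorners ℝ EH HH} {H : Type*} [Group H] [TopologicalSpace H] [ChartedSpace HH H]
  {X : LieCrossedModule 𝓘(ℝ, EG) G IH H}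
  {IΓ : ModelWithCorners ℝ EΓ HΓ} {Γ : Type*} [TopologicalSpace Γ] [ChartedSpace HΓ Γ]
  {M : Type*} [TopologicalSpace M] [ChartedSpace EM M] [IsManifold 𝓘(ℝ, EM) ∞ M]
  {𝒢 : LieGroupoid IΓ Γ 𝓘(ℝ, EM) M}
  {IR : ModelWithCorners ℝ ER HR} {R : Type*} [TopologicalSpace R] [ChartedSpace HR R]
  {IP : ModelWithCorners ℝ EP HP} {P : Type*} [TopologicalSpace P] [ChartedSpace HP P]

namespace GHExtensionOn

variable (A : GHExtensionOn X 𝒢 IR R IP P) (s : M → P)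

/-- The map from the kernel of an extension to `G` that inverts `χ(s(m))` on the fibre over `m`. -/
def bandInverse (k : R) : G := (A.χ (s (A.gpd.src k))).exists_inverse.choose k

variable {A s}

theorem bandInverse_eq_choose {m : M} {k : R} (hk : A.gpd.src k = m) :
    A.bandInverse s k = (A.χ (s m)).exists_inverse.choose k := by
  subst hk
  rfl

variable (hs : ContMDiff 𝓘(ℝ, EM) IP ∞ s) (hsp : ∀ m, A.bundle.proj (s m) = m)
include hsp

theorem bandInverse_toFun (m : M) (g : G) : A.bandInverse s ((A.χ (s m)).toFun g) = g := by
  rw [bandInverse_eq_choose (((A.χ (s m)).src_toFun g).trans (hsp m))]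
  exact (A.χ (s m)).exists_inverse.choose_spec.2.1 g

theorem toFun_bandInverse {m : M} {k : R} (hk : A.φ k = 𝒢.unit m) :
    (A.χ (s m)).toFun (A.bandInverse s k) = k := by
  obtain rfl : A.gpd.src k = m := A.src_of_mem_kernel hk
  exact (A.χ (s (A.gpd.src k))).exists_inverse.choose_spec.2.2 k (by rwa [hsp])

theorem φ_toFun (m : M) (g : G) : A.φ ((A.χ (s m)).toFun g) = 𝒢.unit m := by
  rw [(A.χ (s m)).mem_kernel, hsp]

include hs

theorem contMDiffOn_bandInverse [CompleteSpace EM] [CompleteSpace EG] :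
    ContMDiffOn IR 𝓘(ℝ, EG) ∞ (A.bandInverse s) {k | ∃ m, A.φ k = 𝒢.unit m} := by
  rintro k₀ ⟨m₀, hk₀⟩
  obtain rfl : A.gpd.src k₀ = m₀ := A.src_of_mem_kernel hk₀
  set m₀ := A.gpd.src k₀
  obtain ⟨V, hV, hmV, τ, κ, hτ, hκ, hτκ, hκτ, -⟩ := A.kernel_locTriv m₀
  have hθ : ContMDiffOn (𝓘(ℝ, EM).prod 𝓘(ℝ, EG)) 𝓘(ℝ, EG) ∞
      (fun q : M × G => κ ((A.χ (s q.1)).toFun q.2)) (V ×ˢ univ) :=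
    hκ.comp (A.smooth_χ.comp ((hs.comp contMDiff_fst).prodMk contMDiff_snd)).contMDiffOn
      fun q hq => ⟨q.1, hq.1, φ_toFun hsp _ _⟩
  have hη : ContMDiff 𝓘(ℝ, EG) 𝓘(ℝ, EG) ∞ fun g => A.bandInverse s (τ (m₀, g)) := by
    have h1 : ContMDiff 𝓘(ℝ, EG) IR ∞ fun g => τ (m₀, g) := by
      rw [← contMDiffOn_univ]
      exact hτ.comp (contMDiff_const.prodMk contMDiff_id).contMDiffOn fun g _ => ⟨hmV, mem_univ _⟩
    have h2 := (A.χ (s m₀)).exists_inverse.choose_spec.1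
    rw [← contMDiffOn_univ] at h1 ⊢
    refine (h2.comp h1 fun g _ => ?_).congr fun g _ => ?_
    · exact (hτκ _ hmV g).1.trans (by rw [hsp])
    · rw [bandInverse_eq_choose (A.src_of_mem_kernel (hτκ _ hmV g).1)]
      rfl
  have key := contMDiffAt_fiberwise_inverse (η := fun q : M × G => A.bandInverse s (τ q))
    (k₀ := κ k₀) (hV.mem_nhds hmV)
    (hθ.contMDiffAt ((hV.prod isOpen_univ).mem_nhds ⟨hmV, mem_univ _⟩)) hη
    (fun m hm g => by
      simp only
      rw [hκτ m hm _ (φ_toFun hsp _ _), bandInverse_toFun hsp])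
    (fun m hm k => by
      simp only
      rw [toFun_bandInverse hsp (hτκ m hm k).1, (hτκ m hm k).2])
  have hnhds : {k | ∃ m ∈ V, A.φ k = 𝒢.unit m} ∈ 𝓝[{k | ∃ m, A.φ k = 𝒢.unit m}] k₀ := by
    filter_upwards [self_mem_nhdsWithin, nhdsWithin_le_nhds
      ((hV.preimage A.gpd.src_submersion.contMDiff.continuous).mem_nhds hmV)]
    rintro k ⟨m, hk⟩ hkV
    rw [mem_preimage, A.src_of_mem_kernel hk] at hkV
    exact ⟨m, hkV, hk⟩
  have h3 : ContMDiffWithinAt IR 𝓘(ℝ, EG) ∞ κ {k | ∃ m, A.φ k = 𝒢.unit m} k₀ :=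
    (hκ k₀ ⟨m₀, hmV, hk₀⟩).mono_of_mem_nhdsWithin hnhds
  have h4 := key.comp_contMDiffWithinAt k₀
    (f := fun k => (A.gpd.src k, κ k))
    (A.gpd.src_submersion.contMDiff.contMDiffAt.contMDiffWithinAt.prodMk h3)
  refine h4.congr_of_eventuallyEq ?_ ?_
  · filter_upwards [hnhds]
    rintro k ⟨m, hm, hk⟩
    simp only [comp_apply]
    rw [A.src_of_mem_kernel hk, hκτ m hm k hk]
  · simp only [comp_apply]
    rw [hκτ _ hmV k₀ hk₀]

end GHExtensionOn

end BandInverse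

/-! ### Extensions of the Čech groupoid of a good cover -/

section GoodCover

variable {EN : Type*} [NormedAddCommGroup EN] [NormedSpace ℝ EN] [FiniteDimensional ℝ EN]
  {N : Type u} [TopologicalSpace N] [ChartedSpace EN N] [IsManifold 𝓘(ℝ, EN) ∞ N]

theorem Coprod.contMDiff_mk {ι : Type*} {V : ι → Opens N} (i : ι) :
    ContMDiff 𝓘(ℝ, EN) 𝓘(ℝ, EN) ∞ fun x : V i => (⟨i, x⟩ : Coprod V) := fun _ =>
  Coprod.contMDiffWithinAt_of_val (.of_forall fun _ => rfl) contMDiff_subtype_val.contMDiffAt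

theorem Coprod.exists_contMDiff_section [T2Space N] [SecondCountableTopology N]
    {ι : Type*} {V : ι → Opens N} (hV : ∀ i, IsEmpty (V i) ∨ ContractibleSpace (V i))
    {F EP HP : Type*} [NormedAddCommGroup F] [NormedSpace ℝ F] [NormedAddCommGroup EP]
    [NormedSpace ℝ EP] [TopologicalSpace HP] {IP : ModelWithCorners ℝ EP HP}
    {P : Type*} [TopologicalSpace P] [ChartedSpace HP P] {π : P → Coprod V}
    (hπ : HasVerticalCharts F IP 𝓘(ℝ, EN) π) (hπ' : HasLocalTransports π) (hπs : Surjective π) :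
    ∃ s : Coprod V → P, ContMDiff 𝓘(ℝ, EN) IP ∞ s ∧ ∀ a, π (s a) = a := by
  have h : ∀ i, ∃ s : V i → P, ContMDiff 𝓘(ℝ, EN) IP ∞ s ∧ ∀ x, π (s x) = ⟨i, x⟩ := fun i => by
    have : LocallyCompactSpace (V i) := ChartedSpace.locallyCompactSpace EN (V i)
    exact exists_smooth_lift_of_contractible (hV i) hπ hπ' hπs (Coprod.contMDiff_mk i)
  choose s hs hsπ using h
  exact ⟨fun a => s a.1 a.2, contMDiff_sigma hs, fun a => hsπ a.1 a.2⟩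

variable {I : Type u} {U : I → Opens N}
  {EG EH : Type*} [NormedAddCommGroup EG] [NormedSpace ℝ EG] [FiniteDimensional ℝ EG]
  [NormedAddCommGroup EH] [NormedSpace ℝ EH]
  {G H : Type u} [Group G] [TopologicalSpace G] [ChartedSpace EG G] [LieGroup 𝓘(ℝ, EG) ∞ G]
  [Group H] [TopologicalSpace H] [ChartedSpace EH H] [LieGroup 𝓘(ℝ, EH) ∞ H]
  {X : LieCrossedModule 𝓘(ℝ, EG) G 𝓘(ℝ, EH) H}
  {ER HR EP HP : Type*} [NormedAddCommGroup ER] [NormedSpace ℝ ER] [TopologicalSpace HR]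
  [NormedAddCommGroup EP] [NormedSpace ℝ EP] [TopologicalSpace HP]
  {IR : ModelWithCorners ℝ ER HR} {R : Type*} [TopologicalSpace R] [ChartedSpace HR R]
  {IP : ModelWithCorners ℝ EP HP} {P : Type*} [TopologicalSpace P] [ChartedSpace HP P]

namespace GHExtensionOn

variable (A : GHExtensionOn X (cechGroupoid (EN := EN) U) IR R IP P)

open Classical in
/-- Over a good cover, `φ` has a smooth section that is the unit on the diagonal. -/
theorem exists_contMDiff_normalized_section [T2Space N] [SecondCountableTopology N]
    [IR.Boundaryless] [IsManifold IR ∞ R]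
    (hc : ∀ i j, IsEmpty ↥(U i ⊓ U j) ∨ ContractibleSpace ↥(U i ⊓ U j)) :
    ∃ σ : Cech1 U → R, ContMDiff 𝓘(ℝ, EN) IR ∞ σ ∧ (∀ a, A.φ (σ a) = a) ∧
      ∀ i x (hi : x ∈ U i), σ (cech1 i i x hi hi) = A.gpd.unit (cech0 i x hi) := by
  obtain ⟨F, _, _, hF⟩ := A.φ_submersion
  have hv := hF.hasVerticalCharts
  obtain ⟨σ, hσ, hσφ⟩ := Coprod.exists_contMDiff_section (fun p : I × I => hc p.1 p.2) hv
    (A.hasLocalTransports hv) A.φ_surjective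
  refine ⟨fun a => if a.1.1 = a.1.2 then A.gpd.unit ((cechGroupoid (EN := EN) U).src a) else σ a,
    contMDiff_sigma ?_, ?_, fun i x hi => if_pos rfl⟩
  · rintro ⟨i, j⟩
    have hij := Coprod.contMDiff_mk (EN := EN) (V := fun p : I × I => U p.1 ⊓ U p.2) (i, j)
    by_cases h : i = j
    · subst h
      simp only [if_true]
      exact A.gpd.smooth_unit.comp
        ((cechGroupoid (EN := EN) U).src_submersion.contMDiff.comp hij)
    · simp only [h, if_false]
      exact hσ.comp hij
  · rintro ⟨⟨i, j⟩, x⟩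
    by_cases h : i = j
    · subst h
      simp only [if_true]
      rw [A.φ_hom.map_unit]
      rfl
    · simp only [h, if_false]
      exact hσφ _

theorem exists_contMDiff_section [T2Space N] [SecondCountableTopology N]
    (hc : ∀ i j, IsEmpty ↥(U i ⊓ U j) ∨ ContractibleSpace ↥(U i ⊓ U j)) :
    ∃ s : Cech0 U → P, ContMDiff 𝓘(ℝ, EN) IP ∞ s ∧ ∀ a, A.bundle.proj (s a) = a :=
  Coprod.exists_contMDiff_section (fun i => by have := hc i i; rwa [inf_idem] at this)
    A.bundle.hasVerticalCharts A.bundle.hasLocalTransports A.bundle.proj_surjective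

variable {A} {s : Cech0 U → P} (hs : ContMDiff 𝓘(ℝ, EN) IP ∞ s)
  (hsp : ∀ a, A.bundle.proj (s a) = a) {σ : Cech1 U → R} (hσ : ContMDiff 𝓘(ℝ, EN) IR ∞ σ)
  (hσφ : ∀ a, A.φ (σ a) = a)

/-- The arrows of an extension of the Čech groupoid, in the coordinates given by sections. -/
def diffeomorphOfSections : (G × Cech1 U) ≃ₘ^∞⟮𝓘(ℝ, EG).prod 𝓘(ℝ, EN), IR⟯ R where
  toFun q := A.gpd.mul ((A.χ (s ((cechGroupoid (EN := EN) U).src q.2))).toFun q.1) (σ q.2)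
  invFun r := (A.bandInverse s (A.gpd.mul r (A.gpd.inv (σ (A.φ r)))), A.φ r)
  left_inv q := by
    have hc : A.gpd.tgt ((A.χ (s ((cechGroupoid (EN := EN) U).src q.2))).toFun q.1) =
        A.gpd.src (σ q.2) := by
      rw [A.tgt_of_mem_kernel (φ_toFun hsp _ _), ← A.φ_hom.map_src, hσφ]
    have h1 : A.φ (A.gpd.mul ((A.χ (s ((cechGroupoid (EN := EN) U).src q.2))).toFun q.1) (σ q.2)) =
        q.2 := by
      rw [A.φ_hom.map_mul _ _ hc, φ_toFun hsp, hσφ, LieGroupoid.unit_mul]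
    refine Prod.ext ?_ h1
    simp only [h1]
    rw [A.gpd.mul_inv_cancel_right hc, bandInverse_toFun hsp]
  right_inv r := by
    simp only
    rw [toFun_bandInverse hsp (A.φ_mul_inv (hσφ _).symm)]
    refine A.gpd.inv_mul_cancel_right ?_
    rw [← A.φ_hom.map_tgt, ← A.φ_hom.map_tgt, hσφ]
  contMDiff_toFun := by
    rw [← contMDiffOn_univ]
    refine A.gpd.smooth_mul.comp (ContMDiff.contMDiffOn ((A.smooth_χ.comp ((hs.comp
      ((cechGroupoid (EN := EN) U).src_submersion.contMDiff.comp contMDiff_snd)).prodMk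
        contMDiff_fst)).prodMk (hσ.comp contMDiff_snd))) fun q _ => ?_
    change A.gpd.tgt ((A.χ (s ((cechGroupoid (EN := EN) U).src q.2))).toFun q.1) =
        A.gpd.src (σ q.2)
    rw [A.tgt_of_mem_kernel (φ_toFun hsp _ _), ← A.φ_hom.map_src, hσφ]
  contMDiff_invFun := by
    have : CompleteSpace EN := FiniteDimensional.complete ℝ EN
    have : CompleteSpace EG := FiniteDimensional.complete ℝ EG
    refine ContMDiff.prodMk ?_ A.φ_hom.smooth
    have h1 : ContMDiff IR IR ∞ fun r => A.gpd.mul r (A.gpd.inv (σ (A.φ r))) := by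
      rw [← contMDiffOn_univ]
      refine A.gpd.smooth_mul.comp (contMDiff_id.prodMk
        (A.gpd.smooth_inv.comp (hσ.comp A.φ_hom.smooth))).contMDiffOn fun r _ => ?_
      change A.gpd.tgt r = A.gpd.src (A.gpd.inv (σ (A.φ r)))
      rw [A.gpd.src_inv, ← A.φ_hom.map_tgt, ← A.φ_hom.map_tgt, hσφ]
    rw [← contMDiffOn_univ] at h1 ⊢
    exact (contMDiffOn_bandInverse hs hsp).comp h1 fun r _ => ⟨_, A.φ_mul_inv (hσφ _).symm⟩

/-- Coordinates given by sections of the bundle and of the extension. -/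
def frameOfSections
    (hσu : ∀ i x (hi : x ∈ U i), σ (cech1 i i x hi hi) = A.gpd.unit (cech0 i x hi)) : A.Frame where
  Φ := diffeomorphOfSections hs hsp hσ hσφ
  Ψ := SmoothPrincipalBundle.diffeomorphOfSection hs hsp
  φ_Φ r := congrArg Prod.snd ((diffeomorphOfSections hs hsp hσ hσφ).left_inv r)
  proj_Ψ p := by rw [SmoothPrincipalBundle.diffeomorphOfSection_apply, A.bundle.proj_ract, hsp]
  Ψ_mul x h h' := A.bundle.ract_mul _ _ _
  χ_Ψ i x hi h g := by
    change (A.χ (A.bundle.ract (s (cech0 i x hi)) h)).toFun g = A.gpd.mul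
      ((A.χ (s (cech0 i x hi))).toFun (X.act h g)) (σ (cech1 i i x hi hi))
    have h1 := A.gpd.mul_unit ((A.χ (s (cech0 i x hi))).toFun (X.act h g))
    rw [A.tgt_of_mem_kernel (φ_toFun hsp _ _)] at h1
    rw [A.χ_ract, hσu, h1]
  Φ_mul i j x hi hj g g' := by
    change A.gpd.mul ((A.χ (s (cech0 i x hi))).toFun (g * g')) (σ (cech1 i j x hi hj)) =
      A.gpd.mul (A.gpd.mul ((A.χ (s (cech0 i x hi))).toFun g) (σ (cech1 i i x hi hi)))
        (A.gpd.mul ((A.χ (s (cech0 i x hi))).toFun g') (σ (cech1 i j x hi hj)))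
    have h1 : ∀ g, A.gpd.tgt ((A.χ (s (cech0 i x hi))).toFun g) = cech0 i x hi := fun g =>
      A.tgt_of_mem_kernel (φ_toFun hsp _ _)
    have h2 : ∀ g, A.gpd.src ((A.χ (s (cech0 i x hi))).toFun g) = cech0 i x hi := fun g =>
      A.src_of_mem_kernel (φ_toFun hsp _ _)
    have h3 : A.gpd.src (σ (cech1 i j x hi hj)) = cech0 i x hi := by
      rw [← A.φ_hom.map_src, hσφ]
      rfl
    have h4 := A.gpd.mul_unit ((A.χ (s (cech0 i x hi))).toFun g)
    rw [h1] at h4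
    rw [hσu, h4, (A.χ (s (cech0 i x hi))).map_mul, A.gpd.mul_assoc]
    · rw [h1, h2]
    · rw [h1, h3]

theorem nonempty_frame [T2Space N] [SecondCountableTopology N]
    [IR.Boundaryless] [IsManifold IR ∞ R]
    (hc : ∀ i j, IsEmpty ↥(U i ⊓ U j) ∨ ContractibleSpace ↥(U i ⊓ U j)) : Nonempty A.Frame := by
  obtain ⟨s, hs, hsp⟩ := A.exists_contMDiff_section hc
  obtain ⟨σ, hσ, hσφ, hσu⟩ := A.exists_contMDiff_normalized_section hc
  exact ⟨frameOfSections hs hsp hσ hσφ hσu⟩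

end GHExtensionOn

end GoodCover

theorem mainTheorem5 {EN EG EH : Type*}
    [NormedAddCommGroup EN] [NormedSpace ℝ EN] [FiniteDimensional ℝ EN]
    [NormedAddCommGroup EG] [NormedSpace ℝ EG] [FiniteDimensional ℝ EG]
    [NormedAddCommGroup EH] [NormedSpace ℝ EH] [FiniteDimensional ℝ EH]
    {N I G H : Type u}
    [TopologicalSpace N] [T2Space N] [SecondCountableTopology N]
    [ChartedSpace EN N] [IsManifold 𝓘(ℝ, EN) ∞ N]
    [Group G] [TopologicalSpace G] [ChartedSpace EG G] [LieGroup 𝓘(ℝ, EG) ∞ G]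
    [Group H] [TopologicalSpace H] [ChartedSpace EH H] [LieGroup 𝓘(ℝ, EH) ∞ H]
    (X : LieCrossedModule 𝓘(ℝ, EG) G 𝓘(ℝ, EH) H)
    (U : I → Opens N) (hU : ⨆ i, U i = ⊤)
    (hc : ∀ i j, IsEmpty ↥(U i ⊓ U j) ∨ ContractibleSpace ↥(U i ⊓ U j)) :
    ∃ (e₁ : NonabelianH1 (EN := EN) U X ≃ AdaptedExtensionClasses (EN := EN) U X)
      (e₂ : AdaptedExtensionClasses (EN := EN) U X ≃ CechExtensionClasses (EN := EN) U X),
      (∀ A : AdaptedExtension (EN := EN) U X, ∃ c : NonabelianCocycle (EN := EN) U X,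
        A.HasCocycle c ∧ e₁ (Quotient.mk _ c) = Quotient.mk _ A) ∧
      ∀ A : AdaptedExtension (EN := EN) U X,
        e₂ (Quotient.mk _ A) = Quotient.mk _ A.toGHExtension := by
  let m₁ : NonabelianH1 (EN := EN) U X → AdaptedExtensionClasses (EN := EN) U X :=
    Quotient.map NonabelianCocycle.model fun _ _ ⟨_, _, h⟩ => h.modelOn_isomorphic
  let m₂ : AdaptedExtensionClasses (EN := EN) U X → CechExtensionClasses (EN := EN) U X :=
    Quotient.map AdaptedExtension.toGHExtension fun _ _ h => h
  have h₁ : Bijective m₁ := by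
    refine ⟨?_, ?_⟩
    · rintro ⟨c⟩ ⟨c'⟩ h
      exact Quotient.sound (NonabelianCocycle.cohomologous_of_modelOn_isomorphic (Quotient.exact h))
    · rintro ⟨A⟩
      exact ⟨Quotient.mk _ A.frame.cocycle, Quotient.sound A.frame.isomorphic_model⟩
  have h₂ : Bijective m₂ := by
    refine ⟨?_, ?_⟩
    · rintro ⟨A⟩ ⟨B⟩ h
      exact Quotient.sound (Quotient.exact h : A.toGHExtension ≈ B.toGHExtension)
    · rintro ⟨A⟩
      obtain ⟨f⟩ := GHExtensionOn.nonempty_frame (A := A.ext) hc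
      exact ⟨Quotient.mk _ f.cocycle.model, Quotient.sound f.isomorphic_model⟩
  exact ⟨Equiv.ofBijective m₁ h₁, Equiv.ofBijective m₂ h₂,
    fun A => ⟨A.frame.cocycle, A.hasCocycle, Quotient.sound A.frame.isomorphic_model⟩,
    fun A => rfl⟩

end
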